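/- **Setting.** Let $M$ be a finite-dimensional $C^1$ manifold without boundary, whose topology is given by a metric $\mathrm{dist}$, with a continuous Riemannian metric $\|\cdot\|$ on $TM$, and let $f:M\to M$ be a $C^1$ diffeomorphism. A set $Z\subset M$ is *invariant* if $f(Z)=Z$. For an invariant set $Y$, a point $x\in Y$ is *chain recurrent* for $f|_Y$ if for every $\varepsilon>0$ there are $n\ge 1$ and $p_0=x,p_1,\dots,p_n=x$ in $Y$ with $\mathrm{dist}(f(p_i),p_{i+1})<\varepsilon$ for $0\le i<n$. A splitting $T_ZM=E^u\oplus E^s$ over an invariant set $Z$ is *dominated* if $E^u$ and $E^s$ are continuous, $Df$-invariant, non-zero subbundles of $T_ZM$ and there is $n_0$ such that for all $n>n_0$ and all $x\in Z$ $$\log m\bigl(Df^n|_{E^u(x)}\bigr)-\log\bigl\|Df^n|_{E^s(x)}\bigr\|>0,$$ where $\|A\|=\sup\{\|Av\|:\|v\|=1\}$ and $m(A)=\inf\{\|Av\|:\|v\|=1\}$. For a non-zero $v\in TM$ and $n\in\mathbb Z$ put $v^n=Df^nv/\|Df^nv\|$. A sequence in $TM$ *accumulates on* a set $S\subset TM$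 if it has an accumulation point in $S$. **Theorem.** (1) Suppose $M$ is compact. Let $Z\subset M$ be an invariant set which contains all chain-recurrent points of $f$ and which has a dominated splitting $T_ZM=E^u\oplus E^s$ with $\dim E^u=d$. Suppose that for every $x\in M\setminus Z$ there are a point $y$ in the orbit $\{f^k(x):k\in\mathbb Z\}$ and a $d$-dimensional subspace $V_y\subset T_yM$ such that for every non-zero $v\in V_y$ each of the sequences $v^n$ and $v^{-n}$ accumulates on $E^u$ as $n\to+\infty$. Then the splitting on $Z$ extends to a dominated splitting on all of $M$. (2) In general ($M$ not necessarily compact), let $Y$ and $Z$ be compact invariant subsets of $M$ such that all chain-recurrent points of $f|_Y$ lie in $Z$ and $Z$ has a dominated splitting $T_ZM=E^u\oplus E^s$ with $\dim E^u=d$. Suppose that for every $x\in Y\setminus Z$ there are a point $y$ in the orbit of $x$ and a $d$-dimensional subspace $V_y\subset T_yM$ such that for every non-zero $v\in V_y$ each of the sequences $v^n$ and $v^{-n}$ accumulates on a vector in $T_ZM\setminus E^s$ as $n\to+\infty$. Then the splitting on $Z$ extends to a dominated splitting on $Y\cup Z$. -/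

import Mathlib

open Set Filter Topology Manifold Bundle

/-- The norm `sup {‖A v‖ : v ∈ S, ‖v‖ = 1}` of the restriction of a linear operator `A`
to a subspace `S`. -/
noncomputable def normOn {V W : Type*} [NormedAddCommGroup V] [NormedSpace ℝ V]
    [NormedAddCommGroup W] [NormedSpace ℝ W] (A : V →L[ℝ] W) (S : Submodule ℝ V) : ℝ :=
  sSup {r : ℝ | ∃ v ∈ S, ‖v‖ = 1 ∧ ‖A v‖ = r}

/-- The conorm `inf {‖A v‖ : v ∈ S, ‖v‖ = 1}` of the restriction of a linear operator `A`
to a subspace `S`. -/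
noncomputable def conormOn {V W : Type*} [NormedAddCommGroup V] [NormedSpace ℝ V]
    [NormedAddCommGroup W] [NormedSpace ℝ W] (A : V →L[ℝ] W) (S : Submodule ℝ V) : ℝ :=
  sInf {r : ℝ | ∃ v ∈ S, ‖v‖ = 1 ∧ ‖A v‖ = r}

/-- A sequence of functions `α n` is eventually positive on `Z` if there is `n₀` such that
`α n` is positive at every point of `Z` for all `n > n₀`. -/
def EventuallyPositiveOn {M : Type*} (Z : Set M) (α : ℕ → M → ℝ) : Prop :=
  ∃ n₀ : ℕ, ∀ n > n₀, ∀ x ∈ Z, 0 < α n x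

/-- The chain-recurrent points of the restriction of `f` to an invariant set `Y`: the points
`x ∈ Y` such that for every `ε > 0` there is an `ε`-pseudo-orbit
`x = p 0, p 1, …, p n = x` in `Y`, of length `n ≥ 1`. -/
def chainRecurrentOn {M : Type*} [MetricSpace M] (f : M → M) (Y : Set M) : Set M :=
  {x | x ∈ Y ∧ ∀ ε > (0 : ℝ), ∃ n : ℕ, 1 ≤ n ∧ ∃ p : ℕ → M,
    p 0 = x ∧ p n = x ∧ (∀ i ≤ n, p i ∈ Y) ∧ ∀ i < n, dist (f (p i)) (p (i + 1)) < ε}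

section

variable {E : Type*} [NormedAddCommGroup E] [NormedSpace ℝ E]
  {M : Type*} [MetricSpace M] [ChartedSpace E M] [IsManifold 𝓘(ℝ, E) 1 M]

/-- The family of subspaces `B x ⊆ T_x M`, `x ∈ Z`, is a continuous subbundle of `T_Z M`:
near every point of `Z`, it has a frame of continuous sections over `Z`. The values of `B`
outside `Z` play no role. -/
def IsContinuousSubbundleOn (Z : Set M) (B : ∀ x : M, Submodule ℝ (TangentSpace 𝓘(ℝ, E) x)) :
    Prop :=
  ∀ x₀ ∈ Z, ∃ U : Set M, IsOpen U ∧ x₀ ∈ U ∧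
    ∃ (k : ℕ) (s : Fin k → ∀ x : M, TangentSpace 𝓘(ℝ, E) x),
      (∀ i, ContinuousOn (fun x => (⟨x, s i x⟩ : TangentBundle 𝓘(ℝ, E) M)) (U ∩ Z)) ∧
      ∀ x ∈ U ∩ Z, LinearIndependent ℝ (fun i => s i x) ∧
        Submodule.span ℝ (range fun i => s i x) = B x

variable [RiemannianBundle (fun x : M => TangentSpace 𝓘(ℝ, E) x)]

/-- `T_Z M = Eu ⊕ Es` is a dominated splitting for `f` over the invariant set `Z`, in which `Eu`
dominates `Es`. -/
structure IsDominatedSplittingOn (f : M → M) (Z : Set M)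
    (Eu Es : ∀ x : M, Submodule ℝ (TangentSpace 𝓘(ℝ, E) x)) : Prop where
  continuous_u : IsContinuousSubbundleOn Z Eu
  continuous_s : IsContinuousSubbundleOn Z Es
  ne_bot_u : ∀ x ∈ Z, Eu x ≠ ⊥
  ne_bot_s : ∀ x ∈ Z, Es x ≠ ⊥
  isCompl : ∀ x ∈ Z, IsCompl (Eu x) (Es x)
  invariant_u : ∀ x ∈ Z,
    (Eu x).map (mfderiv 𝓘(ℝ, E) 𝓘(ℝ, E) f x).toLinearMap = Eu (f x)
  invariant_s : ∀ x ∈ Z,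
    (Es x).map (mfderiv 𝓘(ℝ, E) 𝓘(ℝ, E) f x).toLinearMap = Es (f x)
  dominated : EventuallyPositiveOn Z fun n x =>
    Real.log (conormOn (mfderiv 𝓘(ℝ, E) 𝓘(ℝ, E) f^[n] x) (Eu x)) -
      Real.log (normOn (mfderiv 𝓘(ℝ, E) 𝓘(ℝ, E) f^[n] x) (Es x))

/-- The normalized iterate `Dgⁿ v / ‖Dgⁿ v‖` of a tangent vector `v` at `y`. -/
noncomputable def normalizedIterate (g : M → M) (y : M) (v : TangentSpace 𝓘(ℝ, E) y) (n : ℕ) :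
    TangentBundle 𝓘(ℝ, E) M :=
  ⟨g^[n] y, ‖mfderiv 𝓘(ℝ, E) 𝓘(ℝ, E) g^[n] y v‖⁻¹ • mfderiv 𝓘(ℝ, E) 𝓘(ℝ, E) g^[n] y v⟩

/-- The normalized iterates of `v ∈ T_y M` under `g` accumulate on some vector of
the set `S ⊆ TM`. -/
def AccumulatesOn (g : M → M) (y : M) (v : TangentSpace 𝓘(ℝ, E) y)
    (S : Set (TangentBundle 𝓘(ℝ, E) M)) : Prop :=
  ∃ w ∈ S, MapClusterPt w atTop (normalizedIterate g y v)

/-- There are a point `y` in the full orbit of `x` and a `d`-dimensional subspace `V` of `T_y M`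
such that, for every nonzero `v ∈ V`, both the forward and the backward normalized iterates of `v`
accumulate on a vector of `S`. -/
def HasAccumulatingSubspace (f : M ≃ₘ^1⟮𝓘(ℝ, E), 𝓘(ℝ, E)⟯ M) (d : ℕ)
    (S : Set (TangentBundle 𝓘(ℝ, E) M)) (x : M) : Prop :=
  ∃ y : M, (∃ k : ℤ, ((f.toEquiv : Equiv.Perm M) ^ k) x = y) ∧
    ∃ V : Submodule ℝ (TangentSpace 𝓘(ℝ, E) y), Module.finrank ℝ V = d ∧
      ∀ v ∈ V, v ≠ 0 → AccumulatesOn f y v S ∧ AccumulatesOn f.symm y v S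

end

/-! Near $Z$ the dynamics is controlled by cones. The projection to $E^u$ along $E^s$ extends to a
continuous family $Q$ of operators (`exists_projection`). By domination, some iterate maps the cone
$\|v-Qv\|\le\|Qv\|$ over a neighbourhood of $Z$ strictly inside itself, and vectors in the cone
outgrow those whose image is outside it (`eventually_cone`, `eventually_growth`). Points off $Z$ are
wandering, so compactness bounds the number of times at which an orbit can be outside a
neighbourhood of $Z$ (`exists_forall_mem_excursionSet`). Every orbit therefore ends up where the
cone estimates hold.

Consequently every vector is eventually inside the cone or, if stable, eventually outside it.
Exponential growth shows that the stable vectors form a subspace (`isStable_add`). Limits of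
subspaces bound its dimension from below (`le_finrank_stable`); pulled back subspaces of the cone
bound it from above (`finrank_stable_add_le`). The same construction for the reversed cocycle and
the complementary projection gives the candidate for $E^u$. Transversality of the two is not
automatic, and this is the role of $V_y$. Backward accumulation off $E^s$ puts $V_y$ inside the
reversed stable space, hence equal to it by dimension; forward accumulation keeps $V_y$ away from
the stable space. So the two spaces are complementary at $y$, and by invariance along its orbit.

Continuity follows from closedness of the graphs (`isClosed_isStable`), proved by induction on the
number of excursions: a failure would produce a non-zero vector stable in both time directions.
Domination follows by compactness from domination of each pair of vectors at a single time
(`IsSplittingOn.isDominatedOn`).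

All this is done for a cocycle on a trivial bundle, restricted to the ranges of a continuous family
of idempotents, and transferred through an embedding of the tangent bundle over a compact set. In
(2) it is applied to $Y$ with $Y\cap Z$ in place of $Z$, and the result is glued to the splitting on
$Z$. In (1) the set $Z$ need not be closed, so the splitting is first restricted to the closed
nonwandering set and extended from there; accumulation then shows that the extension agrees with the
given splitting on $Z$. -/

/-! ### Linear cocycles and invariant splittings -/

/-- A `ℤ`-indexed linear cocycle over a flow on `X`, acting on the subbundle of the trivial bundle
`X × F` whose fibre at `x` is the range of the idempotent `map 0 x`. -/
structure LinearCocycle (X F : Type*) [TopologicalSpace X] [NormedAddCommGroup F]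
    [NormedSpace ℝ F] where
  flow : ℤ → X → X
  map : ℤ → X → F →L[ℝ] F
  flow_zero : ∀ x, flow 0 x = x
  flow_add : ∀ m n x, flow (m + n) x = flow m (flow n x)
  map_add : ∀ m n x v, map (m + n) x v = map m (flow n x) (map n x v)
  continuous_flow : ∀ n, Continuous (flow n)
  continuous_map : ∀ n, Continuous (map n)

namespace LinearCocycle

section Basic

variable {X F : Type*} [TopologicalSpace X] [NormedAddCommGroup F] [NormedSpace ℝ F]
  (C : LinearCocycle X F)

/-- The time reversal of a cocycle. -/
def reverse : LinearCocycle X F where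
  flow n := C.flow (-n)
  map n := C.map (-n)
  flow_zero x := by simpa using C.flow_zero x
  flow_add m n x := by rw [neg_add, C.flow_add]
  map_add m n x v := by rw [neg_add, C.map_add]
  continuous_flow n := C.continuous_flow (-n)
  continuous_map n := C.continuous_map (-n)

@[simp] lemma reverse_flow (n : ℤ) (x : X) : C.reverse.flow n x = C.flow (-n) x := rfl

@[simp] lemma reverse_map (n : ℤ) (x : X) : C.reverse.map n x = C.map (-n) x := rfl

@[simp] lemma reverse_reverse : C.reverse.reverse = C := by
  cases C; simp [reverse]

/-- The fibre of the bundle on which a cocycle acts. -/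
def fiber (x : X) : Submodule ℝ F := LinearMap.range (C.map 0 x).toLinearMap

variable {C}

lemma map_zero_map (n : ℤ) (x : X) (v : F) :
    C.map 0 (C.flow n x) (C.map n x v) = C.map n x v := by
  rw [← C.map_add, zero_add]

lemma map_map_zero (n : ℤ) (x : X) (v : F) : C.map n x (C.map 0 x v) = C.map n x v := by
  have := C.map_add n 0 x v
  rw [C.flow_zero, add_zero] at this
  exact this.symm

lemma mem_fiber {x : X} {v : F} : v ∈ C.fiber x ↔ C.map 0 x v = v := by
  constructor
  · rintro ⟨w, rfl⟩
    exact map_map_zero 0 x w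
  · exact fun h => ⟨v, h⟩

@[simp] lemma reverse_fiber (x : X) : C.reverse.fiber x = C.fiber x := by
  simp [fiber]

lemma map_mem_fiber (n : ℤ) (x : X) (v : F) : C.map n x v ∈ C.fiber (C.flow n x) :=
  mem_fiber.2 (map_zero_map n x v)

lemma flow_neg_flow (n : ℤ) (x : X) : C.flow (-n) (C.flow n x) = x := by
  rw [← C.flow_add, neg_add_cancel, C.flow_zero]

lemma flow_flow_neg (n : ℤ) (x : X) : C.flow n (C.flow (-n) x) = x := by
  rw [← C.flow_add, add_neg_cancel, C.flow_zero]

lemma map_neg_map (n : ℤ) {x : X} {v : F} (hv : v ∈ C.fiber x) :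
    C.map (-n) (C.flow n x) (C.map n x v) = v := by
  rw [← C.map_add, neg_add_cancel, mem_fiber.1 hv]

lemma map_map_neg (n : ℤ) {x : X} {v : F} (hv : v ∈ C.fiber x) :
    C.map n (C.flow (-n) x) (C.map (-n) x v) = v := by
  rw [← C.map_add, add_neg_cancel, mem_fiber.1 hv]

lemma map_ne_zero (n : ℤ) {x : X} {v : F} (hv : v ∈ C.fiber x) (h : v ≠ 0) :
    C.map n x v ≠ 0 := fun h0 => h (by rw [← map_neg_map n hv, h0, map_zero])

lemma isClosed_fiber : IsClosed {p : X × F | p.2 ∈ C.fiber p.1} := by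
  simp only [mem_fiber]
  exact isClosed_eq (((C.continuous_map 0).comp continuous_fst).clm_apply continuous_snd)
    continuous_snd

lemma continuous_action (n : ℤ) :
    Continuous fun p : X × F => (C.flow n p.1, C.map n p.1 p.2) :=
  ((C.continuous_flow n).comp continuous_fst).prodMk
    (((C.continuous_map n).comp continuous_fst).clm_apply continuous_snd)

variable (C)

/-- An invariant splitting, with closed graphs, of the bundle of a cocycle over a closed invariant
set. -/
structure IsSplittingOn (Z : Set X) (Eu Es : X → Submodule ℝ F) : Prop where
  isClosed_u : IsClosed {p : X × F | p.1 ∈ Z ∧ p.2 ∈ Eu p.1}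
  isClosed_s : IsClosed {p : X × F | p.1 ∈ Z ∧ p.2 ∈ Es p.1}
  flow_mem : ∀ x ∈ Z, ∀ n, C.flow n x ∈ Z
  disjoint : ∀ x ∈ Z, Disjoint (Eu x) (Es x)
  sup_eq : ∀ x ∈ Z, Eu x ⊔ Es x = C.fiber x
  map_u : ∀ x ∈ Z, ∀ n, ∀ v ∈ Eu x, C.map n x v ∈ Eu (C.flow n x)
  map_s : ∀ x ∈ Z, ∀ n, ∀ v ∈ Es x, C.map n x v ∈ Es (C.flow n x)

/-- A splitting in which `Eu` dominates `Es`. -/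
structure IsDominatedOn (Z : Set X) (Eu Es : X → Submodule ℝ F) : Prop
    extends C.IsSplittingOn Z Eu Es where
  dominated : ∀ c : ℝ, ∀ᶠ n : ℤ in atTop, ∀ x ∈ Z, ∀ u ∈ Eu x, ∀ s ∈ Es x,
    c * (‖C.map n x s‖ * ‖u‖) ≤ ‖C.map n x u‖ * ‖s‖

variable {C} {Z : Set X} {Eu Es : X → Submodule ℝ F}

lemma IsSplittingOn.reverse (h : C.IsSplittingOn Z Eu Es) : C.reverse.IsSplittingOn Z Es Eu where
  isClosed_u := h.isClosed_s
  isClosed_s := h.isClosed_u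
  flow_mem x hx n := h.flow_mem x hx (-n)
  disjoint x hx := (h.disjoint x hx).symm
  sup_eq x hx := by rw [sup_comm, h.sup_eq x hx, reverse_fiber]
  map_u x hx n v hv := h.map_s x hx (-n) v hv
  map_s x hx n v hv := h.map_u x hx (-n) v hv

lemma IsSplittingOn.u_le (h : C.IsSplittingOn Z Eu Es) {x : X} (hx : x ∈ Z) :
    Eu x ≤ C.fiber x := h.sup_eq x hx ▸ le_sup_left

lemma IsSplittingOn.s_le (h : C.IsSplittingOn Z Eu Es) {x : X} (hx : x ∈ Z) :
    Es x ≤ C.fiber x := h.sup_eq x hx ▸ le_sup_right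

/-- Apply domination at the point $n$ steps back, to the backward images of the two vectors: pushing
them forward again recovers the original vectors, so the same inequality is read in the opposite
direction. -/
lemma IsDominatedOn.reverse (h : C.IsDominatedOn Z Eu Es) :
    C.reverse.IsDominatedOn Z Es Eu where
  toIsSplittingOn := h.toIsSplittingOn.reverse
  dominated c := by
    filter_upwards [h.dominated c] with n hn x hx s hs u hu
    have := hn _ (h.flow_mem x hx (-n)) _ (h.map_u x hx (-n) u hu) _ (h.map_s x hx (-n) s hs)
    rw [map_map_neg n (h.u_le hx hu), map_map_neg n (h.s_le hx hs)] at this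
    simp only [reverse_map]
    linarith

/-- The zero section detects $Z$, since every fibre of `Eu` contains 0. -/
lemma IsSplittingOn.isClosed (h : C.IsSplittingOn Z Eu Es) : IsClosed Z := by
  have : Z = (fun x : X => (x, (0 : F))) ⁻¹' {p : X × F | p.1 ∈ Z ∧ p.2 ∈ Eu p.1} := by
    ext x; simp
  rw [this]
  exact h.isClosed_u.preimage (continuous_id.prodMk continuous_const)

lemma IsSplittingOn.eq_zero (h : C.IsSplittingOn Z Eu Es) {x : X} (hx : x ∈ Z) {v : F}
    (hu : v ∈ Eu x) (hs : v ∈ Es x) : v = 0 :=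
  Submodule.disjoint_def.1 (h.disjoint x hx) v hu hs

end Basic

/-! ### Continuous extension of the projection to the unstable bundle -/

section Projection

variable {X F : Type*} [TopologicalSpace X] [NormedAddCommGroup F] [NormedSpace ℝ F]
  [FiniteDimensional ℝ F] {C : LinearCocycle X F} {Z : Set X} {Eu Es : X → Submodule ℝ F}

lemma isCompact_of_isClosed_of_norm_le [CompactSpace X] {S : Set (X × F)} (hS : IsClosed S) (R : ℝ)
    (h : ∀ p ∈ S, ‖p.2‖ ≤ R) : IsCompact S := by
  have : ProperSpace F := FiniteDimensional.proper_real F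
  refine (isCompact_univ.prod (isCompact_closedBall (0 : F) R)).of_isClosed_subset hS ?_
  exact fun p hp => ⟨mem_univ _, by simpa using h p hp⟩

lemma isCompact_of_isClosed_of_norm_le₂ [CompactSpace X] {S : Set (X × F × F)} (hS : IsClosed S)
    (R : ℝ) (h : ∀ p ∈ S, ‖p.2‖ ≤ R) : IsCompact S := by
  have : ProperSpace F := FiniteDimensional.proper_real F
  refine (isCompact_univ.prod (isCompact_closedBall (0 : F × F) R)).of_isClosed_subset hS ?_
  exact fun p hp => ⟨mem_univ _, by simpa using h p hp⟩

/-- The angle between the two bundles is bounded below: on the compact set of pairs with $\|u\|=1$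
and $\|u+s\|\le 1$, the sum never vanishes. -/
lemma IsSplittingOn.exists_norm_le_mul_norm_add [CompactSpace X] (h : C.IsSplittingOn Z Eu Es) :
    ∃ R : ℝ, ∀ x ∈ Z, ∀ u ∈ Eu x, ∀ s ∈ Es x, ‖u‖ ≤ R * ‖u + s‖ := by
  let S : Set (X × F × F) := {p | (p.1 ∈ Z ∧ p.2.1 ∈ Eu p.1) ∧ (p.1 ∈ Z ∧ p.2.2 ∈ Es p.1) ∧
    ‖p.2.1‖ = 1 ∧ ‖p.2.1 + p.2.2‖ ≤ 1}
  have hS : IsCompact S := by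
    refine isCompact_of_isClosed_of_norm_le₂ ?_ 2 ?_
    · refine (h.isClosed_u.preimage
        (f := fun p : X × F × F => ((p.1, p.2.1) : X × F)) (by fun_prop)).inter
        ((h.isClosed_s.preimage
        (f := fun p : X × F × F => ((p.1, p.2.2) : X × F)) (by fun_prop)).inter ?_)
      exact (isClosed_eq (f := fun p : X × F × F => ‖p.2.1‖) (by fun_prop) continuous_const).inter
        (isClosed_le (f := fun p : X × F × F => ‖p.2.1 + p.2.2‖) (by fun_prop) continuous_const)
    · rintro ⟨x, u, s⟩ ⟨-, -, h1, h2⟩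
      simp only [Prod.norm_def] at *
      have : ‖s‖ ≤ ‖u + s‖ + ‖u‖ := by
        simpa using norm_sub_le (u + s) u
      exact max_le (by linarith) (by linarith)
  have key : ∃ c : ℝ, 0 < c ∧ c ≤ 1 ∧ ∀ p ∈ S, c ≤ ‖p.2.1 + p.2.2‖ := by
    rcases S.eq_empty_or_nonempty with hne | hne
    · exact ⟨1, one_pos, le_rfl, by simp [hne]⟩
    · obtain ⟨p, hp, hmin⟩ := hS.exists_isMinOn hne
        (f := fun p : X × F × F => ‖p.2.1 + p.2.2‖) (by fun_prop)
      refine ⟨‖p.2.1 + p.2.2‖, ?_, hp.2.2.2, fun q hq => hmin hq⟩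
      rw [norm_pos_iff]
      intro h0
      have h1 : p.2.1 ∈ Es p.1 := by
        rw [eq_neg_of_add_eq_zero_left h0]
        exact neg_mem hp.2.1.2
      have := h.eq_zero hp.1.1 hp.1.2 h1
      have h2 := hp.2.2.1
      rw [this] at h2
      simp at h2
  obtain ⟨c, hc, hc1, hmin⟩ := key
  refine ⟨c⁻¹, fun x hx u hu s hs => ?_⟩
  rcases eq_or_ne u 0 with rfl | hu0
  · simp only [norm_zero]; positivity
  have hpos : 0 < ‖u‖ := norm_pos_iff.2 hu0
  have key : c ≤ ‖‖u‖⁻¹ • u + ‖u‖⁻¹ • s‖ := by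
    by_contra hcon
    push Not at hcon
    have := hmin (x, ‖u‖⁻¹ • u, ‖u‖⁻¹ • s) ⟨⟨hx, Submodule.smul_mem _ _ hu⟩,
      ⟨hx, Submodule.smul_mem _ _ hs⟩, by simp [norm_smul, hpos.ne'],
      by simp only; linarith⟩
    exact absurd this (not_le.2 hcon)
  rw [← smul_add, norm_smul, norm_inv, norm_norm] at key
  rw [inv_mul_eq_div, le_div_iff₀ hc]
  rwa [inv_mul_eq_div, le_div_iff₀ hpos, mul_comm] at key

/-- The projection to `Eu` along `Es` extends continuously to the whole space. -/
theorem IsSplittingOn.exists_projection [CompactSpace X] [T2Space X]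
    (h : C.IsSplittingOn Z Eu Es) :
    ∃ Q : X → F →L[ℝ] F, Continuous Q ∧
      ∀ z ∈ Z, ∀ v, Q z v ∈ Eu z ∧ C.map 0 z v - Q z v ∈ Es z := by
  have hex : ∀ z : Z, ∀ v : F, ∃ u, u ∈ Eu z ∧ C.map 0 z v - u ∈ Es z := by
    intro z v
    have : C.map 0 z v ∈ Eu z ⊔ Es z := by rw [h.sup_eq z z.2]; exact ⟨v, rfl⟩
    obtain ⟨u, hu, s, hs, hus⟩ := Submodule.mem_sup.1 this
    exact ⟨u, hu, by rw [← hus]; simpa using hs⟩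
  have huniq : ∀ z : Z, ∀ v u u' : F, u ∈ Eu z → C.map 0 z v - u ∈ Es z → u' ∈ Eu z →
      C.map 0 z v - u' ∈ Es z → u = u' := by
    intro z v u u' hu hs hu' hs'
    refine sub_eq_zero.1 (h.eq_zero z.2 (sub_mem hu hu') ?_)
    simpa using sub_mem hs' hs
  choose q hqu hqs using hex
  let L : Z → F →ₗ[ℝ] F := fun z =>
    { toFun := q z
      map_add' := fun v w => huniq z (v + w) _ _ (hqu z _) (hqs z _)
        (add_mem (hqu z v) (hqu z w)) (by
          rw [_root_.map_add, add_sub_add_comm]; exact add_mem (hqs z v) (hqs z w))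
      map_smul' := fun c v => huniq z (c • v) _ _ (hqu z _) (hqs z _)
        (Submodule.smul_mem _ c (hqu z v)) (by
          rw [map_smul, RingHom.id_apply, ← smul_sub]; exact Submodule.smul_mem _ _ (hqs z v)) }
  let Q₀ : Z → F →L[ℝ] F := fun z => (L z).toContinuousLinearMap
  have hQ₀ : ∀ z v, Q₀ z v = q z v := fun z v => rfl
  -- A closed graph with bounded values forces continuity: the preimage of a closed set `T` is the
  -- first projection of a compact set, described only by the closed graphs of `Eu` and `Es`.
  have hcont : Continuous Q₀ := by
    refine continuous_clm_apply.2 fun v => ?_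
    obtain ⟨R, hR⟩ := h.exists_norm_le_mul_norm_add
    refine continuous_iff_isClosed.2 fun T hT => ?_
    let S : Set (X × F) := {p | (p.1 ∈ Z ∧ p.2 ∈ Eu p.1) ∧
      (p.1 ∈ Z ∧ C.map 0 p.1 v - p.2 ∈ Es p.1) ∧ p.2 ∈ T}
    have hScl : IsClosed S := by
      refine h.isClosed_u.inter (IsClosed.inter ?_ (hT.preimage continuous_snd))
      refine h.isClosed_s.preimage (f := fun p : X × F => (p.1, C.map 0 p.1 v - p.2)) ?_
      have := C.continuous_map 0
      fun_prop
    obtain ⟨R', hR'⟩ : ∃ R' : ℝ, ∀ x : X, ‖C.map 0 x v‖ ≤ R' := by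
      have hc : Continuous fun x => C.map 0 x v :=
        (C.continuous_map 0).clm_apply continuous_const
      obtain ⟨R', hR'⟩ := (isCompact_range hc).isBounded.exists_norm_le
      exact ⟨R', fun x => hR' _ ⟨x, rfl⟩⟩
    have hScomp : IsCompact S := by
      refine isCompact_of_isClosed_of_norm_le hScl (|R| * R') ?_
      rintro ⟨x, u⟩ ⟨⟨hx, hu⟩, ⟨-, hs⟩, -⟩
      have := hR x hx u hu _ hs
      rw [add_sub_cancel] at this
      calc ‖u‖ ≤ R * ‖C.map 0 x v‖ := this
        _ ≤ |R| * R' := by gcongr; exact le_abs_self R; exact hR' x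
    have hpre : (fun z => Q₀ z v) ⁻¹' T = Subtype.val ⁻¹' (Prod.fst '' S) := by
      ext z
      simp only [mem_preimage, hQ₀]
      constructor
      · intro hz
        exact ⟨(z, q z v), ⟨⟨z.2, hqu z v⟩, ⟨z.2, hqs z v⟩, hz⟩, rfl⟩
      · rintro ⟨⟨x, u⟩, ⟨⟨hx, hu⟩, ⟨-, hs⟩, hT⟩, rfl⟩
        rwa [huniq z v (q z v) u (hqu z v) (hqs z v) hu hs]
    rw [hpre]
    exact (hScomp.image continuous_fst).isClosed.preimage continuous_subtype_val
  -- Tietze extension in the finite-dimensional space of operators; away from $Z$ the values need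
  -- not be projections.
  obtain ⟨g, hg⟩ := ContinuousMap.exists_restrict_eq h.isClosed (⟨Q₀, hcont⟩ : C(Z, F →L[ℝ] F))
  refine ⟨g, g.continuous, fun z hz v => ?_⟩
  have : g z = Q₀ ⟨z, hz⟩ := congr($hg ⟨z, hz⟩)
  rw [this]
  exact ⟨hqu ⟨z, hz⟩ v, hqs ⟨z, hz⟩ v⟩

end Projection

end LinearCocycle

/-! ### Cone contraction and growth near the given set -/

namespace LinearCocycle

section Cone

variable {X F : Type*} [TopologicalSpace X] [NormedAddCommGroup F] [NormedSpace ℝ F]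
  {C : LinearCocycle X F} {Z : Set X} {Eu Es : X → Submodule ℝ F} {Q : X → F →L[ℝ] F}

variable (C) in
/-- `Q` is a continuous family of operators which over `Z` is the projection to `Eu` along `Es`. -/
structure IsProjectionOn (Z : Set X) (Eu Es : X → Submodule ℝ F) (Q : X → F →L[ℝ] F) : Prop where
  continuous : Continuous Q
  mem_u : ∀ z ∈ Z, ∀ v, Q z v ∈ Eu z
  mem_s : ∀ z ∈ Z, ∀ v, C.map 0 z v - Q z v ∈ Es z

lemma IsProjectionOn.reverse (hQ : C.IsProjectionOn Z Eu Es Q) :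
    C.reverse.IsProjectionOn Z Es Eu (fun x => C.map 0 x - Q x) where
  continuous := (C.continuous_map 0).sub hQ.continuous
  mem_u z hz v := by simpa using hQ.mem_s z hz v
  mem_s z hz v := by simpa using hQ.mem_u z hz v

lemma IsProjectionOn.sub_mem (hQ : C.IsProjectionOn Z Eu Es Q) {z : X} (hz : z ∈ Z) {v : F}
    (hv : v ∈ C.fiber z) : v - Q z v ∈ Es z := by
  have := hQ.mem_s z hz v
  rwa [mem_fiber.1 hv] at this

lemma IsProjectionOn.eq (hQ : C.IsProjectionOn Z Eu Es Q) (h : C.IsSplittingOn Z Eu Es) {z : X}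
    (hz : z ∈ Z) {u s : F} (hu : u ∈ Eu z) (hs : s ∈ Es z) : Q z (u + s) = u := by
  have hv : u + s ∈ C.fiber z := add_mem (h.u_le hz hu) (h.s_le hz hs)
  have h1 := hQ.sub_mem hz hv
  have h2 := hQ.mem_u z hz (u + s)
  refine sub_eq_zero.1 (h.eq_zero hz (_root_.sub_mem h2 hu) ?_)
  have : Q z (u + s) - u = s - (u + s - Q z (u + s)) := by abel
  rw [this]
  exact _root_.sub_mem hs h1

lemma IsProjectionOn.apply_map (hQ : C.IsProjectionOn Z Eu Es Q) (h : C.IsSplittingOn Z Eu Es)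
    {z : X} (hz : z ∈ Z) {v : F} (hv : v ∈ C.fiber z) (n : ℤ) :
    Q (C.flow n z) (C.map n z v) = C.map n z (Q z v) := by
  have h1 := h.map_u z hz n _ (hQ.mem_u z hz v)
  have h2 := h.map_s z hz n _ (hQ.sub_mem hz hv)
  have := hQ.eq h (h.flow_mem z hz n) h1 h2
  rwa [← _root_.map_add, add_sub_cancel] at this

lemma IsProjectionOn.map_sub_apply_map (hQ : C.IsProjectionOn Z Eu Es Q)
    (h : C.IsSplittingOn Z Eu Es) {z : X} (hz : z ∈ Z) {v : F} (hv : v ∈ C.fiber z) (n : ℤ) :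
    C.map n z v - Q (C.flow n z) (C.map n z v) = C.map n z (v - Q z v) := by
  rw [hQ.apply_map h hz hv, _root_.map_sub]

lemma IsProjectionOn.mem_s_iff (hQ : C.IsProjectionOn Z Eu Es Q) (h : C.IsSplittingOn Z Eu Es)
    {z : X} (hz : z ∈ Z) {v : F} (hv : v ∈ C.fiber z) : v ∈ Es z ↔ Q z v = 0 := by
  constructor
  · intro hs
    simpa using hQ.eq h hz (zero_mem _) hs
  · intro h0
    simpa [h0] using hQ.sub_mem hz hv

/-- A form of the tube lemma. It turns a strict estimate for unit vectors over $Z$ into one near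
$Z$, by taking for `S` the compact set of violations. -/
lemma eventually_nhdsSet_forall_notMem {X Y : Type*} [TopologicalSpace X] [T2Space X]
    [TopologicalSpace Y] {Z : Set X} {S : Set (X × Y)} (hS : IsCompact S)
    (h : ∀ z ∈ Z, ∀ y, (z, y) ∉ S) : ∀ᶠ x in 𝓝ˢ Z, ∀ y, (x, y) ∉ S := by
  have hcl : IsClosed (Prod.fst '' S) := (hS.image continuous_fst).isClosed
  have : (Prod.fst '' S)ᶜ ∈ 𝓝ˢ Z := by
    refine hcl.isOpen_compl.mem_nhdsSet.2 fun z hz => ?_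
    rintro ⟨⟨x, y⟩, hp, rfl⟩
    exact h x hz y hp
  filter_upwards [this] with x hx y hy using hx ⟨_, hy, rfl⟩

variable [CompactSpace X] [T2Space X] [FiniteDimensional ℝ F]

/-- Over $Z$, domination with constant 4 makes the stable part of the image of a cone vector at most
a quarter of its unstable part. The factor 2 claimed is weaker, so the estimate persists near $Z$.
-/
lemma IsDominatedOn.eventually_cone (h : C.IsDominatedOn Z Eu Es)
    (hQ : C.IsProjectionOn Z Eu Es Q) :
    ∀ᶠ m : ℤ in atTop, ∀ᶠ x in 𝓝ˢ Z, ∀ v ∈ C.fiber x, v ≠ 0 → ‖v - Q x v‖ ≤ ‖Q x v‖ →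
      2 * ‖C.map m x v - Q (C.flow m x) (C.map m x v)‖ < ‖Q (C.flow m x) (C.map m x v)‖ := by
  filter_upwards [h.dominated 4] with m hm
  have hQc := hQ.continuous
  have hA := C.continuous_map m
  have hf := C.continuous_flow m
  let S : Set (X × F) := {p | p.2 ∈ C.fiber p.1 ∧ ‖p.2‖ = 1 ∧ ‖p.2 - Q p.1 p.2‖ ≤ ‖Q p.1 p.2‖ ∧
    ‖Q (C.flow m p.1) (C.map m p.1 p.2)‖ ≤
      2 * ‖C.map m p.1 p.2 - Q (C.flow m p.1) (C.map m p.1 p.2)‖}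
  have hS : IsCompact S := by
    refine isCompact_of_isClosed_of_norm_le ?_ 1 fun p hp => hp.2.1.le
    refine isClosed_fiber.inter ((isClosed_eq (f := fun p : X × F => ‖p.2‖) (by fun_prop)
      continuous_const).inter ((isClosed_le (f := fun p : X × F => ‖p.2 - Q p.1 p.2‖)
      (g := fun p : X × F => ‖Q p.1 p.2‖) (by fun_prop) (by fun_prop)).inter
      (isClosed_le (f := fun p : X × F => ‖Q (C.flow m p.1) (C.map m p.1 p.2)‖)
      (g := fun p : X × F => 2 * ‖C.map m p.1 p.2 - Q (C.flow m p.1) (C.map m p.1 p.2)‖)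
      (by fun_prop) (by fun_prop))))
  have := eventually_nhdsSet_forall_notMem (Z := Z) hS ?_
  · filter_upwards [this] with x hx v hv hv0 hcone
    by_contra! hcon
    have hpos : 0 < ‖v‖ := norm_pos_iff.2 hv0
    refine hx (‖v‖⁻¹ • v) ⟨Submodule.smul_mem _ _ hv, by simp [norm_smul, hpos.ne'], ?_, ?_⟩
    · simp only [map_smul, ← smul_sub, norm_smul]
      gcongr
    · simp only [map_smul, ← smul_sub, norm_smul]
      rw [mul_left_comm]
      gcongr
  · rintro z hz v ⟨hv, hv1, hcone, hcon⟩
    simp only at *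
    rw [hQ.map_sub_apply_map h.toIsSplittingOn hz hv, hQ.apply_map h.toIsSplittingOn hz hv] at hcon
    have hu := hQ.mem_u z hz v
    have hs := hQ.sub_mem hz hv
    have hd := hm z hz _ hu _ hs
    have hQ0 : Q z v ≠ 0 := by
      intro h0
      rw [h0, sub_zero, norm_zero, hv1] at hcone
      linarith
    have hu0 : 0 < ‖C.map m z (Q z v)‖ :=
      norm_pos_iff.2 (map_ne_zero m (h.u_le hz hu) hQ0)
    have hQ1 : 0 < ‖Q z v‖ := norm_pos_iff.2 hQ0
    have : ‖C.map m z (Q z v)‖ * ‖v - Q z v‖ ≤ ‖C.map m z (Q z v)‖ * ‖Q z v‖ := by gcongr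
    nlinarith

/-- A vector of the cone has size comparable to its unstable part, and a vector mapped outside the
cone has image comparable to that of its stable part. Over $Z$ this reduces the estimate to the
domination of the stable part of `w` by the unstable part of `u`. -/
lemma IsDominatedOn.eventually_growth (h : C.IsDominatedOn Z Eu Es)
    (hQ : C.IsProjectionOn Z Eu Es Q) :
    ∀ᶠ m : ℤ in atTop, ∀ᶠ x in 𝓝ˢ Z, ∀ u ∈ C.fiber x, ∀ w ∈ C.fiber x,
      ‖u - Q x u‖ ≤ ‖Q x u‖ →
      ‖Q (C.flow m x) (C.map m x w)‖ ≤ ‖C.map m x w - Q (C.flow m x) (C.map m x w)‖ →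
      2 * (‖C.map m x w‖ * ‖u‖) ≤ ‖C.map m x u‖ * ‖w‖ := by
  obtain ⟨R, hR0, hR⟩ : ∃ R : ℝ, 0 < R ∧ ∀ x v, ‖v - Q x v‖ ≤ R * ‖v‖ := by
    have hc : Continuous fun x => ContinuousLinearMap.id ℝ F - Q x :=
      continuous_const.sub hQ.continuous
    obtain ⟨R, hR0, hR⟩ := (isCompact_range hc).isBounded.exists_pos_norm_le
    exact ⟨R, hR0, fun x v => (ContinuousLinearMap.id ℝ F - Q x).le_of_opNorm_le (hR _ ⟨x, rfl⟩) v⟩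
  -- For unit vectors $\|Qu\|\ge 1/2$ and $\|w-Qw\|\le R$, so $16R$ gives $8\|A(w-Qw)\|\le\|AQu\|$
  -- and hence $\|Aw\|\le\|AQu\|/4$. The constant 4 gives $\|Au\|\ge\frac34\|AQu\|$, which excludes
  -- $\|Au\|\le 2\|Aw\|$.
  filter_upwards [h.dominated 4, h.dominated (16 * R)] with m hm4 hm
  have hQc := hQ.continuous
  have hA := C.continuous_map m
  have hf := C.continuous_flow m
  let S : Set (X × F × F) := {p | p.2.1 ∈ C.fiber p.1 ∧ p.2.2 ∈ C.fiber p.1 ∧ ‖p.2.1‖ = 1 ∧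
    ‖p.2.2‖ = 1 ∧ ‖p.2.1 - Q p.1 p.2.1‖ ≤ ‖Q p.1 p.2.1‖ ∧
    ‖Q (C.flow m p.1) (C.map m p.1 p.2.2)‖ ≤
      ‖C.map m p.1 p.2.2 - Q (C.flow m p.1) (C.map m p.1 p.2.2)‖ ∧
    ‖C.map m p.1 p.2.1‖ ≤ 2 * ‖C.map m p.1 p.2.2‖}
  have hS : IsCompact S := by
    refine isCompact_of_isClosed_of_norm_le₂ ?_ 1 fun p hp => by
      rw [Prod.norm_def, hp.2.2.1, hp.2.2.2.1, max_self]
    have h1 : IsClosed {p : X × F × F | p.2.1 ∈ C.fiber p.1} :=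
      isClosed_fiber.preimage (f := fun p : X × F × F => ((p.1, p.2.1) : X × F)) (by fun_prop)
    have h2 : IsClosed {p : X × F × F | p.2.2 ∈ C.fiber p.1} :=
      isClosed_fiber.preimage (f := fun p : X × F × F => ((p.1, p.2.2) : X × F)) (by fun_prop)
    refine h1.inter (h2.inter ((isClosed_eq (f := fun p : X × F × F => ‖p.2.1‖) (by fun_prop)
      continuous_const).inter ((isClosed_eq (f := fun p : X × F × F => ‖p.2.2‖) (by fun_prop)
      continuous_const).inter ((isClosed_le (f := fun p : X × F × F => ‖p.2.1 - Q p.1 p.2.1‖)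
      (g := fun p : X × F × F => ‖Q p.1 p.2.1‖) (by fun_prop) (by fun_prop)).inter
      ((isClosed_le (f := fun p : X × F × F => ‖Q (C.flow m p.1) (C.map m p.1 p.2.2)‖)
      (g := fun p : X × F × F => ‖C.map m p.1 p.2.2 - Q (C.flow m p.1) (C.map m p.1 p.2.2)‖)
      (by fun_prop) (by fun_prop)).inter
      (isClosed_le (f := fun p : X × F × F => ‖C.map m p.1 p.2.1‖)
      (g := fun p : X × F × F => 2 * ‖C.map m p.1 p.2.2‖) (by fun_prop) (by fun_prop)))))))
  have := eventually_nhdsSet_forall_notMem (Z := Z) hS ?_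
  · filter_upwards [this] with x hx u hu w hw hcu hcw
    by_contra! hcon
    rcases eq_or_ne u 0 with rfl | hu0
    · simp at hcon
    rcases eq_or_ne w 0 with rfl | hw0
    · simp at hcon
    have hpu : 0 < ‖u‖ := norm_pos_iff.2 hu0
    have hpw : 0 < ‖w‖ := norm_pos_iff.2 hw0
    refine hx (‖u‖⁻¹ • u, ‖w‖⁻¹ • w) ⟨Submodule.smul_mem _ _ hu, Submodule.smul_mem _ _ hw,
      by simp [norm_smul, hpu.ne'], by simp [norm_smul, hpw.ne'], ?_, ?_, ?_⟩
    · simp only [map_smul, ← smul_sub, norm_smul]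
      gcongr
    · simp only [map_smul, ← smul_sub, norm_smul]
      gcongr
    · simp only [map_smul, norm_smul, norm_inv, norm_norm]
      rw [inv_mul_le_iff₀ hpu, mul_left_comm, mul_left_comm, ← mul_assoc, inv_mul_eq_div,
        mul_div_assoc', le_div_iff₀ hpw]
      linarith
  · rintro z hz ⟨u, w⟩ ⟨hu, hw, hu1, hw1, hcu, hcw, hcon⟩
    simp only at *
    have hu' := hQ.mem_u z hz u
    have hw' := hQ.sub_mem hz hw
    have hus := hQ.sub_mem hz hu
    rw [hQ.map_sub_apply_map h.toIsSplittingOn hz hw, hQ.apply_map h.toIsSplittingOn hz hw] at hcw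
    have hd := hm z hz _ hu' _ hw'
    have hd4 := hm4 z hz _ hu' _ hus
    have hQ0 : Q z u ≠ 0 := by
      intro h0
      rw [h0, sub_zero, norm_zero, hu1] at hcu
      linarith
    have hQ1 : 0 < ‖Q z u‖ := norm_pos_iff.2 hQ0
    have hAu0 : 0 < ‖C.map m z (Q z u)‖ :=
      norm_pos_iff.2 (map_ne_zero m (h.u_le hz hu') hQ0)
    have e1 : ‖C.map m z u‖ ≥ ‖C.map m z (Q z u)‖ - ‖C.map m z (u - Q z u)‖ := by
      have : C.map m z u = C.map m z (Q z u) - (- C.map m z (u - Q z u)) := by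
        rw [_root_.map_sub]; abel
      rw [this]
      have := norm_sub_norm_le (C.map m z (Q z u)) (- C.map m z (u - Q z u))
      rwa [norm_neg] at this
    have e2 : ‖C.map m z w‖ ≤ 2 * ‖C.map m z (w - Q z w)‖ := by
      have : C.map m z w = C.map m z (Q z w) + C.map m z (w - Q z w) := by
        rw [_root_.map_sub]; abel
      calc ‖C.map m z w‖ ≤ ‖C.map m z (Q z w)‖ + ‖C.map m z (w - Q z w)‖ :=
            this ▸ norm_add_le _ _
        _ ≤ _ := by linarith
    have e3 : (1 : ℝ) ≤ 2 * ‖Q z u‖ := by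
      have := norm_add_le (Q z u) (u - Q z u)
      rw [add_sub_cancel, hu1] at this
      linarith
    have e4 : ‖w - Q z w‖ ≤ R := by simpa [hw1] using hR z w
    have e5 : 4 * ‖C.map m z (u - Q z u)‖ ≤ ‖C.map m z (Q z u)‖ := by
      have : ‖C.map m z (Q z u)‖ * ‖u - Q z u‖ ≤ ‖C.map m z (Q z u)‖ * ‖Q z u‖ := by gcongr
      have : 4 * ‖C.map m z (u - Q z u)‖ * ‖Q z u‖ ≤ ‖C.map m z (Q z u)‖ * ‖Q z u‖ := by linarith
      exact le_of_mul_le_mul_right this hQ1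
    have e6 : 8 * ‖C.map m z (w - Q z w)‖ ≤ ‖C.map m z (Q z u)‖ := by
      have h1 : ‖C.map m z (Q z u)‖ * ‖w - Q z w‖ ≤ ‖C.map m z (Q z u)‖ * R := by gcongr
      have h2 : ‖C.map m z (w - Q z w)‖ * 1 ≤ ‖C.map m z (w - Q z w)‖ * (2 * ‖Q z u‖) := by gcongr
      have h3 : R * (‖C.map m z (w - Q z w)‖ * 1) ≤
        R * (‖C.map m z (w - Q z w)‖ * (2 * ‖Q z u‖)) := by gcongr
      have : R * (8 * ‖C.map m z (w - Q z w)‖) ≤ R * ‖C.map m z (Q z u)‖ := by nlinarith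
      exact le_of_mul_le_mul_left this hR0
    linarith

end Cone

end LinearCocycle

/-! ### Wandering points and bounded excursions -/

namespace LinearCocycle

section Wandering

variable {X F : Type*} [TopologicalSpace X] [NormedAddCommGroup F] [NormedSpace ℝ F]

variable (C : LinearCocycle X F)

/-- The points having a neighbourhood which no orbit visits twice. -/
def IsWandering (x : X) : Prop :=
  ∃ W ∈ 𝓝 x, ∀ y ∈ W, ∀ n : ℤ, 0 < n → C.flow n y ∉ W

/-- The points whose forward orbit leaves `U` at most `k` times. -/
def excursionSet (U : Set X) : ℕ → Set X
  | 0 => {x | ∀ n : ℤ, 0 ≤ n → C.flow n x ∈ U}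
  | k + 1 => {x | ∀ n : ℤ, 0 ≤ n → C.flow n x ∉ U → C.flow (n + 1) x ∈ excursionSet U k}

variable {C}

lemma IsWandering.reverse {x : X} (h : C.IsWandering x) : C.reverse.IsWandering x := by
  obtain ⟨W, hW, h⟩ := h
  refine ⟨W, hW, fun y hy n hn hy' => h _ hy' n hn ?_⟩
  rwa [reverse_flow, flow_flow_neg]

/-- The compact complement of `U` is covered by finitely many wandering neighbourhoods, and an orbit
is in each of them at most once. After each excursion one neighbourhood can be discarded, hence the
induction on the size of the cover. -/
lemma exists_forall_mem_excursionSet [CompactSpace X] {U Z : Set X} (hU : IsOpen U) (hZ : Z ⊆ U)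
    (hw : ∀ x ∉ Z, C.IsWandering x) : ∃ k, ∀ x, x ∈ C.excursionSet U k := by
  choose! W hW hdis using hw
  obtain ⟨t, htU, ht⟩ := hU.isClosed_compl.isCompact.elim_nhds_subcover W
    (fun x hx => hW x fun h => hx (hZ h))
  have key : ∀ k : ℕ, ∀ s : Finset X, s.card = k → (∀ y ∈ s, y ∉ U) → ∀ x,
      (∀ n : ℤ, 0 ≤ n → C.flow n x ∉ U → ∃ y ∈ s, C.flow n x ∈ W y) →
      x ∈ C.excursionSet U k := by
    intro k
    induction k with
    | zero =>
      intro s hs _ x hx n hn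
      by_contra hcon
      obtain ⟨y, hy, -⟩ := hx n hn hcon
      simp [Finset.card_eq_zero.1 hs] at hy
    | succ k ih =>
      intro s hs hsU x hx n hn hnU
      classical
      obtain ⟨y, hy, hyW⟩ := hx n hn hnU
      refine ih (s.erase y) (by rw [Finset.card_erase_of_mem hy, hs]; rfl)
        (fun z hz => hsU z (Finset.mem_of_mem_erase hz)) _ fun m hm hmU => ?_
      rw [← C.flow_add] at hmU ⊢
      obtain ⟨z, hz, hzW⟩ := hx _ (by lia) hmU
      refine ⟨z, Finset.mem_erase.2 ⟨?_, hz⟩, hzW⟩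
      rintro rfl
      refine hdis z (fun h => hsU z hz (hZ h)) _ hyW (m + 1) (by lia) ?_
      rwa [← C.flow_add, show m + 1 + n = m + (n + 1) by ring]
  refine ⟨t.card, fun x => key _ t rfl htU x fun n _ hnU => ?_⟩
  simpa using ht hnU

lemma eventually_flow_mem_of_mem_excursionSet {U : Set X} {k : ℕ} {x : X}
    (hx : x ∈ C.excursionSet U k) : ∀ᶠ n : ℤ in atTop, C.flow n x ∈ U := by
  induction k generalizing x with
  | zero => filter_upwards [eventually_ge_atTop 0] with n hn using hx n hn
  | succ k ih =>
    by_cases h : ∀ n : ℤ, 0 ≤ n → C.flow n x ∈ U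
    · filter_upwards [eventually_ge_atTop 0] with n hn using h n hn
    · push Not at h
      obtain ⟨n, hn, hnU⟩ := h
      have := ih (hx n hn hnU)
      have := (tendsto_atTop_add_const_right atTop (-(n + 1)) tendsto_id).eventually this
      filter_upwards [this] with m hm
      rwa [id, ← C.flow_add, neg_add_cancel_right] at hm

/-- The orbits off a set with only wandering points in the complement converge to this set. -/
lemma eventually_flow_mem [CompactSpace X] {U Z : Set X} (hU : IsOpen U) (hZ : Z ⊆ U)
    (hw : ∀ x ∉ Z, C.IsWandering x) (x : X) : ∀ᶠ n : ℤ in atTop, C.flow n x ∈ U := by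
  obtain ⟨k, hk⟩ := exists_forall_mem_excursionSet hU hZ hw
  exact eventually_flow_mem_of_mem_excursionSet (hk x)

end Wandering

/-! ### Absorbing cones and the stable subspaces -/

section Absorbing

variable {X F : Type*} [TopologicalSpace X] [NormedAddCommGroup F] [NormedSpace ℝ F]
  {C : LinearCocycle X F} {Z : Set X} {Eu Es : X → Submodule ℝ F} {Q : X → F →L[ℝ] F}

variable (C) in
/-- In the open set `U`, which absorbs all orbits, the cone `‖v - Q x v‖ ≤ ‖Q x v‖` is contracted
by `map m` for all times `m` from `N` to `2 * N`, and vectors in the cone grow faster under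
`map N` than those mapped outside it. -/
structure IsAbsorbingCone (Q : X → F →L[ℝ] F) (N : ℤ) (U : Set X) : Prop where
  continuous : Continuous Q
  pos : 0 < N
  isOpen : IsOpen U
  absorbing : ∀ x, ∀ᶠ n : ℤ in atTop, C.flow n x ∈ U
  cone : ∀ x ∈ U, ∀ v ∈ C.fiber x, v ≠ 0 → ‖v - Q x v‖ ≤ ‖Q x v‖ → ∀ m, N ≤ m → m < 2 * N →
    2 * ‖C.map m x v - Q (C.flow m x) (C.map m x v)‖ < ‖Q (C.flow m x) (C.map m x v)‖
  growth : ∀ x ∈ U, ∀ u ∈ C.fiber x, ∀ w ∈ C.fiber x, ‖u - Q x u‖ ≤ ‖Q x u‖ →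
    ‖Q (C.flow N x) (C.map N x w)‖ ≤ ‖C.map N x w - Q (C.flow N x) (C.map N x w)‖ →
    2 * (‖C.map N x w‖ * ‖u‖) ≤ ‖C.map N x u‖ * ‖w‖

/-- Only finitely many times are imposed on one neighbourhood. Those from $N$ to $2N-1$ suffice,
because any time at least $N$ is one of them plus a multiple of $N$. -/
theorem IsDominatedOn.exists_isAbsorbingCone [CompactSpace X] [T2Space X] [FiniteDimensional ℝ F]
    (h : C.IsDominatedOn Z Eu Es) (hQ : C.IsProjectionOn Z Eu Es Q)
    (hw : ∀ x ∉ Z, C.IsWandering x) : ∃ N U, Z ⊆ U ∧ C.IsAbsorbingCone Q N U := by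
  obtain ⟨N, hN, hNpos⟩ := ((eventually_forall_ge_atTop.2 ((h.eventually_cone hQ).and
    (h.eventually_growth hQ))).and (eventually_gt_atTop 0)).exists
  have h1 : ∀ᶠ x in 𝓝ˢ Z, ∀ m ∈ Finset.Ico N (2 * N), ∀ v ∈ C.fiber x, v ≠ 0 →
      ‖v - Q x v‖ ≤ ‖Q x v‖ → 2 * ‖C.map m x v - Q (C.flow m x) (C.map m x v)‖ <
        ‖Q (C.flow m x) (C.map m x v)‖ := by
    rw [Filter.eventually_all_finset]
    exact fun m hm => (hN m (Finset.mem_Ico.1 hm).1).1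
  obtain ⟨U, hUo, hZU, hU⟩ := mem_nhdsSet_iff_exists.1 (h1.and (hN N le_rfl).2)
  exact ⟨N, U, hZU, hQ.continuous, hNpos, hUo, eventually_flow_mem hUo hZU hw,
    fun x hx v hv hv0 hc m hm1 hm2 => (hU hx).1 m (Finset.mem_Ico.2 ⟨hm1, hm2⟩) v hv hv0 hc,
    fun x hx => (hU hx).2⟩

variable {N : ℤ} {U : Set X}

/-- Split the time into one initial step of length in $[N,2N)$ and further steps of length $N$. Only
the starting point of each step has to be in `U`, so the conclusion reaches up to $N-1$ steps past
time $M$, where the orbit may have left `U`. -/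
lemma IsAbsorbingCone.map_mem_cone (hc : C.IsAbsorbingCone Q N U) {x : X} {v : F}
    (hv : v ∈ C.fiber x) (hv0 : v ≠ 0) (hcone : ‖v - Q x v‖ ≤ ‖Q x v‖) {M : ℤ}
    (hM : ∀ j, 0 ≤ j → j < M → C.flow j x ∈ U) {n : ℤ} (hn : N ≤ n) (hnM : n < M + N) :
    2 * ‖C.map n x v - Q (C.flow n x) (C.map n x v)‖ < ‖Q (C.flow n x) (C.map n x v)‖ := by
  have hN := hc.pos
  obtain ⟨k, hk⟩ : ∃ k : ℕ, n.toNat = k := ⟨_, rfl⟩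
  induction k using Nat.strong_induction_on generalizing n with
  | _ k ih =>
    rcases lt_or_ge n (2 * N) with h | h
    · have hx : x ∈ U := by simpa [C.flow_zero] using hM 0 le_rfl (by lia)
      exact hc.cone x hx v hv hv0 hcone n hn h
    · have h1 := ih (n - N).toNat (by lia) (n := n - N) (by lia) (by lia) rfl
      have h2 := hc.cone _ (hM (n - N) (by lia) (by lia)) _ (map_mem_fiber (n - N) x v)
        (map_ne_zero _ hv hv0)
        (by linarith [norm_nonneg (C.map (n - N) x v - Q (C.flow (n - N) x) (C.map (n - N) x v))])
        N le_rfl (by lia)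
      rwa [← C.map_add, ← C.flow_add, add_sub_cancel] at h2

variable (C Q) in
/-- The vectors whose forward iterates eventually leave the cone `‖v - Q x v‖ ≤ ‖Q x v‖`. -/
def IsStable (x : X) (v : F) : Prop :=
  v ∈ C.fiber x ∧ (v = 0 ∨ ∀ᶠ n : ℤ in atTop,
    ‖Q (C.flow n x) (C.map n x v)‖ < ‖C.map n x v - Q (C.flow n x) (C.map n x v)‖)

lemma isStable_zero (x : X) : C.IsStable Q x 0 := ⟨zero_mem _, Or.inl rfl⟩

lemma IsStable.map {x : X} {v : F} (h : C.IsStable Q x v) (k : ℤ) :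
    C.IsStable Q (C.flow k x) (C.map k x v) := by
  refine ⟨map_mem_fiber k x v, ?_⟩
  rcases h.2 with rfl | h
  · left; simp
  · right
    have := (tendsto_atTop_add_const_right atTop k tendsto_id).eventually h
    filter_upwards [this] with n hn
    rwa [id, C.map_add, C.flow_add] at hn

/-- A vector that is not stable returns to the cone at arbitrarily late times. One return after the
orbit has settled in `U` traps it in the narrower cone, so there is no intermediate behaviour. -/
lemma IsAbsorbingCone.eventually_of_not_isStable (hc : C.IsAbsorbingCone Q N U) {x : X} {v : F}
    (hv : v ∈ C.fiber x) (h : ¬ C.IsStable Q x v) : ∀ᶠ n : ℤ in atTop,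
    2 * ‖C.map n x v - Q (C.flow n x) (C.map n x v)‖ < ‖Q (C.flow n x) (C.map n x v)‖ := by
  have hv0 : v ≠ 0 := by rintro rfl; exact h (isStable_zero x)
  have hfreq : ∃ᶠ n : ℤ in atTop,
      ‖C.map n x v - Q (C.flow n x) (C.map n x v)‖ ≤ ‖Q (C.flow n x) (C.map n x v)‖ := by
    intro hcon
    exact h ⟨hv, Or.inr (hcon.mono fun n hn => not_le.1 hn)⟩
  obtain ⟨n, hn, hnU⟩ := (hfreq.and_eventually
    (eventually_forall_ge_atTop.2 (hc.absorbing x))).exists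
  filter_upwards [eventually_ge_atTop (n + N)] with m hm
  have := hc.map_mem_cone (map_mem_fiber n x v) (map_ne_zero n hv hv0) hn (M := m - n)
    (fun j hj _ => by rw [← C.flow_add]; exact hnU _ (by lia)) (n := m - n) (by lia)
    (by have := hc.pos; lia)
  rwa [← C.map_add, ← C.flow_add, sub_add_cancel] at this

/-- Past some time `u` is in the cone, `v` is outside it and the orbit is in `U`; from then on each
block of $N$ steps doubles the ratio of their norms. -/
lemma IsAbsorbingCone.eventually_growth (hc : C.IsAbsorbingCone Q N U) {x : X} {u v : F}
    (hu : u ∈ C.fiber x) (hus : ¬ C.IsStable Q x u) (hv : C.IsStable Q x v) :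
    ∀ᶠ n : ℤ in atTop, ∀ k : ℕ, (2 : ℝ) ^ k * (‖C.map (k * N + n) x v‖ * ‖C.map n x u‖) ≤
      ‖C.map (k * N + n) x u‖ * ‖C.map n x v‖ := by
  rcases hv.2 with rfl | hv'
  · simp
  filter_upwards [eventually_forall_ge_atTop.2 ((hc.eventually_of_not_isStable hu hus).and
    (hv'.and (hc.absorbing x)))] with n hn k
  have hN := hc.pos
  induction k with
  | zero => simp [mul_comm]
  | succ k ih =>
    have hk : n ≤ k * N + n := by have : 0 ≤ k * N := by positivity
                                  lia
    have hk' : n ≤ (k + 1) * N + n := by have : 0 ≤ (k + 1) * N := by positivity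
                                         lia
    obtain ⟨h1, -, h3⟩ := hn _ hk
    obtain ⟨-, h2, -⟩ := hn _ hk'
    have e : (k + 1) * N + n = N + (k * N + n) := by ring
    rw [e] at h2
    have := hc.growth _ h3 _ (map_mem_fiber (k * N + n) x u) _ (map_mem_fiber (k * N + n) x v)
      (by linarith [norm_nonneg (C.map (k * N + n) x u - Q (C.flow (k * N + n) x)
        (C.map (k * N + n) x u))])
      (by rw [← C.map_add, ← C.flow_add]; exact h2.le)
    rw [← C.map_add, ← C.map_add] at this
    push_cast
    rw [e]
    have hu0 : u ≠ 0 := by rintro rfl; exact hus (isStable_zero x)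
    have hpos : 0 < ‖C.map (k * N + n) x u‖ := norm_pos_iff.2 (map_ne_zero _ hu hu0)
    set a := ‖C.map (N + (k * N + n)) x v‖
    set b := ‖C.map (N + (k * N + n)) x u‖
    set c := ‖C.map (k * N + n) x u‖
    set d := ‖C.map (k * N + n) x v‖
    refine le_of_mul_le_mul_right ?_ hpos
    calc 2 ^ (k + 1) * (a * ‖C.map n x u‖) * c
        = (2 * (a * c)) * (2 ^ k * ‖C.map n x u‖) := by ring
      _ ≤ (b * d) * (2 ^ k * ‖C.map n x u‖) := by gcongr
      _ = b * (2 ^ k * (d * ‖C.map n x u‖)) := by ring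
      _ ≤ b * (c * ‖C.map n x v‖) := by gcongr
      _ = b * ‖C.map n x v‖ * c := by ring

/-- If the sum were not stable it would outgrow both summands exponentially, against the triangle
inequality. -/
lemma IsAbsorbingCone.isStable_add (hc : C.IsAbsorbingCone Q N U) {x : X} {v w : F}
    (hv : C.IsStable Q x v) (hw : C.IsStable Q x w) : C.IsStable Q x (v + w) := by
  by_contra hcon
  have hu : v + w ∈ C.fiber x := add_mem hv.1 hw.1
  have hu0 : v + w ≠ 0 := fun h => hcon (h ▸ isStable_zero x)
  obtain ⟨n, hnv, hnw⟩ :=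
    ((hc.eventually_growth hu hcon hv).and (hc.eventually_growth hu hcon hw)).exists
  have hpos : ∀ m, 0 < ‖C.map m x (v + w)‖ := fun m => norm_pos_iff.2 (map_ne_zero m hu hu0)
  have key : ∀ k : ℕ, (2 : ℝ) ^ k * ‖C.map n x (v + w)‖ ≤ ‖C.map n x v‖ + ‖C.map n x w‖ := by
    intro k
    have h1 := hnv k
    have h2 := hnw k
    refine le_of_mul_le_mul_left ?_ (hpos (k * N + n))
    have h3 : ‖C.map (k * N + n) x (v + w)‖ ≤
        ‖C.map (k * N + n) x v‖ + ‖C.map (k * N + n) x w‖ := by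
      rw [_root_.map_add]; exact norm_add_le _ _
    calc ‖C.map (k * N + n) x (v + w)‖ * (2 ^ k * ‖C.map n x (v + w)‖)
        ≤ (‖C.map (k * N + n) x v‖ + ‖C.map (k * N + n) x w‖) * (2 ^ k * ‖C.map n x (v + w)‖) := by
          gcongr
      _ ≤ _ := by linarith
  obtain ⟨k, hk⟩ := pow_unbounded_of_one_lt
    ((‖C.map n x v‖ + ‖C.map n x w‖) / ‖C.map n x (v + w)‖) (one_lt_two (α := ℝ))
  rw [div_lt_iff₀ (hpos n)] at hk
  exact absurd (key k) (not_le.2 hk)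

lemma IsStable.smul {x : X} {v : F} (hv : C.IsStable Q x v) (c : ℝ) :
    C.IsStable Q x (c • v) := by
  rcases eq_or_ne c 0 with rfl | hc
  · rw [zero_smul]; exact isStable_zero x
  refine ⟨Submodule.smul_mem _ _ hv.1, hv.2.imp (fun h => by simp [h]) fun h => ?_⟩
  filter_upwards [h] with n hn
  simp only [map_smul, ← smul_sub, norm_smul]
  have : 0 < ‖c‖ := norm_pos_iff.2 hc
  gcongr

/-- The subspace of stable vectors at a point. -/
def IsAbsorbingCone.stable (hc : C.IsAbsorbingCone Q N U) (x : X) : Submodule ℝ F where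
  carrier := {v | C.IsStable Q x v}
  add_mem' := hc.isStable_add
  zero_mem' := isStable_zero x
  smul_mem' c _ hv := hv.smul c

@[simp] lemma IsAbsorbingCone.mem_stable (hc : C.IsAbsorbingCone Q N U) {x : X} {v : F} :
    v ∈ hc.stable x ↔ C.IsStable Q x v := Iff.rfl

lemma IsAbsorbingCone.stable_le (hc : C.IsAbsorbingCone Q N U) (x : X) :
    hc.stable x ≤ C.fiber x := fun _ hv => hv.1

end Absorbing

end LinearCocycle

/-! ### Limits of subspaces of constant dimension -/

section Subspaces

open Module

/-- Choose orthonormal bases and pass to a convergent subsequence: the limit is again orthonormal,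
so no dimension is lost, and its combinations are limits of the corresponding combinations. -/
lemma exists_limit_subspace_aux {G : Type*} [NormedAddCommGroup G] [InnerProductSpace ℝ G]
    [FiniteDimensional ℝ G] {r : ℕ} {S : ℕ → Submodule ℝ G} (hS : ∀ n, finrank ℝ (S n) = r) :
    ∃ L : Submodule ℝ G, finrank ℝ L = r ∧
      ∀ v ∈ L, ∀ O ∈ 𝓝 v, ∃ᶠ n in atTop, ∃ w ∈ S n, w ∈ O := by
  let e : ∀ n, OrthonormalBasis (Fin r) ℝ (S n) := fun n =>
    (stdOrthonormalBasis ℝ (S n)).reindex (finCongr (hS n))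
  let b : ℕ → Fin r → G := fun n i => (e n i : G)
  have hb : ∀ n, Orthonormal ℝ (b n) := fun n =>
    (e n).orthonormal.comp_linearIsometry (S n).subtypeₗᵢ
  have : ProperSpace G := FiniteDimensional.proper_real G
  obtain ⟨a, -, φ, hφ, ha⟩ := (isCompact_univ_pi fun _ : Fin r =>
    isCompact_closedBall (0 : G) 1).tendsto_subseq (x := b)
    fun n i _ => by simp [(hb n).1 i]
  have ha' := tendsto_pi_nhds.1 ha
  have hao : Orthonormal ℝ a := by
    rw [orthonormal_iff_ite]
    intro i j
    have h1 : Tendsto (fun n => inner ℝ (b (φ n) i) (b (φ n) j)) atTop (𝓝 (inner ℝ (a i) (a j))) :=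
      (ha' i).inner (ha' j)
    refine tendsto_nhds_unique h1 ?_
    simp only [(orthonormal_iff_ite.1 (hb _)) i j]
    exact tendsto_const_nhds
  refine ⟨Submodule.span ℝ (range a), ?_, fun v hv O hO => ?_⟩
  · simpa using finrank_span_eq_card hao.linearIndependent
  · obtain ⟨c, rfl⟩ := (Submodule.mem_span_range_iff_exists_fun ℝ).1 hv
    have h1 : Tendsto (fun n => ∑ i, c i • b (φ n) i) atTop (𝓝 (∑ i, c i • a i)) :=
      tendsto_finsetSum _ fun i _ => (ha' i).const_smul (c i)
    refine hφ.tendsto_atTop.frequently (Eventually.frequently ?_)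
    filter_upwards [h1 hO] with n hn
    exact ⟨_, Submodule.sum_mem _ fun i _ => Submodule.smul_mem _ _ (e (φ n) i).2, hn⟩

/-- A sequence of subspaces of constant dimension `r` has a limit subspace of dimension `r`. -/
lemma exists_limit_subspace {F : Type*} [NormedAddCommGroup F] [NormedSpace ℝ F]
    [FiniteDimensional ℝ F] {r : ℕ} {S : ℕ → Submodule ℝ F} (hS : ∀ n, finrank ℝ (S n) = r) :
    ∃ L : Submodule ℝ F, finrank ℝ L = r ∧
      ∀ v ∈ L, ∀ O ∈ 𝓝 v, ∃ᶠ n in atTop, ∃ w ∈ S n, w ∈ O := by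
  let T := toEuclidean (E := F)
  obtain ⟨L, hL, h⟩ := exists_limit_subspace_aux
    (S := fun n => (S n).map T.toLinearEquiv.toLinearMap) (r := r)
    (fun n => by rw [← hS n]; exact LinearEquiv.finrank_map_eq T.toLinearEquiv (S n))
  refine ⟨L.map T.symm.toLinearEquiv.toLinearMap, ?_, ?_⟩
  · rw [← hL]; exact LinearEquiv.finrank_map_eq T.symm.toLinearEquiv L
  · rintro _ ⟨v, hv, rfl⟩ O hO
    refine (h v hv (T.symm ⁻¹' O) (T.symm.continuous.continuousAt hO)).mono ?_
    rintro n ⟨_, ⟨w, hw, rfl⟩, hwO⟩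
    exact ⟨w, hw, by simpa [T] using hwO⟩

end Subspaces

/-! ### Accumulation and the dimension of the stable subspaces -/

namespace LinearCocycle

section Dimension

open Module

variable {X F : Type*} [TopologicalSpace X] [NormedAddCommGroup F] [NormedSpace ℝ F]
  {C : LinearCocycle X F} {Z : Set X} {Eu Es : X → Submodule ℝ F} {Q : X → F →L[ℝ] F}

/-- The vectors of `Eu`, hence those outside `Es`, eventually enter the unstable cone. -/
lemma IsDominatedOn.eventually_mem_cone (h : C.IsDominatedOn Z Eu Es)
    (hQ : C.IsProjectionOn Z Eu Es Q) {z : X} (hz : z ∈ Z) {w : F} (hw : w ∈ C.fiber z)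
    (hws : w ∉ Es z) : ∀ᶠ m : ℤ in atTop,
    ‖C.map m z w - Q (C.flow m z) (C.map m z w)‖ < ‖Q (C.flow m z) (C.map m z w)‖ := by
  have hu := hQ.mem_u z hz w
  have hs := hQ.sub_mem hz hw
  have hQ0 : Q z w ≠ 0 := fun h0 => hws ((hQ.mem_s_iff h.toIsSplittingOn hz hw).2 h0)
  have hpos : 0 < ‖Q z w‖ := norm_pos_iff.2 hQ0
  filter_upwards [h.dominated (‖w - Q z w‖ / ‖Q z w‖ + 1)] with m hm
  have := hm z hz _ hu _ hs
  rw [hQ.map_sub_apply_map h.toIsSplittingOn hz hw, hQ.apply_map h.toIsSplittingOn hz hw]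
  by_contra! hcon
  have hA : 0 < ‖C.map m z (Q z w)‖ := norm_pos_iff.2 (map_ne_zero m (h.u_le hz hu) hQ0)
  have h1 : (‖w - Q z w‖ / ‖Q z w‖ + 1) * (‖C.map m z (w - Q z w)‖ * ‖Q z w‖) =
      ‖C.map m z (w - Q z w)‖ * (‖w - Q z w‖ + ‖Q z w‖) := by
    field_simp
  rw [h1] at this
  have h2 : ‖C.map m z (Q z w)‖ * (‖w - Q z w‖ + ‖Q z w‖) ≤
    ‖C.map m z (w - Q z w)‖ * (‖w - Q z w‖ + ‖Q z w‖) := by gcongr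
  nlinarith

/-- Over $Z$ a vector with non-zero unstable part is eventually in the cone, while $Q$ vanishes
along the iterates of a vector of `Es`. -/
lemma IsDominatedOn.isStable_iff (h : C.IsDominatedOn Z Eu Es)
    (hQ : C.IsProjectionOn Z Eu Es Q) {z : X} (hz : z ∈ Z) {v : F} :
    C.IsStable Q z v ↔ v ∈ Es z := by
  constructor
  · rintro ⟨hv, rfl | hs⟩
    · exact zero_mem _
    by_contra hcon
    obtain ⟨n, h1, h2⟩ := ((h.eventually_mem_cone hQ hz hv hcon).and hs).exists
    exact lt_asymm h1 h2
  · intro hv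
    have hvf := h.s_le hz hv
    refine ⟨hvf, or_iff_not_imp_left.2 fun hv0 => Eventually.of_forall fun n => ?_⟩
    rw [hQ.map_sub_apply_map h.toIsSplittingOn hz hvf, hQ.apply_map h.toIsSplittingOn hz hvf,
      (hQ.mem_s_iff h.toIsSplittingOn hz hvf).1 hv]
    simpa using map_ne_zero n hvf hv0

variable (C) in
/-- Suitably rescaled forward iterates of `v` accumulate on a vector over `Z` which is not in the
subbundle `B`. -/
def AccumulatesOff (Z : Set X) (B : X → Submodule ℝ F) (x : X) (v : F) : Prop :=
  ∃ c : ℕ → ℝ, ∃ z ∈ Z, ∃ w ∉ B z,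
    MapClusterPt (z, w) atTop fun n : ℕ => (C.flow n x, c n • C.map n x v)

lemma mem_fiber_of_mapClusterPt {x z : X} {v w : F} {c : ℕ → ℝ}
    (h : MapClusterPt (z, w) atTop fun n : ℕ => (C.flow n x, c n • C.map n x v)) :
    w ∈ C.fiber z := by
  by_contra hcon
  have := h.frequently ((isClosed_fiber (C := C)).isOpen_compl.mem_nhds hcon)
  obtain ⟨n, hn⟩ := this.exists
  exact hn (Submodule.smul_mem _ _ (map_mem_fiber n x v))

lemma isOpen_setOf_mem_cone (hQ : Continuous Q) (m : ℤ) : IsOpen {p : X × F |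
    ‖C.map m p.1 p.2 - Q (C.flow m p.1) (C.map m p.1 p.2)‖ <
      ‖Q (C.flow m p.1) (C.map m p.1 p.2)‖} := by
  have hA := C.continuous_map m
  have hf := C.continuous_flow m
  exact isOpen_lt (by fun_prop) (by fun_prop)

lemma isOpen_setOf_notMem_cone (hQ : Continuous Q) (m : ℤ) : IsOpen {p : X × F |
    ‖Q (C.flow m p.1) (C.map m p.1 p.2)‖ <
      ‖C.map m p.1 p.2 - Q (C.flow m p.1) (C.map m p.1 p.2)‖} := by
  have hA := C.continuous_map m
  have hf := C.continuous_flow m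
  exact isOpen_lt (by fun_prop) (by fun_prop)

lemma tendsto_natCast_int_atTop : Tendsto (fun n : ℕ => (n : ℤ)) atTop atTop :=
  tendsto_natCast_atTop_atTop

/-- Some iterate of the limit vector `w` is strictly inside the cone. This is an open and
scale-invariant condition, so the orbit of `v` enters the cone at arbitrarily late times. -/
lemma IsDominatedOn.not_isStable (h : C.IsDominatedOn Z Eu Es) (hQ : C.IsProjectionOn Z Eu Es Q)
    {x : X} {v : F} (hv0 : v ≠ 0) (hacc : C.AccumulatesOff Z Es x v) : ¬ C.IsStable Q x v := by
  rintro ⟨hv, hs⟩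
  have hs := hs.resolve_left hv0
  obtain ⟨c, z, hz, w, hw, hcl⟩ := hacc
  obtain ⟨m, hm⟩ := (h.eventually_mem_cone hQ hz (mem_fiber_of_mapClusterPt hcl) hw).exists
  have h1 := hcl.frequently ((isOpen_setOf_mem_cone (C := C) hQ.continuous m).mem_nhds hm)
  have h2 := (tendsto_atTop_add_const_left atTop m tendsto_natCast_int_atTop).eventually hs
  obtain ⟨n, hn1, hn2⟩ := (h1.and_eventually h2).exists
  simp only [map_smul, ← smul_sub, norm_smul, ← C.flow_add, ← C.map_add] at hn1 hn2
  exact absurd (lt_of_mul_lt_mul_left hn1 (norm_nonneg _)) hn2.le.not_gt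

/-- If `v` were not stable it would remain in the cone from some time on. But a backward iterate of
the limit `w`, which is not in `Eu`, is strictly outside the cone, so iterates of `v` are outside it
at arbitrarily late times. -/
lemma IsAbsorbingCone.isStable {N : ℤ} {U : Set X} (hc : C.IsAbsorbingCone Q N U)
    (h : C.IsDominatedOn Z Eu Es) (hQ : C.IsProjectionOn Z Eu Es Q)
    {x : X} {v : F} (hv : v ∈ C.fiber x) (hacc : C.AccumulatesOff Z Eu x v) :
    C.IsStable Q x v := by
  by_contra hcon
  have hu := hc.eventually_of_not_isStable hv hcon
  obtain ⟨c, z, hz, w, hw, hcl⟩ := hacc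
  have hwf := mem_fiber_of_mapClusterPt hcl
  obtain ⟨m, hm⟩ := (h.reverse.eventually_mem_cone hQ.reverse hz (by simpa using hwf) hw).exists
  have hwf' := map_zero_map (C := C) (-m) z w
  simp only [reverse_map, reverse_flow, _root_.sub_apply, hwf',
    sub_sub_cancel] at hm
  have h1 := hcl.frequently ((isOpen_setOf_notMem_cone (C := C) hQ.continuous (-m)).mem_nhds hm)
  have h2 := (tendsto_atTop_add_const_left atTop (-m) tendsto_natCast_int_atTop).eventually hu
  obtain ⟨n, hn1, hn2⟩ := (h1.and_eventually h2).exists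
  simp only [map_smul, ← smul_sub, norm_smul, ← C.flow_add, ← C.map_add] at hn1 hn2
  have := lt_of_mul_lt_mul_left hn1 (norm_nonneg _)
  linarith [norm_nonneg (C.map (-m + n) x v - Q (C.flow (-m + n) x) (C.map (-m + n) x v))]

lemma finrank_map_eq (n : ℤ) {x : X} {S : Submodule ℝ F} (hS : S ≤ C.fiber x) :
    finrank ℝ (S.map (C.map n x).toLinearMap) = finrank ℝ S := by
  have : Function.Injective ((C.map n x).toLinearMap.domRestrict S) := by
    rw [← LinearMap.ker_eq_bot, LinearMap.ker_eq_bot']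
    intro s hs
    by_contra hcon
    exact map_ne_zero n (hS s.2) (by simpa using hcon) hs
  rw [← LinearMap.range_domRestrict, LinearMap.finrank_range_of_inj this]

/-- Near `Z`, the complement of the unstable cone contains subspaces of the dimension of `Es`. -/
lemma IsSplittingOn.eventually_exists_subspace (h : C.IsSplittingOn Z Eu Es)
    (hQ : C.IsProjectionOn Z Eu Es Q) {r : ℕ} (hr : ∀ z ∈ Z, finrank ℝ (Es z) = r) :
    ∀ᶠ x in 𝓝ˢ Z, ∃ S ≤ C.fiber x, finrank ℝ S = r ∧ ∀ v ∈ S, v ≠ 0 →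
      ‖Q x v‖ < ‖v - Q x v‖ := by
  rw [eventually_nhdsSet_iff_forall]
  intro z hz
  have hQc := hQ.continuous
  have h0c := C.continuous_map 0
  -- Project to `Es z`, then to the fibre at `x`. Since $QT$ vanishes at $z$ and $T$ is the identity
  -- on `Es z`, nearby vectors of the image have small unstable part.
  let T : X → F →L[ℝ] F := fun x => (C.map 0 x).comp (C.map 0 z - Q z)
  have hT : Continuous T := by fun_prop
  have hG : Continuous fun x => (Q x).comp (T x) := by fun_prop
  have hTs : ∀ s ∈ Es z, T z s = s := by
    intro s hs
    change C.map 0 z (C.map 0 z s - Q z s) = s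
    rw [(hQ.mem_s_iff h hz (h.s_le hz hs)).1 hs, sub_zero, mem_fiber.1 (h.s_le hz hs),
      mem_fiber.1 (h.s_le hz hs)]
  have hGz : (Q z).comp (T z) = 0 := by
    ext v
    have hv := hQ.mem_s z hz v
    change Q z (C.map 0 z (C.map 0 z v - Q z v)) = 0
    rw [mem_fiber.1 (h.s_le hz hv)]
    exact (hQ.mem_s_iff h hz (h.s_le hz hv)).1 hv
  have e1 : ∀ᶠ x in 𝓝 z, ‖T x - T z‖ < 1 / 8 := by
    have : Tendsto (fun x => ‖T x - T z‖) (𝓝 z) (𝓝 0) := by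
      have := ((hT.sub (continuous_const (y := T z))).norm).tendsto z
      simpa using this
    exact this.eventually (gt_mem_nhds (by norm_num))
  have e2 : ∀ᶠ x in 𝓝 z, ‖(Q x).comp (T x)‖ < 1 / 8 := by
    have : Tendsto (fun x => ‖(Q x).comp (T x)‖) (𝓝 z) (𝓝 0) := by
      have := hG.norm.tendsto z
      rwa [hGz, norm_zero] at this
    exact this.eventually (gt_mem_nhds (by norm_num))
  filter_upwards [e1, e2] with x h1 h2
  have b0 : ∀ s ∈ Es z, T x s = C.map 0 x s := by
    intro s hs
    change C.map 0 x (C.map 0 z s - Q z s) = _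
    rw [(hQ.mem_s_iff h hz (h.s_le hz hs)).1 hs, sub_zero, mem_fiber.1 (h.s_le hz hs)]
  have b1 : ∀ s ∈ Es z, 7 / 8 * ‖s‖ ≤ ‖C.map 0 x s‖ := by
    intro s hs
    have a1 := (T x - T z).le_of_opNorm_le h1.le s
    have a3 := norm_sub_norm_le (T z s) (T z s - T x s)
    rw [sub_sub_cancel, hTs s hs] at a3
    rw [_root_.sub_apply, norm_sub_rev, hTs s hs] at a1
    rw [← b0 s hs]
    linarith
  have b2 : ∀ s ∈ Es z, ‖Q x (C.map 0 x s)‖ ≤ 1 / 8 * ‖s‖ := by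
    intro s hs
    rw [← b0 s hs]
    exact ((Q x).comp (T x)).le_of_opNorm_le h2.le s
  have hinj : Function.Injective ((C.map 0 x).toLinearMap.domRestrict (Es z)) := by
    rw [← LinearMap.ker_eq_bot, LinearMap.ker_eq_bot']
    intro s hs
    have := b1 s s.2
    have hs' : C.map 0 x s = 0 := hs
    rw [hs', norm_zero] at this
    exact norm_le_zero_iff.1 (by simpa using (by linarith : ‖(s : F)‖ ≤ 0))
  refine ⟨(Es z).map (C.map 0 x).toLinearMap, ?_, ?_, ?_⟩
  · rintro _ ⟨s, hs, rfl⟩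
    exact ⟨(s : F), rfl⟩
  · rw [← LinearMap.range_domRestrict, LinearMap.finrank_range_of_inj hinj, hr z hz]
  · rintro _ ⟨s, hs, rfl⟩ hs0
    have hs0 : 0 < ‖s‖ := norm_pos_iff.2 fun h => hs0 (by simp [h])
    change ‖Q x (C.map 0 x s)‖ < ‖C.map 0 x s - Q x (C.map 0 x s)‖
    linarith [b1 s hs, b2 s hs, norm_sub_norm_le (C.map 0 x s) (Q x (C.map 0 x s))]

variable [FiniteDimensional ℝ F]

/-- Pull back to `x` the subspaces lying outside the cone at late times and take a limit `L`. If a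
vector of `L` were not stable, vectors of some pulled back subspace close to it would be trapped in
the cone before the late time at which they must be outside. -/
lemma IsAbsorbingCone.le_finrank_stable {N : ℤ} {U : Set X} (hc : C.IsAbsorbingCone Q N U)
    {r : ℕ} {x : X} (hx : ∀ᶠ n : ℤ in atTop, ∃ S ≤ C.fiber (C.flow n x), finrank ℝ S = r ∧
      ∀ v ∈ S, v ≠ 0 → ‖Q (C.flow n x) v‖ < ‖v - Q (C.flow n x) v‖) :
    r ≤ finrank ℝ (hc.stable x) := by
  obtain ⟨n₀, hn₀⟩ := eventually_atTop.1 hx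
  choose S hSle hSr hScone using fun n : ℕ => hn₀ (n₀ + n) (by lia)
  let S' : ℕ → Submodule ℝ F := fun n =>
    (S n).map (C.map (-(n₀ + n)) (C.flow (n₀ + n) x)).toLinearMap
  obtain ⟨L, hL, hlim⟩ := exists_limit_subspace (S := S') (r := r) fun n => by
    rw [← hSr n]; exact finrank_map_eq _ (hSle n)
  have hS'f : ∀ n, S' n ≤ C.fiber x := by
    rintro n _ ⟨s, hs, rfl⟩
    have := map_mem_fiber (C := C) (-(n₀ + n)) (C.flow (n₀ + n) x) s
    rwa [flow_neg_flow] at this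
  rw [← hL]
  refine Submodule.finrank_mono fun v hv => ?_
  have hvf : v ∈ C.fiber x := by
    by_contra hcon
    have hcl : IsClosed (C.fiber x : Set F) := (C.fiber x).closed_of_finiteDimensional
    obtain ⟨n, w, hw, hw'⟩ := (hlim v hv _ (hcl.isOpen_compl.mem_nhds hcon)).exists
    exact hw' (hS'f n hw)
  rw [hc.mem_stable]
  by_contra hcon
  obtain ⟨m, hm1, hm2⟩ := ((hc.eventually_of_not_isStable hvf hcon).and
    (eventually_forall_ge_atTop.2 (hc.absorbing x))).exists
  have hO : {w : F | ‖C.map m x w - Q (C.flow m x) (C.map m x w)‖ <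
      ‖Q (C.flow m x) (C.map m x w)‖} ∈ 𝓝 v := by
    refine (isOpen_lt (by fun_prop) (by fun_prop)).mem_nhds ?_
    simp only [mem_ofPred_eq]
    linarith [norm_nonneg (C.map m x v - Q (C.flow m x) (C.map m x v))]
  have hlarge : ∀ᶠ n : ℕ in atTop, m + N ≤ n₀ + n :=
    (tendsto_atTop_add_const_left atTop n₀ tendsto_natCast_int_atTop).eventually_ge_atTop _
  obtain ⟨n, ⟨w, hw, hwO⟩, hn⟩ := ((hlim v hv _ hO).and_eventually hlarge).exists
  simp only [mem_ofPred_eq] at hwO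
  have hw0 : w ≠ 0 := by
    rintro rfl
    simp at hwO
  have hwf := hS'f n hw
  have h1 := hc.map_mem_cone (map_mem_fiber m x w) (map_ne_zero m hwf hw0) hwO.le (M := n₀ + n - m)
    (fun j hj _ => by rw [← C.flow_add]; exact hm2 _ (by lia)) (n := n₀ + n - m) (by lia)
    (by have := hc.pos; lia)
  rw [← C.map_add, ← C.flow_add, sub_add_cancel] at h1
  obtain ⟨s, hs, rfl⟩ := hw
  have hs0 : s ≠ 0 := by
    rintro rfl
    simp at hw0
  have h2 := hScone n s hs hs0
  have h3 : C.map (n₀ + n) x (C.map (-(n₀ + n)) (C.flow (n₀ + n) x) s) = s := by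
    have := map_map_neg (C := C) (n₀ + n) (hSle n hs)
    rwa [flow_neg_flow] at this
  change 2 * ‖C.map (n₀ + n) x (C.map (-(n₀ + n)) (C.flow (n₀ + n) x) s) - Q (C.flow (n₀ + n) x)
    (C.map (n₀ + n) x (C.map (-(n₀ + n)) (C.flow (n₀ + n) x) s))‖ < ‖Q (C.flow (n₀ + n) x)
    (C.map (n₀ + n) x (C.map (-(n₀ + n)) (C.flow (n₀ + n) x) s))‖ at h1
  rw [h3] at h1
  linarith [norm_nonneg (s - Q (C.flow (n₀ + n) x) s)]

/-- A subspace contained in the cone at a time after which the orbit stays in `U` remains in the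
cone. Its pullback to `x` therefore meets the stable subspace only in 0. -/
lemma IsAbsorbingCone.finrank_stable_add_le {N : ℤ} {U : Set X} (hc : C.IsAbsorbingCone Q N U)
    {r : ℕ} {x : X} (hx : ∃ᶠ n : ℤ in atTop, ∃ S ≤ C.fiber (C.flow n x), finrank ℝ S = r ∧
      ∀ v ∈ S, v ≠ 0 → ‖v - Q (C.flow n x) v‖ ≤ ‖Q (C.flow n x) v‖) :
    finrank ℝ (hc.stable x) + r ≤ finrank ℝ (C.fiber x) := by
  obtain ⟨n, ⟨S, hSle, hSr, hS⟩, hnU⟩ := (hx.and_eventually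
    (eventually_forall_ge_atTop.2 (hc.absorbing x))).exists
  let S' : Submodule ℝ F := S.map (C.map (-n) (C.flow n x)).toLinearMap
  have hS'f : S' ≤ C.fiber x := by
    rintro _ ⟨s, hs, rfl⟩
    have := map_mem_fiber (C := C) (-n) (C.flow n x) s
    rwa [flow_neg_flow] at this
  have hS'r : finrank ℝ S' = r := by rw [← hSr]; exact finrank_map_eq _ hSle
  have hdisj : Disjoint (hc.stable x) S' := by
    rw [Submodule.disjoint_def]
    rintro v hv ⟨s, hs, rfl⟩
    by_contra hv0
    change C.map (-n) (C.flow n x) s ≠ 0 at hv0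
    have hs0 : s ≠ 0 := by rintro rfl; simp at hv0
    have hev := (hv.2.resolve_left hv0)
    have hmap : ∀ m, C.map m x (C.map (-n) (C.flow n x) s) = C.map (m - n) (C.flow n x) s := by
      intro m
      have := C.map_add m (-n) (C.flow n x) s
      rw [flow_neg_flow] at this
      exact this.symm
    obtain ⟨m, hm1, hm2⟩ := (hev.and (eventually_ge_atTop (n + N))).exists
    have h1 := hc.map_mem_cone (hSle hs) hs0 (hS s hs hs0) (M := m - n)
      (fun j hj _ => by rw [← C.flow_add]; exact hnU _ (by lia)) (n := m - n) (by lia)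
      (by have := hc.pos; lia)
    rw [← C.flow_add, sub_add_cancel] at h1
    change ‖Q (C.flow m x) (C.map m x (C.map (-n) (C.flow n x) s))‖ <
      ‖C.map m x (C.map (-n) (C.flow n x) s) -
        Q (C.flow m x) (C.map m x (C.map (-n) (C.flow n x) s))‖ at hm1
    rw [hmap] at hm1
    linarith [norm_nonneg (C.map (m - n) (C.flow n x) s - Q (C.flow m x)
      (C.map (m - n) (C.flow n x) s))]
  have h1 := Submodule.finrank_sup_add_finrank_inf_eq (hc.stable x) S'
  rw [hdisj.eq_bot, finrank_bot, add_zero, hS'r] at h1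
  rw [← h1]
  exact Submodule.finrank_mono (sup_le (hc.stable_le x) hS'f)

end Dimension

end LinearCocycle

/-! ### Closedness of the stable graph -/

namespace LinearCocycle

section ClosedGraph

variable {X F : Type*} [MetricSpace X] [CompactSpace X] [NormedAddCommGroup F] [NormedSpace ℝ F]
  [FiniteDimensional ℝ F] {C : LinearCocycle X F} {Q : X → F →L[ℝ] F} {N : ℤ} {U : Set X}

/-- After leaving `U` late, an orbit near an unstable vector yields, in the limit, a vector which
is stable for the reversed cocycle. -/
lemma IsAbsorbingCone.exists_limit (hc : C.IsAbsorbingCone Q N U) {D : Set X} {m : ℤ}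
    {x : ℕ → X} {v : ℕ → F} {M : ℕ → ℤ} (hv : ∀ n, C.IsStable Q (x n) (v n))
    (hcone : ∀ n, ‖C.map m (x n) (v n) - Q (C.flow m (x n)) (C.map m (x n) (v n))‖ <
      ‖Q (C.flow m (x n)) (C.map m (x n) (v n))‖)
    (hMlarge : ∀ n : ℕ, m + n ≤ M n)
    (hU : ∀ n j, m ≤ j → j < M n → C.flow j (x n) ∈ U)
    (hD : ∀ n, C.flow (M n + 1) (x n) ∈ D) :
    ∃ (y : ℕ → X) (w : ℕ → F) (y₀ : X) (w₀ : F), (∀ n, y n ∈ D) ∧ (∀ n, C.IsStable Q (y n) (w n)) ∧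
      Tendsto y atTop (𝓝 y₀) ∧ Tendsto w atTop (𝓝 w₀) ∧ ‖w₀‖ = 1 ∧
      C.reverse.IsStable (fun x => C.map 0 x - Q x) y₀ w₀ := by
  have hv0 : ∀ n, v n ≠ 0 := by
    intro n h
    have := hcone n
    simp [h] at this
  have hvf : ∀ n, v n ∈ C.fiber (x n) := fun n => (hv n).1
  let c : ℕ → ℝ := fun n => ‖C.map (M n + 1) (x n) (v n)‖⁻¹
  have hc0 : ∀ n, 0 < ‖C.map (M n + 1) (x n) (v n)‖ :=
    fun n => norm_pos_iff.2 (map_ne_zero _ (hvf n) (hv0 n))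
  let y : ℕ → X := fun n => C.flow (M n + 1) (x n)
  let w : ℕ → F := fun n => c n • C.map (M n + 1) (x n) (v n)
  have hw1 : ∀ n, ‖w n‖ = 1 := by
    intro n
    simp only [w, c, norm_smul, norm_inv, norm_norm]
    exact inv_mul_cancel₀ (hc0 n).ne'
  have hK : IsCompact {p : X × F | p.2 ∈ C.fiber p.1 ∧ ‖p.2‖ ≤ 1} :=
    isCompact_of_isClosed_of_norm_le (isClosed_fiber.inter
      (isClosed_le (f := fun p : X × F => ‖p.2‖) (by fun_prop) continuous_const)) 1 fun p hp => hp.2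
  obtain ⟨⟨y₀, w₀⟩, ⟨hw₀f, -⟩, φ, hφ, hlim⟩ := hK.tendsto_subseq (x := fun n => (y n, w n))
    fun n => ⟨Submodule.smul_mem _ _ (map_mem_fiber _ _ _), (hw1 n).le⟩
  have hy := (continuous_fst.tendsto _).comp hlim
  have hw := (continuous_snd.tendsto _).comp hlim
  refine ⟨y ∘ φ, w ∘ φ, y₀, w₀, fun n => hD _, fun n => ((hv _).map _).smul _, hy, hw, ?_, ?_⟩
  · refine tendsto_nhds_unique hw.norm ?_
    simp only [Function.comp_apply, hw1]
    exact tendsto_const_nhds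
  have hQ := hc.continuous
  refine ⟨by simpa using hw₀f, Or.inr ?_⟩
  -- The normalized vectors lie just after the exit time $M$, and their whole past back to time $m$,
  -- except for the first $N$ steps, is in the narrow cone. As $M\to\infty$, every backward iterate
  -- of the limit is in that cone, that is, outside the cone of the reversed cocycle.
  filter_upwards [eventually_ge_atTop 1] with i hi
  have hclosed : IsClosed {p : X × F |
      2 * ‖C.map (-i) p.1 p.2 - Q (C.flow (-i) p.1) (C.map (-i) p.1 p.2)‖ ≤
      ‖Q (C.flow (-i) p.1) (C.map (-i) p.1 p.2)‖} := by
    have hA := C.continuous_map (-i)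
    have hf := C.continuous_flow (-i)
    exact isClosed_le (by fun_prop) (by fun_prop)
  have hmem : (y₀, w₀) ∈ {p : X × F |
      2 * ‖C.map (-i) p.1 p.2 - Q (C.flow (-i) p.1) (C.map (-i) p.1 p.2)‖ ≤
      ‖Q (C.flow (-i) p.1) (C.map (-i) p.1 p.2)‖} := by
    refine hclosed.mem_of_tendsto hlim ?_
    have hev : ∀ᶠ n : ℕ in atTop, i + N ≤ n :=
      tendsto_natCast_int_atTop.eventually_ge_atTop _
    filter_upwards [hφ.tendsto_atTop.eventually hev] with n hn
    have hM := hMlarge (φ n)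
    have h1 := hc.map_mem_cone (map_mem_fiber m (x (φ n)) (v (φ n)))
      (map_ne_zero m (hvf _) (hv0 _)) (hcone (φ n)).le (M := M (φ n) - m)
      (fun j hj hj' => by rw [← C.flow_add]; exact hU _ _ (by lia) (by lia))
      (n := M (φ n) + 1 - i - m) (by lia) (by have := hc.pos; lia)
    rw [← C.map_add, ← C.flow_add, sub_add_cancel] at h1
    have e : M (φ n) + 1 - i = -i + (M (φ n) + 1) := by ring
    simp only [Function.comp_apply, y, w, map_smul, ← smul_sub, norm_smul]
    rw [← C.map_add, ← C.flow_add, ← e, mul_left_comm]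
    gcongr
  simp only [mem_ofPred_eq] at hmem
  have hw₀ : w₀ ≠ 0 := by
    rintro rfl
    have : Tendsto (fun n => ‖w (φ n)‖) atTop (𝓝 0) := by simpa using hw.norm
    simp only [hw1] at this
    exact one_ne_zero (tendsto_nhds_unique tendsto_const_nhds this)
  -- The limit retains only a weak inequality with factor 2; since the iterate is non-zero, this
  -- still gives the strict inequality with factor 1.
  have hpos : 0 < ‖C.map (-i) y₀ w₀‖ := norm_pos_iff.2 (map_ne_zero _ hw₀f hw₀)
  have htri := norm_add_le (Q (C.flow (-i) y₀) (C.map (-i) y₀ w₀))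
    (C.map (-i) y₀ w₀ - Q (C.flow (-i) y₀) (C.map (-i) y₀ w₀))
  rw [add_sub_cancel] at htri
  simp only [reverse_map, reverse_flow, _root_.sub_apply, map_zero_map, sub_sub_cancel]
  linarith

/-- The graph of the stable subspaces is closed as soon as no non-zero vector is stable for both
the cocycle and the reversed one. -/
theorem IsAbsorbingCone.isClosed_isStable (hc : C.IsAbsorbingCone Q N U)
    (hdisj : ∀ x v, C.IsStable Q x v →
      C.reverse.IsStable (fun x => C.map 0 x - Q x) x v → v = 0)
    (hk : ∃ k, ∀ x, x ∈ C.excursionSet U k) : IsClosed {p : X × F | C.IsStable Q p.1 p.2} := by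
  -- Induction on the number of excursions. If the limit `v₀` is not stable, the nearby stable
  -- vectors are in the cone at time $m$ and can leave it only through an excursion of their orbit.
  -- With no excursion allowed this is absurd; otherwise the points just after the excursion have
  -- one excursion fewer.
  have key : ∀ k, ∀ (x : ℕ → X) (v : ℕ → F) (x₀ : X) (v₀ : F), (∀ n, x n ∈ C.excursionSet U k) →
      (∀ n, C.IsStable Q (x n) (v n)) → Tendsto x atTop (𝓝 x₀) → Tendsto v atTop (𝓝 v₀) →
      C.IsStable Q x₀ v₀ := by
    intro k
    induction k with
    | zero => ?_
    | succ k ih => ?_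
    all_goals
      intro x v x₀ v₀ hD hv hx hvl
      by_contra hcon
      have hxv : Tendsto (fun n => (x n, v n)) atTop (𝓝 (x₀, v₀)) := hx.prodMk_nhds hvl
      have hv₀f : v₀ ∈ C.fiber x₀ :=
        isClosed_fiber.mem_of_tendsto hxv (Eventually.of_forall fun n => (hv n).1)
      obtain ⟨m, hm, hm0⟩ := ((eventually_forall_ge_atTop.2
        ((hc.eventually_of_not_isStable hv₀f hcon).and (hc.absorbing x₀))).and
          (eventually_ge_atTop 0)).exists
      have hcone : ∀ᶠ n in atTop,
          ‖C.map m (x n) (v n) - Q (C.flow m (x n)) (C.map m (x n) (v n))‖ <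
          ‖Q (C.flow m (x n)) (C.map m (x n) (v n))‖ := by
        refine hxv.eventually ((isOpen_setOf_mem_cone hc.continuous m).mem_nhds ?_)
        have := (hm m le_rfl).1
        simp only [mem_ofPred_eq]
        linarith [norm_nonneg (C.map m x₀ v₀ - Q (C.flow m x₀) (C.map m x₀ v₀))]
      have hexit : ∀ n, ‖C.map m (x n) (v n) - Q (C.flow m (x n)) (C.map m (x n) (v n))‖ <
          ‖Q (C.flow m (x n)) (C.map m (x n) (v n))‖ →
          ∃ M, m ≤ M ∧ C.flow M (x n) ∉ U ∧ ∀ j, m ≤ j → j < M → C.flow j (x n) ∈ U := by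
        intro n hn
        -- An orbit staying in `U` after time $m$ would keep `v n` in the cone, against its
        -- stability.
        have hex : ∃ i : ℕ, C.flow (m + i) (x n) ∉ U := by
          by_contra! hall
          have hv0 : v n ≠ 0 := by
            intro h
            simp [h] at hn
          obtain ⟨i, hi1, hi2⟩ := (((hv n).2.resolve_left hv0).and
            (eventually_ge_atTop (m + N))).exists
          have h1 := hc.map_mem_cone (map_mem_fiber m (x n) (v n))
            (map_ne_zero m (hv n).1 hv0) hn.le (M := i - m)
            (fun j hj _ => by
              rw [← C.flow_add, add_comm]
              have := hall j.toNat
              rwa [Int.toNat_of_nonneg hj] at this)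
            (n := i - m) (by lia) (by have := hc.pos; lia)
          rw [← C.map_add, ← C.flow_add, sub_add_cancel] at h1
          linarith [norm_nonneg (C.map i (x n) (v n) - Q (C.flow i (x n)) (C.map i (x n) (v n)))]
        classical
        refine ⟨m + Nat.find hex, by lia, Nat.find_spec hex, fun j hj hj' => ?_⟩
        have := Nat.find_min hex (m := (j - m).toNat) (by lia)
        rw [Int.toNat_of_nonneg (by lia), add_sub_cancel, not_not] at this
        exact this
    · obtain ⟨n, hn⟩ := hcone.exists
      obtain ⟨M, hM, hMU, -⟩ := hexit n hn
      exact hMU (hD n M (by lia))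
    -- The orbit of `x n` follows that of `x₀`, which stays in `U`, for any prescribed finite time.
    -- Along a suitable choice of indices the exit times thus tend to infinity.
    · have hstay : ∀ J : ℕ, ∀ᶠ n in atTop, ∀ j ∈ Finset.Icc m (m + J), C.flow j (x n) ∈ U := by
        intro J
        rw [Filter.eventually_all_finset]
        intro j hj
        exact ((C.continuous_flow j).tendsto x₀).comp hx
          |>.eventually (hc.isOpen.mem_nhds (hm j (Finset.mem_Icc.1 hj).1).2)
      choose n hn1 hn2 using fun J => (hcone.and (hstay J)).exists
      choose M hM1 hM2 hM3 using fun J => hexit (n J) (hn1 J)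
      have hMlarge : ∀ J : ℕ, m + J ≤ M J := by
        intro J
        by_contra! hlt
        exact hM2 J (hn2 J _ (Finset.mem_Icc.2 ⟨hM1 J, by lia⟩))
      obtain ⟨y, w, y₀, w₀, hy, hw, hyl, hwl, hw1, hrev⟩ := hc.exists_limit
        (D := C.excursionSet U k) (m := m) (x := x ∘ n) (v := v ∘ n) (M := M)
        (fun J => hv _) hn1 hMlarge hM3 (fun J => hD _ _ (by have := hM1 J; lia) (hM2 J))
      -- The limit unit vector is stable by induction and stable for the reversed cocycle by its
      -- past.
      have := hdisj _ _ (ih y w y₀ w₀ hy hw hyl hwl) hrev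
      simp [this] at hw1
  obtain ⟨k, hk⟩ := hk
  refine isClosed_of_closure_subset fun p hp => ?_
  obtain ⟨q, hq, hlim⟩ := mem_closure_iff_seq_limit.1 hp
  exact key k (fun n => (q n).1) (fun n => (q n).2) p.1 p.2 (fun n => hk _) hq
    ((continuous_fst.tendsto _).comp hlim) ((continuous_snd.tendsto _).comp hlim)

end ClosedGraph

end LinearCocycle

/-! ### Domination from a single time for each pair of vectors -/

namespace LinearCocycle

section Domination

variable {X F : Type*} [TopologicalSpace X] [NormedAddCommGroup F] [NormedSpace ℝ F]
  {C : LinearCocycle X F} {Z : Set X} {Eu Es : X → Submodule ℝ F}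

variable (C) in
/-- A continuous family of homogeneous functions which are positive on non-zero vectors of the
fibres. -/
structure IsFiberNorm (ν : X → F → ℝ) : Prop where
  continuous : Continuous fun p : X × F => ν p.1 p.2
  smul : ∀ x (c : ℝ) v, ν x (c • v) = |c| * ν x v
  pos : ∀ x, ∀ v ∈ C.fiber x, v ≠ 0 → 0 < ν x v

variable (C) in
lemma isFiberNorm_norm : C.IsFiberNorm fun _ v => ‖v‖ where
  continuous := by fun_prop
  smul _ c v := norm_smul c v
  pos _ _ _ hv := norm_pos_iff.2 hv

variable {ν : X → F → ℝ}

lemma IsFiberNorm.zero (hν : C.IsFiberNorm ν) (x : X) : ν x 0 = 0 := by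
  simpa using hν.smul x 0 0

lemma IsFiberNorm.nonneg (hν : C.IsFiberNorm ν) {x : X} {v : F} (hv : v ∈ C.fiber x) :
    0 ≤ ν x v := by
  rcases eq_or_ne v 0 with rfl | h
  · exact (hν.zero x).ge
  · exact (hν.pos x v hv h).le

variable [CompactSpace X] [FiniteDimensional ℝ F]

lemma IsFiberNorm.exists_bound (hν : C.IsFiberNorm ν) :
    ∃ R : ℝ, 0 < R ∧ ∀ x, ∀ v ∈ C.fiber x, ν x v ≤ R * ‖v‖ ∧ ‖v‖ ≤ R * ν x v := by
  let S : Set (X × F) := {p | p.2 ∈ C.fiber p.1 ∧ ‖p.2‖ = 1}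
  have hS : IsCompact S := isCompact_of_isClosed_of_norm_le (isClosed_fiber.inter
    (isClosed_eq (f := fun p : X × F => ‖p.2‖) (by fun_prop) continuous_const)) 1
    fun p hp => hp.2.le
  have hne : ∀ p ∈ S, 0 < ν p.1 p.2 := fun p hp =>
    hν.pos _ _ hp.1 (norm_pos_iff.1 (by rw [hp.2]; exact one_pos))
  obtain ⟨R₁, hR₁⟩ := hS.exists_bound_of_continuousOn hν.continuous.continuousOn
  obtain ⟨R₂, hR₂⟩ := hS.exists_bound_of_continuousOn (f := fun p => (ν p.1 p.2)⁻¹)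
    (hν.continuous.continuousOn.inv₀ fun p hp => (hne p hp).ne')
  refine ⟨|R₁| + |R₂| + 1, by positivity, fun x v hv => ?_⟩
  rcases eq_or_ne v 0 with rfl | hv0
  · simp [hν.zero]
  have hpos : 0 < ‖v‖ := norm_pos_iff.2 hv0
  have hνpos := hν.pos x v hv hv0
  have hmem : (x, ‖v‖⁻¹ • v) ∈ S :=
    ⟨Submodule.smul_mem _ _ hv, by simp [norm_smul, hpos.ne']⟩
  have h1 := hR₁ _ hmem
  have h2 := hR₂ _ hmem
  simp only [hν.smul, norm_mul, norm_inv, Real.norm_eq_abs, abs_inv,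
    abs_of_pos hνpos, abs_of_pos hpos, mul_inv, inv_inv] at h1 h2
  have h1' : ‖v‖⁻¹ * ν x v ≤ |R₁| + |R₂| + 1 := by
    linarith [le_abs_self R₁, abs_nonneg R₂]
  have h2' : ‖v‖ * (ν x v)⁻¹ ≤ |R₁| + |R₂| + 1 := by
    linarith [le_abs_self R₂, abs_nonneg R₁]
  constructor
  · rwa [inv_mul_le_iff₀ hpos, mul_comm] at h1'
  · rwa [← div_eq_mul_inv, div_le_iff₀ hνpos] at h2'

/-- At a fixed time the distortion of ratios is bounded; this pays for the leftover times shorter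
than one gaining block. -/
lemma IsFiberNorm.exists_map_bound (hν : C.IsFiberNorm ν) (n : ℤ) :
    ∃ B : ℝ, 0 ≤ B ∧ ∀ x, ∀ u ∈ C.fiber x, ∀ s ∈ C.fiber x,
      ν (C.flow n x) (C.map n x s) * ν x u ≤ B * (ν (C.flow n x) (C.map n x u) * ν x s) := by
  obtain ⟨R, hR0, hR⟩ := hν.exists_bound
  obtain ⟨A, hA0, hA⟩ := (isCompact_range (C.continuous_map n)).isBounded.exists_pos_norm_le
  obtain ⟨A', hA0', hA'⟩ := (isCompact_range (C.continuous_map (-n))).isBounded.exists_pos_norm_le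
  have h1 : ∀ x, ∀ s ∈ C.fiber x, ν (C.flow n x) (C.map n x s) ≤ R * A * R * ν x s := by
    intro x s hs
    calc ν (C.flow n x) (C.map n x s) ≤ R * ‖C.map n x s‖ := (hR _ _ (map_mem_fiber n x s)).1
      _ ≤ R * (A * ‖s‖) := by
          gcongr; exact (C.map n x).le_of_opNorm_le (hA _ ⟨x, rfl⟩) s
      _ ≤ R * (A * (R * ν x s)) := by gcongr; exact (hR x s hs).2
      _ = _ := by ring
  have h2 : ∀ x, ∀ u ∈ C.fiber x, ν x u ≤ R * A' * R * ν (C.flow n x) (C.map n x u) := by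
    intro x u hu
    calc ν x u ≤ R * ‖u‖ := (hR _ _ hu).1
      _ = R * ‖C.map (-n) (C.flow n x) (C.map n x u)‖ := by rw [map_neg_map n hu]
      _ ≤ R * (A' * ‖C.map n x u‖) := by
          gcongr; exact (C.map (-n) (C.flow n x)).le_of_opNorm_le (hA' _ ⟨_, rfl⟩) _
      _ ≤ R * (A' * (R * ν (C.flow n x) (C.map n x u))) := by
          gcongr; exact (hR _ _ (map_mem_fiber n x u)).2
      _ = _ := by ring
  refine ⟨(R * A * R) * (R * A' * R), by positivity, fun x u hu s hs => ?_⟩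
  have p1 := hν.nonneg hs
  have p2 := hν.nonneg hu
  calc _ ≤ (R * A * R * ν x s) * (R * A' * R * ν (C.flow n x) (C.map n x u)) :=
        mul_le_mul (h1 x s hs) (h2 x u hu) p2 (by positivity)
    _ = _ := by ring

/-- Each strict inequality leaves room for a factor less than 1 and holds on an open set of pairs,
so compactness of the set of unit pairs makes both the time and the factor uniform. -/
lemma IsSplittingOn.exists_uniform_time (h : C.IsSplittingOn Z Eu Es) (hν : C.IsFiberNorm ν)
    (hex : ∀ x ∈ Z, ∀ u ∈ Eu x, ∀ s ∈ Es x, u ≠ 0 → s ≠ 0 → ∃ n : ℤ, 0 < n ∧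
      ν (C.flow n x) (C.map n x s) * ν x u < ν (C.flow n x) (C.map n x u) * ν x s) :
    ∃ L : ℕ, ∃ θ : ℝ, 0 < θ ∧ θ < 1 ∧
      ∀ x ∈ Z, ∀ u ∈ Eu x, ∀ s ∈ Es x, u ≠ 0 → s ≠ 0 → ∃ n : ℤ, 0 < n ∧ n ≤ L ∧
        ν (C.flow n x) (C.map n x s) * ν x u ≤ θ * (ν (C.flow n x) (C.map n x u) * ν x s) := by
  let T : Set (X × F × F) := {p | (p.1 ∈ Z ∧ p.2.1 ∈ Eu p.1) ∧ (p.1 ∈ Z ∧ p.2.2 ∈ Es p.1) ∧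
    ‖p.2.1‖ = 1 ∧ ‖p.2.2‖ = 1}
  have hT : IsCompact T := by
    refine isCompact_of_isClosed_of_norm_le₂ ?_ 1 fun p hp => by
      rw [Prod.norm_def, hp.2.2.1, hp.2.2.2, max_self]
    exact (h.isClosed_u.preimage
        (f := fun p : X × F × F => ((p.1, p.2.1) : X × F)) (by fun_prop)).inter
      ((h.isClosed_s.preimage
        (f := fun p : X × F × F => ((p.1, p.2.2) : X × F)) (by fun_prop)).inter
      ((isClosed_eq (f := fun p : X × F × F => ‖p.2.1‖) (by fun_prop) continuous_const).inter
        (isClosed_eq (f := fun p : X × F × F => ‖p.2.2‖) (by fun_prop) continuous_const)))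
  -- One index governs both the bound on the time and the factor, so that the open sets increase
  -- with `L`; the shift by 2 keeps the factor positive also for `L = 0`.
  let θ : ℕ → ℝ := fun L => 1 - 1 / (L + 2)
  let O : ℕ → Set (X × F × F) := fun L => {p | ∃ n : ℤ, (0 < n ∧ n ≤ L) ∧
    ν (C.flow n p.1) (C.map n p.1 p.2.2) * ν p.1 p.2.1 <
      θ L * (ν (C.flow n p.1) (C.map n p.1 p.2.1) * ν p.1 p.2.2)}
  have hθmono : Monotone θ := fun a b hab => by
    have : (a : ℝ) ≤ b := by exact_mod_cast hab
    simp only [θ]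
    gcongr
  have hOopen : ∀ L, IsOpen (O L) := by
    intro L
    have : O L = ⋃ n : ℤ, {p | (0 < n ∧ n ≤ L) ∧
      ν (C.flow n p.1) (C.map n p.1 p.2.2) * ν p.1 p.2.1 <
      θ L * (ν (C.flow n p.1) (C.map n p.1 p.2.1) * ν p.1 p.2.2)} := by
      ext p; simp [O]
    rw [this]
    refine isOpen_iUnion fun n => isOpen_const.inter ?_
    have hc := hν.continuous
    have h1 : Continuous fun p : X × F × F => ν (C.flow n p.1) (C.map n p.1 p.2.2) :=
      hc.comp ((continuous_action n).comp (continuous_fst.prodMk continuous_snd.snd))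
    have h2 : Continuous fun p : X × F × F => ν (C.flow n p.1) (C.map n p.1 p.2.1) :=
      hc.comp ((continuous_action n).comp (continuous_fst.prodMk continuous_snd.fst))
    have h3 : Continuous fun p : X × F × F => ν p.1 p.2.1 :=
      hc.comp (continuous_fst.prodMk continuous_snd.fst)
    have h4 : Continuous fun p : X × F × F => ν p.1 p.2.2 :=
      hc.comp (continuous_fst.prodMk continuous_snd.snd)
    exact isOpen_lt (h1.mul h3) (continuous_const.mul (h2.mul h4))
  have hcov : T ⊆ ⋃ L, O L := by
    rintro ⟨x, u, s⟩ ⟨⟨hx, hu⟩, ⟨-, hs⟩, hu1, hs1⟩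
    have hu0 : u ≠ 0 := by rintro rfl; simp at hu1
    have hs0 : s ≠ 0 := by rintro rfl; simp at hs1
    obtain ⟨n, hn, hlt⟩ := hex x hx u hu s hs hu0 hs0
    have hlim : Tendsto (fun L : ℕ => θ L * (ν (C.flow n x) (C.map n x u) * ν x s)) atTop
        (𝓝 (1 * (ν (C.flow n x) (C.map n x u) * ν x s))) := by
      refine Tendsto.mul_const _ ?_
      have h2 : Tendsto (fun L : ℕ => 1 / ((L : ℝ) + 2)) atTop (𝓝 0) :=
        tendsto_const_nhds.div_atTop
          (tendsto_natCast_atTop_atTop.atTop_add tendsto_const_nhds)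
      simpa [θ] using h2.const_sub 1
    rw [one_mul] at hlim
    obtain ⟨L, hL1, hL2⟩ := ((hlim.eventually (lt_mem_nhds hlt)).and
      (tendsto_natCast_int_atTop.eventually_ge_atTop n)).exists
    exact mem_iUnion.2 ⟨L, n, ⟨hn, hL2⟩, hL1⟩
  have hnn : ∀ n x, ∀ u ∈ C.fiber x, ∀ s ∈ C.fiber x,
      0 ≤ ν (C.flow n x) (C.map n x u) * ν x s := fun n x u _ s hs =>
    mul_nonneg (hν.nonneg (map_mem_fiber n x u)) (hν.nonneg hs)
  obtain ⟨L, hL⟩ : ∃ L, T ⊆ O L := by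
    obtain ⟨t, ht⟩ := hT.elim_finite_subcover O hOopen hcov
    refine ⟨t.sup id, fun p hp => ?_⟩
    obtain ⟨L, hLt, n, hn, hlt⟩ := by simpa only [mem_iUnion, exists_prop] using ht hp
    have hle : L ≤ t.sup id := Finset.le_sup (f := id) hLt
    refine ⟨n, ⟨hn.1, hn.2.trans (by exact_mod_cast hle)⟩, hlt.trans_le ?_⟩
    exact mul_le_mul_of_nonneg_right (hθmono hle)
      (hnn n p.1 _ (h.u_le hp.1.1 hp.1.2) _ (h.s_le hp.1.1 hp.2.1.2))
  have hθ1 : 1 / ((L : ℝ) + 2) < 1 := by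
    rw [div_lt_one (by positivity)]
    have : (0 : ℝ) ≤ L := by positivity
    linarith
  refine ⟨L, θ L, by simp only [θ]; linarith, by
    simp only [θ]; have : 0 < 1 / ((L : ℝ) + 2) := by positivity
    linarith, fun x hx u hu s hs hu0 hs0 => ?_⟩
  have hpu : 0 < ‖u‖ := norm_pos_iff.2 hu0
  have hps : 0 < ‖s‖ := norm_pos_iff.2 hs0
  have hmem : (x, ‖u‖⁻¹ • u, ‖s‖⁻¹ • s) ∈ T := ⟨⟨hx, Submodule.smul_mem _ _ hu⟩,
    ⟨hx, Submodule.smul_mem _ _ hs⟩, by simp [norm_smul, hpu.ne'], by simp [norm_smul, hps.ne']⟩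
  obtain ⟨n, ⟨hn0, hnL⟩, hlt⟩ := hL hmem
  refine ⟨n, hn0, hnL, ?_⟩
  simp only [map_smul, hν.smul, abs_inv, abs_norm] at hlt
  have hpos : 0 < ‖u‖⁻¹ * ‖s‖⁻¹ := by positivity
  refine le_of_mul_le_mul_left ?_ hpos
  linarith

/-- A splitting is dominated as soon as, for some fibre norm, any pair of vectors is dominated at
some time. -/
theorem IsSplittingOn.isDominatedOn (h : C.IsSplittingOn Z Eu Es) (hν : C.IsFiberNorm ν)
    (hex : ∀ x ∈ Z, ∀ u ∈ Eu x, ∀ s ∈ Es x, u ≠ 0 → s ≠ 0 → ∃ n : ℤ, 0 < n ∧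
      ν (C.flow n x) (C.map n x s) * ν x u < ν (C.flow n x) (C.map n x u) * ν x s) :
    C.IsDominatedOn Z Eu Es where
  toIsSplittingOn := h
  dominated c := by
    obtain ⟨L, θ, hθ0, hθ1, hL⟩ := h.exists_uniform_time hν hex
    choose B hB0 hB using hν.exists_map_bound
    let B' : ℝ := ∑ n ∈ Finset.Icc (0 : ℤ) L, B n + 1
    have hB' : ∀ n : ℤ, 0 ≤ n → n ≤ L → B n ≤ B' := by
      intro n h0 h1
      have := Finset.single_le_sum (f := B) (fun i _ => hB0 i) (Finset.mem_Icc.2 ⟨h0, h1⟩)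
      simp only [B']
      linarith
    have hB'0 : 0 ≤ B' := by
      have : 0 ≤ ∑ n ∈ Finset.Icc (0 : ℤ) L, B n := Finset.sum_nonneg fun i _ => hB0 i
      simp only [B']
      linarith
    -- Cut the time into blocks of length at most `L`, each gaining the factor `θ`: time at least
    -- $qL$ provides $q$ gains, and further blocks lose nothing because `θ < 1`. The last piece
    -- costs at most `B'`.
    have key : ∀ k : ℕ, ∀ n q : ℕ, n ≤ k → q * L ≤ n → ∀ x ∈ Z, ∀ u ∈ Eu x, ∀ s ∈ Es x, u ≠ 0 →
        s ≠ 0 → ν (C.flow n x) (C.map n x s) * ν x u ≤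
          B' * θ ^ q * (ν (C.flow n x) (C.map n x u) * ν x s) := by
      intro k
      induction k with
      | zero =>
        intro n q hn hq x hx u hu s hs hu0 hs0
        have hn0 : n = 0 := by lia
        subst hn0
        obtain ⟨n₁, h1, h2, -⟩ := hL x hx u hu s hs hu0 hs0
        have hq0 : q = 0 := by
          have : 0 < L := by lia
          rcases Nat.mul_eq_zero.1 (Nat.le_zero.1 hq) with h | h <;> lia
        subst hq0
        rw [pow_zero, mul_one]
        refine (hB 0 x u (h.u_le hx hu) s (h.s_le hx hs)).trans ?_
        refine mul_le_mul_of_nonneg_right (hB' 0 le_rfl (by lia)) ?_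
        exact mul_nonneg (hν.nonneg (map_mem_fiber _ _ _)) (hν.nonneg (h.s_le hx hs))
      | succ k ih =>
        intro n q hn hq x hx u hu s hs hu0 hs0
        obtain ⟨n₁, h1, h2, h3⟩ := hL x hx u hu s hs hu0 hs0
        have huf := h.u_le hx hu
        have hsf := h.s_le hx hs
        have pu := hν.pos x u huf hu0
        have ps := hν.pos x s hsf hs0
        rcases q.eq_zero_or_pos with rfl | hqpos
        · rcases le_or_gt n L with hnL | hnL
          · rw [pow_zero, mul_one]
            refine (hB n x u huf s hsf).trans ?_
            refine mul_le_mul_of_nonneg_right (hB' n (by lia) (by lia)) ?_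
            exact mul_nonneg (hν.nonneg (map_mem_fiber _ _ _)) ps.le
          · have pn₁ := hν.pos _ _ (map_mem_fiber n₁ x u) (map_ne_zero n₁ huf hu0)
            have pn₁' := hν.pos _ _ (map_mem_fiber n₁ x s) (map_ne_zero n₁ hsf hs0)
            have h4 := ih (n - n₁.toNat) 0 (by lia) (by simp) _ (h.flow_mem x hx n₁) _
              (h.map_u x hx n₁ u hu) _ (h.map_s x hx n₁ s hs) (map_ne_zero n₁ huf hu0)
              (map_ne_zero n₁ hsf hs0)
            rw [← C.map_add, ← C.map_add, ← C.flow_add,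
              show ((n - n₁.toNat : ℕ) : ℤ) + n₁ = n by lia] at h4
            have p1 := hν.nonneg (map_mem_fiber (C := C) n x u)
            have p2 := hν.nonneg (map_mem_fiber (C := C) n x s)
            refine le_of_mul_le_mul_right ?_ pn₁
            calc _ = (ν (C.flow n x) (C.map n x s) * ν (C.flow n₁ x) (C.map n₁ x u)) * ν x u := by
                  ring
              _ ≤ (B' * θ ^ 0 * (ν (C.flow n x) (C.map n x u) *
                    ν (C.flow n₁ x) (C.map n₁ x s))) * ν x u := by gcongr
              _ = B' * θ ^ 0 * ν (C.flow n x) (C.map n x u) *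
                    (ν (C.flow n₁ x) (C.map n₁ x s) * ν x u) := by ring
              _ ≤ B' * θ ^ 0 * ν (C.flow n x) (C.map n x u) *
                    (1 * (ν (C.flow n₁ x) (C.map n₁ x u) * ν x s)) := by
                  have h5 := h3.trans (mul_le_mul_of_nonneg_right hθ1.le (by positivity))
                  exact mul_le_mul_of_nonneg_left h5 (by positivity)
              _ = _ := by ring
        · obtain ⟨q, rfl⟩ : ∃ q', q = q' + 1 := ⟨q - 1, by lia⟩
          rw [Nat.succ_mul] at hq
          have pn₁ := hν.pos _ _ (map_mem_fiber n₁ x u) (map_ne_zero n₁ huf hu0)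
          have pn₁' := hν.pos _ _ (map_mem_fiber n₁ x s) (map_ne_zero n₁ hsf hs0)
          have h4 := ih (n - n₁.toNat) q (by lia) (by lia) _ (h.flow_mem x hx n₁) _
            (h.map_u x hx n₁ u hu) _ (h.map_s x hx n₁ s hs) (map_ne_zero n₁ huf hu0)
            (map_ne_zero n₁ hsf hs0)
          rw [← C.map_add, ← C.map_add, ← C.flow_add,
            show ((n - n₁.toNat : ℕ) : ℤ) + n₁ = n by lia] at h4
          have p1 := hν.nonneg (map_mem_fiber (C := C) n x u)
          have p2 := hν.nonneg (map_mem_fiber (C := C) n x s)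
          refine le_of_mul_le_mul_right ?_ pn₁
          calc _ = (ν (C.flow n x) (C.map n x s) * ν (C.flow n₁ x) (C.map n₁ x u)) * ν x u := by
                ring
            _ ≤ (B' * θ ^ q * (ν (C.flow n x) (C.map n x u) *
                  ν (C.flow n₁ x) (C.map n₁ x s))) * ν x u := by gcongr
            _ = B' * θ ^ q * ν (C.flow n x) (C.map n x u) *
                  (ν (C.flow n₁ x) (C.map n₁ x s) * ν x u) := by ring
            _ ≤ B' * θ ^ q * ν (C.flow n x) (C.map n x u) *
                  (θ * (ν (C.flow n₁ x) (C.map n₁ x u) * ν x s)) := by gcongr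
            _ = _ := by ring
    obtain ⟨R, hR0, hR⟩ := hν.exists_bound
    have hlim : Tendsto (fun q : ℕ => |c| * R ^ 4 * B' * θ ^ q) atTop (𝓝 0) := by
      simpa using (tendsto_pow_atTop_nhds_zero_of_lt_one hθ0.le hθ1).const_mul (|c| * R ^ 4 * B')
    -- The four factors $R$ come from replacing the fibre norm by the ambient norm at the four
    -- vectors.
    obtain ⟨q, hq⟩ := (hlim.eventually (gt_mem_nhds one_pos)).exists
    filter_upwards [eventually_ge_atTop ((q * L : ℕ) : ℤ)] with n hn x hx u hu s hs
    rcases eq_or_ne u 0 with rfl | hu0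
    · simp
    rcases eq_or_ne s 0 with rfl | hs0
    · simp
    lift n to ℕ using by lia
    have huf := h.u_le hx hu
    have hsf := h.s_le hx hs
    have h1 := key n n q le_rfl (by lia) x hx u hu s hs hu0 hs0
    have p1 := hν.nonneg (map_mem_fiber (C := C) n x u)
    have p2 := hν.nonneg (map_mem_fiber (C := C) n x s)
    have p3 := hν.nonneg huf
    have p4 := hν.nonneg hsf
    calc c * (‖C.map n x s‖ * ‖u‖)
        ≤ |c| * ((R * ν (C.flow n x) (C.map n x s)) * (R * ν x u)) := by
          gcongr
          · exact le_abs_self c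
          · exact (hR _ _ (map_mem_fiber n x s)).2
          · exact (hR _ _ huf).2
      _ = |c| * R ^ 2 * (ν (C.flow n x) (C.map n x s) * ν x u) := by ring
      _ ≤ |c| * R ^ 2 * (B' * θ ^ q * (ν (C.flow n x) (C.map n x u) * ν x s)) := by gcongr
      _ ≤ |c| * R ^ 2 * (B' * θ ^ q * ((R * ‖C.map n x u‖) * (R * ‖s‖))) := by
          gcongr
          · exact (hR _ _ (map_mem_fiber n x u)).1
          · exact (hR _ _ hsf).1
      _ = (|c| * R ^ 4 * B' * θ ^ q) * (‖C.map n x u‖ * ‖s‖) := by ring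
      _ ≤ 1 * (‖C.map n x u‖ * ‖s‖) := by gcongr
      _ = _ := one_mul _

end Domination

end LinearCocycle

/-! ### Extension of a dominated splitting of a cocycle -/

namespace LinearCocycle

section Extension

open Module

variable {X F : Type*} [MetricSpace X] [CompactSpace X] [NormedAddCommGroup F] [NormedSpace ℝ F]
  [FiniteDimensional ℝ F] {C : LinearCocycle X F} {Z : Set X} {Eu Es : X → Submodule ℝ F}

lemma finrank_add_finrank_eq {V : Type*} [AddCommGroup V] [Module ℝ V] [FiniteDimensional ℝ V]
    {S T W : Submodule ℝ V} (hd : Disjoint S T) (hs : S ⊔ T = W) :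
    finrank ℝ S + finrank ℝ T = finrank ℝ W := by
  have := Submodule.finrank_sup_add_finrank_inf_eq S T
  rw [hd.eq_bot, finrank_bot, add_zero, hs] at this
  exact this.symm

/-- The stable subspaces of a cocycle and of its reversal, when they form a splitting at some point
of every orbit, form a splitting over the whole space. -/
lemma isSplittingOn_univ {Q Q' : X → F →L[ℝ] F} {N N' : ℤ} {U U' : Set X}
    (hc : C.IsAbsorbingCone Q N U) (hc' : C.reverse.IsAbsorbingCone Q' N' U')
    (hQ' : Q' = fun x => C.map 0 x - Q x)
    (hk : ∃ k, ∀ x, x ∈ C.excursionSet U k) (hk' : ∃ k, ∀ x, x ∈ C.reverse.excursionSet U' k)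
    (h : ∀ x, ∃ k : ℤ, Disjoint (hc'.stable (C.flow k x)) (hc.stable (C.flow k x)) ∧
      C.fiber (C.flow k x) ≤ hc'.stable (C.flow k x) ⊔ hc.stable (C.flow k x)) :
    C.IsSplittingOn univ hc'.stable hc.stable := by
  have mapu : ∀ x n v, v ∈ hc'.stable x → C.map n x v ∈ hc'.stable (C.flow n x) := by
    intro x n v hv
    have := IsStable.map (k := -n) hv
    rwa [reverse_map, reverse_flow, neg_neg] at this
  have maps : ∀ x n v, v ∈ hc.stable x → C.map n x v ∈ hc.stable (C.flow n x) :=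
    fun x n v hv => IsStable.map hv n
  have hdisj : ∀ x, Disjoint (hc'.stable x) (hc.stable x) := by
    intro x
    obtain ⟨k, hd, -⟩ := h x
    rw [Submodule.disjoint_def] at hd ⊢
    intro v hu hs
    by_contra hv0
    exact map_ne_zero k (hc.stable_le x hs) hv0 (hd _ (mapu x k v hu) (maps x k v hs))
  have hule : ∀ x, hc'.stable x ≤ C.fiber x := fun x => by simpa using hc'.stable_le x
  have hcls : IsClosed {p : X × F | C.IsStable Q p.1 p.2} := by
    refine hc.isClosed_isStable (fun x v hs hu => ?_) hk
    rw [← hQ'] at hu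
    exact Submodule.disjoint_def.1 (hdisj x) v hu hs
  have hclu : IsClosed {p : X × F | C.reverse.IsStable Q' p.1 p.2} := by
    refine hc'.isClosed_isStable (fun x v hu hs => ?_) hk'
    have : (fun x => C.reverse.map 0 x - Q' x) = Q := by
      funext x
      simp [hQ']
    rw [reverse_reverse, this] at hs
    exact Submodule.disjoint_def.1 (hdisj x) v hu hs
  exact
  { isClosed_u := by simpa using hclu
    isClosed_s := by simpa using hcls
    flow_mem := fun _ _ _ => mem_univ _
    disjoint := fun x _ => hdisj x
    sup_eq := fun x _ => by
      refine le_antisymm (sup_le (hule x) (hc.stable_le x)) fun v hv => ?_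
      obtain ⟨k, -, hk⟩ := h x
      obtain ⟨u, hu, s, hs, hus⟩ := Submodule.mem_sup.1 (hk (map_mem_fiber k x v))
      have h1 := mapu _ (-k) u hu
      have h2 := maps _ (-k) s hs
      rw [flow_neg_flow] at h1 h2
      refine Submodule.mem_sup.2 ⟨_, h1, _, h2, ?_⟩
      rw [← _root_.map_add, hus, map_neg_map k hv]
    map_u := fun x _ n v hv => mapu x n v hv
    map_s := fun x _ n v hv => maps x n v hv }

/-- If all points off `Z` are wandering and every orbit off `Z` carries a subspace of the dimension
of `Eu` whose vectors accumulate off `Es` in both time directions, then a dominated splitting over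
`Z` extends to the whole space. -/
theorem IsDominatedOn.exists_extension {D d : ℕ} (h : C.IsDominatedOn Z Eu Es)
    (hw : ∀ x ∉ Z, C.IsWandering x) (hD : ∀ x, finrank ℝ (C.fiber x) = D)
    (hd : ∀ z ∈ Z, finrank ℝ (Eu z) = d)
    (hV : ∀ x ∉ Z, ∃ k : ℤ, ∃ V ≤ C.fiber (C.flow k x), finrank ℝ V = d ∧ ∀ v ∈ V, v ≠ 0 →
      C.AccumulatesOff Z Es (C.flow k x) v ∧ C.reverse.AccumulatesOff Z Es (C.flow k x) v) :
    ∃ Eu' Es' : X → Submodule ℝ F, C.IsDominatedOn univ Eu' Es' ∧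
      (∀ z ∈ Z, Eu' z = Eu z ∧ Es' z = Es z) ∧ (∀ x, finrank ℝ (Eu' x) = d) ∧
      (∀ x, ∀ v ∈ C.fiber x, C.reverse.AccumulatesOff Z Es x v → v ∈ Eu' x) ∧
      (∀ x, ∀ v ∈ C.fiber x, C.AccumulatesOff Z Eu x v → v ∈ Es' x) := by
  have hsp := h.toIsSplittingOn
  obtain ⟨Q, hQc, hQZ⟩ := hsp.exists_projection
  have hQ : C.IsProjectionOn Z Eu Es Q := ⟨hQc, fun z hz v => (hQZ z hz v).1,
    fun z hz v => (hQZ z hz v).2⟩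
  have hwr : ∀ x ∉ Z, C.reverse.IsWandering x := fun x hx => (hw x hx).reverse
  obtain ⟨N, U, hZU, hc⟩ := h.exists_isAbsorbingCone hQ hw
  obtain ⟨N', U', hZU', hc'⟩ := h.reverse.exists_isAbsorbingCone hQ.reverse hwr
  have hZs : ∀ z ∈ Z, hc.stable z = Es z := fun z hz => by
    ext v; exact h.isStable_iff hQ hz
  have hZu : ∀ z ∈ Z, hc'.stable z = Eu z := fun z hz => by
    ext v; exact h.reverse.isStable_iff hQ.reverse hz
  -- If $Z$ were empty, orbits would converge to the empty set. A point of $Z$ is needed to know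
  -- $d\le D$, so that the natural number $D-d$ is a true difference.
  have hZne : ∀ _ : X, ∃ z, z ∈ Z := by
    intro x
    by_contra! hcon
    obtain ⟨n, hn⟩ := (eventually_flow_mem (C := C) isOpen_empty
      (fun z hz => (hcon z hz).elim) hw x).exists
    exact hn
  have hsum : ∀ z ∈ Z, d + finrank ℝ (Es z) = D := fun z hz => by
    rw [← hd z hz, ← hD z]
    exact finrank_add_finrank_eq (hsp.disjoint z hz) (hsp.sup_eq z hz)
  have hEs : ∀ z ∈ Z, finrank ℝ (Es z) = D - d := fun z hz => by have := hsum z hz; lia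
  have hdD : ∀ _ : X, d + (D - d) = D := fun x => by
    obtain ⟨z, hz⟩ := hZne x
    have := hsum z hz
    lia
  -- subspaces in the cones near `Z`
  obtain ⟨Os, hOs, hZOs, hSs⟩ := mem_nhdsSet_iff_exists.1 (hsp.eventually_exists_subspace hQ hEs)
  have hdim_s : ∀ x, D - d ≤ finrank ℝ (hc.stable x) := fun x =>
    hc.le_finrank_stable ((eventually_flow_mem hOs hZOs hw x).mono fun n hn => hSs hn)
  -- The subspaces outside the unstable cone are inside the cone of the reversed cocycle, so the
  -- upper bound applies in reversed time.
  have hdim_u : ∀ x, finrank ℝ (hc'.stable x) + (D - d) ≤ D := by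
    intro x
    have := hc'.finrank_stable_add_le (r := D - d) (x := x) ?_
    · rwa [reverse_fiber, hD] at this
    · refine ((eventually_flow_mem (C := C.reverse) hOs hZOs hwr x).mono fun n hn => ?_).frequently
      obtain ⟨S, hS, hSr, hcone⟩ := hSs hn
      refine ⟨S, by simpa using hS, hSr, fun v hv hv0 => ?_⟩
      have := hcone v hv hv0
      have hv' := mem_fiber.1 (hS hv)
      rw [reverse_flow] at hv' this ⊢
      rw [_root_.sub_apply, hv', sub_sub_cancel]
      exact this.le
  have hk := exists_forall_mem_excursionSet hc.isOpen hZU hw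
  have hk' := exists_forall_mem_excursionSet hc'.isOpen hZU' hwr
  have hsplit : C.IsSplittingOn univ hc'.stable hc.stable := by
    refine isSplittingOn_univ hc hc' rfl hk hk' fun x => ?_
    by_cases hx : x ∈ Z
    · refine ⟨0, ?_⟩
      rw [C.flow_zero, hZs x hx, hZu x hx]
      exact ⟨hsp.disjoint x hx, (hsp.sup_eq x hx).ge⟩
    · obtain ⟨k, V, hVle, hVd, hVacc⟩ := hV x hx
      refine ⟨k, ?_⟩
      set y := C.flow k x
      -- Backward accumulation off `Es` means stability for the reversed cocycle, in which `Es`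
      -- plays the unstable role; the dimension bound turns the inclusion into equality.
      have hVu : V = hc'.stable y := by
        refine Submodule.eq_of_le_of_finrank_le (fun v hv => ?_) ?_
        · rcases eq_or_ne v 0 with rfl | hv0
          · exact zero_mem _
          exact hc'.isStable h.reverse hQ.reverse (by simpa using hVle hv) (hVacc v hv hv0).2
        · have := hdim_u y
          have := hdD y
          lia
      have hdisj : Disjoint (hc'.stable y) (hc.stable y) := by
        rw [Submodule.disjoint_def, ← hVu]
        intro v hv hs
        by_contra hv0
        exact h.not_isStable hQ hv0 (hVacc v hv hv0).1 hs
      refine ⟨hdisj, ?_⟩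
      have hle : hc'.stable y ⊔ hc.stable y ≤ C.fiber y :=
        sup_le (hVu ▸ hVle) (hc.stable_le y)
      refine (Submodule.eq_of_le_of_finrank_le hle ?_).ge
      rw [← finrank_add_finrank_eq hdisj rfl, ← hVu, hVd, hD]
      have := hdim_s y
      have := hdD y
      lia
  refine ⟨hc'.stable, hc.stable, hsplit.isDominatedOn (isFiberNorm_norm C) ?_,
    fun z hz => ⟨hZu z hz, hZs z hz⟩, fun x => ?_,
    fun x v hv hacc => hc'.isStable h.reverse hQ.reverse (by simpa using hv) hacc,
    fun x v hv hacc => hc.isStable h hQ hv hacc⟩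
  · intro x hx u hu s hs hu0 hs0
    have huf := hsplit.u_le hx hu
    have hsf := hsplit.s_le hx hs
    obtain ⟨n, hn, hn0⟩ := ((hc.eventually_growth huf
      (fun hus => hu0 (hsplit.eq_zero hx hu hus)) hs).and (eventually_gt_atTop 0)).exists
    have pu := norm_pos_iff.2 hu0
    have ps := norm_pos_iff.2 hs0
    have pAu := norm_pos_iff.2 (map_ne_zero n huf hu0)
    -- The growth estimate compares with time `n`; enough doublings absorb the bounded change of
    -- ratio between times 0 and `n`.
    obtain ⟨k, hk⟩ := pow_unbounded_of_one_lt
      (‖C.map n x s‖ * ‖u‖ / (‖C.map n x u‖ * ‖s‖)) (one_lt_two (α := ℝ))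
    rw [div_lt_iff₀ (by positivity)] at hk
    have hN := hc.pos
    refine ⟨k * N + n, by positivity, ?_⟩
    have pAu' := norm_pos_iff.2 (map_ne_zero (k * N + n) huf hu0)
    have hpos : (0 : ℝ) < 2 ^ k * ‖C.map n x u‖ := by positivity
    refine lt_of_mul_lt_mul_left ?_ hpos.le
    calc 2 ^ k * ‖C.map n x u‖ * (‖C.map (k * N + n) x s‖ * ‖u‖)
        = (2 ^ k * (‖C.map (k * N + n) x s‖ * ‖C.map n x u‖)) * ‖u‖ := by ring
      _ ≤ (‖C.map (k * N + n) x u‖ * ‖C.map n x s‖) * ‖u‖ :=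
          mul_le_mul_of_nonneg_right (hn k) pu.le
      _ = ‖C.map (k * N + n) x u‖ * (‖C.map n x s‖ * ‖u‖) := by ring
      _ < ‖C.map (k * N + n) x u‖ * (2 ^ k * (‖C.map n x u‖ * ‖s‖)) := by gcongr
      _ = _ := by ring
  · have h1 := finrank_add_finrank_eq (hsplit.disjoint x (mem_univ x)) (hsplit.sup_eq x (mem_univ x))
    rw [hD] at h1
    have h2 := hdim_u x
    have h3 := hdD x
    -- the reverse inequality comes from the bound on the dimension of the stable subspace
    obtain ⟨Ou, hOu, hZOu, hSu⟩ := mem_nhdsSet_iff_exists.1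
      (hsp.reverse.eventually_exists_subspace hQ.reverse hd)
    have h4 := hc.finrank_stable_add_le (r := d) (x := x)
      ((eventually_flow_mem hOu hZOu hw x).mono fun n hn => by
        obtain ⟨S, hS, hSr, hcone⟩ := hSu hn
        refine ⟨S, by simpa using hS, hSr, fun v hv hv0 => ?_⟩
        have := hcone v hv hv0
        have hv' : C.map 0 (C.flow n x) v = v := mem_fiber.1 (by simpa using hS hv)
        rw [_root_.sub_apply, hv', sub_sub_cancel] at this
        exact this.le).frequently
    rw [hD] at h4
    lia

end Extension

end LinearCocycle

/-! ### Embedding a vector bundle over a compact set into a trivial one -/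

section Embedding

variable {B E : Type*} [TopologicalSpace B] [NormedAddCommGroup E] [NormedSpace ℝ E]
  {V : B → Type*} [TopologicalSpace (TotalSpace E V)] [∀ x, TopologicalSpace (V x)]
  [∀ x, AddCommGroup (V x)] [∀ x, Module ℝ (V x)] [FiberBundle E V] [VectorBundle ℝ E V]

lemma continuousAt_trivialization_snd (x₀ : B) {p : TotalSpace E V}
    (hp : p.1 ∈ (trivializationAt E V x₀).baseSet) :
    ContinuousAt (fun q : TotalSpace E V => (trivializationAt E V x₀).linearMapAt ℝ q.1 q.2) p := by
  set e := trivializationAt E V x₀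
  have hs : p ∈ e.source := e.mem_source.2 hp
  have h1 : ContinuousAt (fun q => (e q).2) p :=
    continuous_snd.continuousAt.comp (e.continuousOn.continuousAt (e.open_source.mem_nhds hs))
  refine h1.congr ?_
  filter_upwards [e.open_source.mem_nhds hs] with q hq
  rw [e.coe_linearMapAt_of_mem (e.mem_source.1 hq)]

lemma continuousAt_trivialization_symm (x₀ : B) {p : B × E}
    (hp : p.1 ∈ (trivializationAt E V x₀).baseSet) :
    ContinuousAt (fun q : B × E =>
      (⟨q.1, (trivializationAt E V x₀).symmₗ ℝ q.1 q.2⟩ : TotalSpace E V)) p := by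
  set e := trivializationAt E V x₀
  have hs : p ∈ e.target := e.mem_target.2 hp
  have h1 : ContinuousAt e.toOpenPartialHomeomorph.symm p :=
    e.toOpenPartialHomeomorph.continuousAt_symm hs
  refine h1.congr ?_
  filter_upwards [e.open_target.mem_nhds hs] with q hq
  have hq' := e.mem_target.1 hq
  change _ = (⟨q.1, e.symmₗ ℝ q.1 q.2⟩ : TotalSpace E V)
  rw [e.symmₗ_apply hq', e.mk_symm hq']

/-- Over a compact set, a vector bundle embeds into a trivial bundle, and the embedding has a
continuous left inverse. -/
lemma exists_embedding_trivial_bundle [T2Space B] [NormalSpace B] {K : Set B} (hK : IsCompact K) :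
    ∃ (t : Finset B) (Φ : ∀ x, V x →ₗ[ℝ] (t → E)) (Ψ : ∀ x, (t → E) →ₗ[ℝ] V x),
      (Continuous fun p : TotalSpace E V => Φ p.1 p.2) ∧
      (Continuous fun p : B × (t → E) => (⟨p.1, Ψ p.1 p.2⟩ : TotalSpace E V)) ∧
      ∀ x ∈ K, ∀ v, Ψ x (Φ x v) = v := by
  obtain ⟨t, -, ht⟩ := hK.elim_nhds_subcover (fun x => (trivializationAt E V x).baseSet)
    fun x _ => (trivializationAt E V x).open_baseSet.mem_nhds (mem_baseSet_trivializationAt E V x)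
  obtain ⟨ρ, hρ⟩ := PartitionOfUnity.exists_isSubordinate_of_locallyFinite hK.isClosed
    (fun i : t => (trivializationAt E V (i : B)).baseSet)
    (fun i => (trivializationAt E V (i : B)).open_baseSet) (locallyFinite_of_finite _)
    (by simpa [iUnion_subtype] using ht)
  let e : t → Trivialization E (π E V) := fun i => trivializationAt E V (i : B)
  have hzero : ∀ (i : t) (x : B), x ∉ tsupport (ρ i) → ∀ᶠ y in 𝓝 x, √(ρ i y) = 0 := by
    intro i x hx
    filter_upwards [(isClosed_tsupport _).isOpen_compl.mem_nhds hx] with y hy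
    rw [image_eq_zero_of_notMem_tsupport hy, Real.sqrt_zero]
  have hsqrt : ∀ i : t, Continuous fun x => √(ρ i x) := fun i => (ρ i).continuous.sqrt
  -- Local trivializations are weighted by square roots of a partition of unity on both sides, so
  -- that in $\Psi\Phi$ the weights multiply to the partition itself and sum to 1 over `K`.
  let Φ : ∀ x, V x →ₗ[ℝ] (t → E) := fun x =>
    LinearMap.pi fun i => √(ρ i x) • (trivializationAt E V (i : B)).linearMapAt ℝ x
  let Ψ : ∀ x, (t → E) →ₗ[ℝ] V x := fun x =>
    ∑ i : t, √(ρ i x) • ((trivializationAt E V (i : B)).symmₗ ℝ x).comp (LinearMap.proj i)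
  refine ⟨t, Φ, Ψ, ?_, ?_, ?_⟩
  · refine continuous_pi fun i => continuous_iff_continuousAt.2 fun p => ?_
    have hproj : ContinuousAt (fun q : TotalSpace E V => √(ρ i q.1)) p :=
      ((hsqrt i).comp (FiberBundle.continuous_proj E V)).continuousAt
    by_cases hp : p.1 ∈ tsupport (ρ i)
    · exact hproj.smul (continuousAt_trivialization_snd (i : B) (hρ i hp))
    · have : ∀ᶠ q : TotalSpace E V in 𝓝 p, √(ρ i q.1) = 0 :=
        (FiberBundle.continuous_proj E V).continuousAt.eventually (hzero i p.1 hp)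
      refine (continuousAt_const (y := (0 : E))).congr ?_
      filter_upwards [this] with q hq
      simp [Φ, hq]
  · refine continuous_iff_continuousAt.2 fun p => ?_
    rw [FiberBundle.continuousAt_totalSpace]
    refine ⟨continuous_fst.continuousAt, ?_⟩
    have hmem := mem_baseSet_trivializationAt E V p.1
    have hsum : ContinuousAt (fun q : B × (t → E) => ∑ i : t, √(ρ i q.1) •
        (trivializationAt E V p.1).linearMapAt ℝ q.1
          ((trivializationAt E V (i : B)).symmₗ ℝ q.1 (q.2 i))) p := by
      refine tendsto_finsetSum _ fun i _ => ?_
      by_cases hp : p.1 ∈ tsupport (ρ i)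
      · have h1 : ContinuousAt (fun q : B × (t → E) => (⟨q.1,
            (trivializationAt E V (i : B)).symmₗ ℝ q.1 (q.2 i)⟩ : TotalSpace E V)) p := by
          have h2 : ContinuousAt (fun q : B × (t → E) => (q.1, q.2 i)) p := by fun_prop
          exact ContinuousAt.comp (f := fun q : B × (t → E) => (q.1, q.2 i))
            (continuousAt_trivialization_symm (i : B) (p := (p.1, p.2 i)) (hρ i hp)) h2
        have h3 := ContinuousAt.comp (x := p) (f := fun q : B × (t → E) => (⟨q.1,
            (trivializationAt E V (i : B)).symmₗ ℝ q.1 (q.2 i)⟩ : TotalSpace E V))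
            (continuousAt_trivialization_snd p.1 hmem) h1
        exact ((hsqrt i).comp continuous_fst).continuousAt.smul h3
      · have : ∀ᶠ q : B × (t → E) in 𝓝 p, √(ρ i q.1) = 0 :=
          continuous_fst.continuousAt.eventually (hzero i p.1 hp)
        refine (continuousAt_const (y := (0 : E))).congr ?_ |>.tendsto.trans ?_
        · filter_upwards [this] with q hq
          simp [hq]
        · rw [(hzero i p.1 hp).self_of_nhds, zero_smul]
    refine hsum.congr ?_
    filter_upwards [continuous_fst.continuousAt.preimage_mem_nhds
      ((trivializationAt E V p.1).open_baseSet.mem_nhds hmem)] with q hq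
    have := congrFun ((trivializationAt E V p.1).coe_linearMapAt_of_mem (R := ℝ) hq) (Ψ q.1 q.2)
    rw [← this]
    simp [Ψ]
  · intro x hx v
    have h1 : ∀ i : t, √(ρ i x) • (trivializationAt E V (i : B)).symmₗ ℝ x (Φ x v i) =
        ρ i x • v := by
      intro i
      by_cases hi : x ∈ tsupport (ρ i)
      · simp only [Φ, LinearMap.pi_apply, LinearMap.smul_apply, map_smul, smul_smul,
          Real.mul_self_sqrt (ρ.nonneg i x)]
        rw [(trivializationAt E V (i : B)).symmₗ_linearMapAt (hρ i hi)]
      · rw [image_eq_zero_of_notMem_tsupport hi]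
        simp
    calc Ψ x (Φ x v) = ∑ i : t, √(ρ i x) • (trivializationAt E V (i : B)).symmₗ ℝ x (Φ x v i) := by
          simp [Ψ]
      _ = ∑ i : t, ρ i x • v := Finset.sum_congr rfl fun i _ => h1 i
      _ = v := by
          rw [← Finset.sum_smul, ← finsum_eq_sum_of_fintype, ρ.sum_eq_one hx, one_smul]

end Embedding

/-! ### Integer iterates of the diffeomorphism -/

section Iterates

variable {E : Type*} [NormedAddCommGroup E] [NormedSpace ℝ E]
  {M : Type*} [MetricSpace M] [ChartedSpace E M]

instance [FiniteDimensional ℝ E] (x : M) : FiniteDimensional ℝ (TangentSpace 𝓘(ℝ, E) x) :=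
  inferInstanceAs (FiniteDimensional ℝ E)

lemma finrank_tangentSpace (x : M) :
    Module.finrank ℝ (TangentSpace 𝓘(ℝ, E) x) = Module.finrank ℝ E := rfl

/-- The integer iterates of a diffeomorphism. -/
def zIterate (f : M ≃ₘ^1⟮𝓘(ℝ, E), 𝓘(ℝ, E)⟯ M) (k : ℤ) : M → M :=
  ⇑((f.toEquiv : Equiv.Perm M) ^ k)

variable (f : M ≃ₘ^1⟮𝓘(ℝ, E), 𝓘(ℝ, E)⟯ M)

lemma zIterate_natCast (n : ℕ) : zIterate f n = f^[n] := by
  rw [zIterate, zpow_natCast, ← Equiv.Perm.iterate_eq_pow]; rfl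

lemma zIterate_neg_natCast (n : ℕ) : zIterate f (-n) = f.symm^[n] := by
  rw [zIterate, zpow_neg, zpow_natCast, ← inv_pow, ← Equiv.Perm.iterate_eq_pow]; rfl

lemma zIterate_zero : zIterate f 0 = id := by
  rw [zIterate, zpow_zero]; rfl

lemma zIterate_one : zIterate f 1 = f := by
  rw [zIterate, zpow_one]; rfl

lemma zIterate_add (m n : ℤ) : zIterate f (m + n) = zIterate f m ∘ zIterate f n := by
  rw [zIterate, zpow_add]; rfl

lemma contMDiff_zIterate (k : ℤ) : ContMDiff 𝓘(ℝ, E) 𝓘(ℝ, E) 1 (zIterate f k) := by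
  obtain ⟨n, rfl | rfl⟩ := k.eq_nat_or_neg
  · rw [zIterate_natCast]; exact f.contMDiff.iterate n
  · rw [zIterate_neg_natCast]; exact f.symm.contMDiff.iterate n

lemma mdifferentiable_zIterate (k : ℤ) : MDifferentiable 𝓘(ℝ, E) 𝓘(ℝ, E) (zIterate f k) :=
  (contMDiff_zIterate f k).mdifferentiable one_ne_zero

lemma tangentMap_zIterate_add (m n : ℤ) (p : TangentBundle 𝓘(ℝ, E) M) :
    tangentMap 𝓘(ℝ, E) 𝓘(ℝ, E) (zIterate f (m + n)) p =
      tangentMap 𝓘(ℝ, E) 𝓘(ℝ, E) (zIterate f m) (tangentMap 𝓘(ℝ, E) 𝓘(ℝ, E) (zIterate f n) p) := by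
  rw [zIterate_add, tangentMap_comp (mdifferentiable_zIterate f m) (mdifferentiable_zIterate f n)]
  rfl

lemma tangentMap_zIterate_zero (p : TangentBundle 𝓘(ℝ, E) M) :
    tangentMap 𝓘(ℝ, E) 𝓘(ℝ, E) (zIterate f 0) p = p := by
  rw [zIterate_zero, tangentMap_id]; rfl

lemma continuous_tangentMap_zIterate [IsManifold 𝓘(ℝ, E) 1 M] (k : ℤ) :
    Continuous (tangentMap 𝓘(ℝ, E) 𝓘(ℝ, E) (zIterate f k)) :=
  (contMDiff_zIterate f k).continuous_tangentMap le_rfl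

lemma mfderiv_zIterate_ne_zero (k : ℤ) {x : M} {v : TangentSpace 𝓘(ℝ, E) x} (hv : v ≠ 0) :
    mfderiv 𝓘(ℝ, E) 𝓘(ℝ, E) (zIterate f k) x v ≠ 0 := by
  intro h0
  have h1 := tangentMap_zIterate_add f (-k) k ⟨x, v⟩
  rw [neg_add_cancel, tangentMap_zIterate_zero] at h1
  have h2 : tangentMap 𝓘(ℝ, E) 𝓘(ℝ, E) (zIterate f k) ⟨x, v⟩ = ⟨zIterate f k x, 0⟩ := by
    rw [← h0]; rfl
  rw [h2] at h1
  have h3 : tangentMap 𝓘(ℝ, E) 𝓘(ℝ, E) (zIterate f (-k)) ⟨zIterate f k x, 0⟩ =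
      ⟨zIterate f (-k) (zIterate f k x), 0⟩ := by
    simp [tangentMap]
  rw [h3] at h1
  have hx : zIterate f (-k) (zIterate f k x) = x := by
    have := congrFun (zIterate_add f (-k) k) x
    rw [neg_add_cancel, zIterate_zero] at this
    exact this.symm
  rw [hx] at h1
  exact hv (TotalSpace.mk_inj.1 h1)

lemma zIterate_mem {f : M ≃ₘ^1⟮𝓘(ℝ, E), 𝓘(ℝ, E)⟯ M} {Z : Set M} (hZ : f '' Z = Z) {x : M}
    (hx : x ∈ Z) (k : ℤ) :
    zIterate f k x ∈ Z := by
  have hfw : ∀ x ∈ Z, f x ∈ Z := fun x hx => hZ ▸ mem_image_of_mem f hx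
  have hbw : ∀ x ∈ Z, f.symm x ∈ Z := by
    intro x hx
    rw [← hZ] at hx
    obtain ⟨y, hy, rfl⟩ := hx
    have : f.symm (f y) = y := f.toEquiv.symm_apply_apply y
    rwa [this]
  obtain ⟨n, rfl | rfl⟩ := k.eq_nat_or_neg
  · rw [zIterate_natCast]
    exact (show MapsTo f Z Z from hfw).iterate n hx
  · rw [zIterate_neg_natCast]
    exact (show MapsTo f.symm Z Z from hbw).iterate n hx

lemma mapsTo_symm_of_image_eq {f : M ≃ₘ^1⟮𝓘(ℝ, E), 𝓘(ℝ, E)⟯ M} {Y : Set M}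
    (hY : f '' Y = Y) : MapsTo f.symm Y Y := fun y hy => by
  have := zIterate_mem hY hy (-(1 : ℕ))
  rwa [zIterate_neg_natCast, Function.iterate_one] at this

end Iterates

/-! ### The tangent cocycle in an embedding -/

section Embedding

variable (E : Type*) [NormedAddCommGroup E] [NormedSpace ℝ E]
  {M : Type*} [MetricSpace M] [ChartedSpace E M] [IsManifold 𝓘(ℝ, E) 1 M]

/-- A continuous family of linear maps from the tangent spaces to a fixed space, with a continuous
family of left inverses over the set `K`. -/
structure TangentEmbedding (K : Set M) (F : Type*) [NormedAddCommGroup F] [NormedSpace ℝ F] where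
  toFun : ∀ x : M, TangentSpace 𝓘(ℝ, E) x →ₗ[ℝ] F
  inv : ∀ x : M, F →ₗ[ℝ] TangentSpace 𝓘(ℝ, E) x
  continuous_toFun : Continuous fun p : TangentBundle 𝓘(ℝ, E) M => toFun p.1 p.2
  continuous_inv : Continuous fun p : M × F => (⟨p.1, inv p.1 p.2⟩ : TangentBundle 𝓘(ℝ, E) M)
  inv_toFun : ∀ x ∈ K, ∀ v, inv x (toFun x v) = v

lemma exists_tangentEmbedding {K : Set M} (hK : IsCompact K) :
    ∃ t : Finset M, Nonempty (TangentEmbedding E K (t → E)) := by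
  obtain ⟨t, Φ, Ψ, h1, h2, h3⟩ := exists_embedding_trivial_bundle (E := E)
    (V := fun x : M => TangentSpace 𝓘(ℝ, E) x) hK
  exact ⟨t, ⟨Φ, Ψ, h1, h2, h3⟩⟩

variable {E} {K : Set M} {F : Type*} [NormedAddCommGroup F] [NormedSpace ℝ F]

namespace TangentEmbedding

variable (e : TangentEmbedding E K F)

lemma injective {x : M} (hx : x ∈ K) : Function.Injective (e.toFun x) :=
  Function.LeftInverse.injective (e.inv_toFun x hx)

variable [FiniteDimensional ℝ F]

/-- The cocycle over an invariant set `K` read through an embedding of the tangent bundle. -/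
noncomputable def cocycle (f : M ≃ₘ^1⟮𝓘(ℝ, E), 𝓘(ℝ, E)⟯ M) (hK : f '' K = K) :
    LinearCocycle K F where
  flow k x := ⟨zIterate f k x, zIterate_mem hK x.2 k⟩
  map k x := LinearMap.toContinuousLinearMap ((e.toFun (zIterate f k x)).comp
    ((mfderiv 𝓘(ℝ, E) 𝓘(ℝ, E) (zIterate f k) (x : M)).toLinearMap.comp (e.inv x)))
  flow_zero x := by simp [zIterate_zero]
  flow_add m n x := by simp [zIterate_add]
  map_add m n x v := by
    let Φ : TangentBundle 𝓘(ℝ, E) M → F := fun p => e.toFun p.1 p.2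
    have hΦ : ∀ p : TangentBundle 𝓘(ℝ, E) M, p.1 ∈ K → (⟨p.1, e.inv p.1 (Φ p)⟩ :
        TangentBundle 𝓘(ℝ, E) M) = p := fun p hp => by
      simp only [Φ, e.inv_toFun p.1 hp]
    change Φ (tangentMap 𝓘(ℝ, E) 𝓘(ℝ, E) (zIterate f (m + n)) ⟨x, e.inv x v⟩) =
      Φ (tangentMap 𝓘(ℝ, E) 𝓘(ℝ, E) (zIterate f m) ⟨zIterate f n x, e.inv (zIterate f n x)
        (Φ (tangentMap 𝓘(ℝ, E) 𝓘(ℝ, E) (zIterate f n) ⟨x, e.inv x v⟩))⟩)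
    have := hΦ (tangentMap 𝓘(ℝ, E) 𝓘(ℝ, E) (zIterate f n) ⟨x, e.inv x v⟩)
      (zIterate_mem hK x.2 n)
    rw [tangentMap_zIterate_add]
    exact congrArg (fun p => Φ (tangentMap 𝓘(ℝ, E) 𝓘(ℝ, E) (zIterate f m) p)) this.symm
  continuous_flow k := ((contMDiff_zIterate f k).continuous.comp continuous_subtype_val).subtype_mk _
  continuous_map k := by
    refine continuous_clm_apply.2 fun w => ?_
    exact e.continuous_toFun.comp ((continuous_tangentMap_zIterate f k).comp
      (e.continuous_inv.comp (continuous_subtype_val.prodMk continuous_const)))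

variable {e} {f : M ≃ₘ^1⟮𝓘(ℝ, E), 𝓘(ℝ, E)⟯ M} {hK : f '' K = K}

lemma cocycle_map (k : ℤ) (x : K) (v : TangentSpace 𝓘(ℝ, E) (x : M)) :
    (e.cocycle f hK).map k x (e.toFun x v) =
      e.toFun (zIterate f k x) (mfderiv 𝓘(ℝ, E) 𝓘(ℝ, E) (zIterate f k) (x : M) v) := by
  change e.toFun (zIterate f k x) (mfderiv 𝓘(ℝ, E) 𝓘(ℝ, E) (zIterate f k) (x : M)
    (e.inv x (e.toFun x v))) = _
  rw [e.inv_toFun x x.2]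

lemma cocycle_map_zero (x : K) (w : F) :
    (e.cocycle f hK).map 0 x w = e.toFun x (e.inv x w) := by
  have := congrArg (fun p : TangentBundle 𝓘(ℝ, E) M => e.toFun p.1 p.2)
    (tangentMap_zIterate_zero f ⟨x, e.inv x w⟩)
  exact this

lemma cocycle_fiber (x : K) : (e.cocycle f hK).fiber x = LinearMap.range (e.toFun x) := by
  ext w
  constructor
  · rintro ⟨w, rfl⟩
    exact ⟨e.inv x w, (cocycle_map_zero x w).symm⟩
  · rintro ⟨v, rfl⟩
    rw [LinearCocycle.mem_fiber, cocycle_map_zero, e.inv_toFun x x.2]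

lemma finrank_cocycle_fiber (x : K) :
    Module.finrank ℝ ((e.cocycle f hK).fiber x) = Module.finrank ℝ E := by
  rw [cocycle_fiber, LinearMap.finrank_range_of_inj (e.injective x.2), finrank_tangentSpace]

end TangentEmbedding

end Embedding

/-! ### Continuous subbundles and closed graphs -/

/-- An injective limit operator is bounded below, and so are operators close to it; hence preimages
of `w i` are bounded, their images under `L₀` also converge to `w₀`, and the range of `L₀` is
closed. -/
lemma mem_range_of_tendsto {ι V W : Type*} [NormedAddCommGroup V] [NormedSpace ℝ V]
    [FiniteDimensional ℝ V] [NormedAddCommGroup W] [NormedSpace ℝ W] {l : Filter ι} [l.NeBot]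
    {L : ι → V →L[ℝ] W} {L₀ : V →L[ℝ] W} (hL : Tendsto L l (𝓝 L₀))
    (hinj : Function.Injective L₀) {w : ι → W} {w₀ : W} (hw : Tendsto w l (𝓝 w₀))
    (hmem : ∀ᶠ i in l, w i ∈ range (L i)) : w₀ ∈ range L₀ := by
  obtain ⟨K, hK0, hK⟩ := L₀.toLinearMap.exists_antilipschitzWith (LinearMap.ker_eq_bot.2 hinj)
  have hK' : ∀ v, ‖v‖ ≤ K * ‖L₀ v‖ := fun v => hK.le_mul_norm (map_zero L₀) v
  have hK0' : (0 : ℝ) < K := by exact_mod_cast hK0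
  have hsmall : ∀ᶠ i in l, ‖L i - L₀‖ < (2 * K : ℝ)⁻¹ := by
    have : Tendsto (fun i => ‖L i - L₀‖) l (𝓝 0) := tendsto_iff_norm_sub_tendsto_zero.1 hL
    exact this.eventually (gt_mem_nhds (by positivity))
  have hlim : Tendsto (fun i => ‖L i - L₀‖ * (2 * K * ‖w i‖) + ‖w i - w₀‖) l (𝓝 0) := by
    have h1 := (tendsto_iff_norm_sub_tendsto_zero.1 hL).mul (hw.norm.const_mul (2 * K : ℝ))
    have h2 := tendsto_iff_norm_sub_tendsto_zero.1 hw
    simpa using h1.add h2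
  have hcl : IsClosed (range L₀) := by
    have := (LinearMap.range L₀.toLinearMap).closed_of_finiteDimensional
    exact this
  rw [← hcl.closure_eq, Metric.mem_closure_iff]
  intro ε hε
  obtain ⟨i, ⟨v, hv⟩, hi, hiε⟩ := (hmem.and (hsmall.and (hlim.eventually (gt_mem_nhds hε)))).exists
  refine ⟨L₀ v, ⟨v, rfl⟩, ?_⟩
  have e1 : ‖(L i - L₀) v‖ ≤ ‖L i - L₀‖ * ‖v‖ := (L i - L₀).le_opNorm v
  have e2 : ‖L₀ v‖ ≤ ‖w i‖ + ‖(L i - L₀) v‖ := by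
    have : L₀ v = w i - (L i - L₀) v := by rw [_root_.sub_apply, hv, sub_sub_cancel]
    rw [this]
    exact norm_sub_le _ _
  have e3 : ‖v‖ ≤ 2 * K * ‖w i‖ := by
    have h1 := hK' v
    have h2 : ‖L i - L₀‖ * ‖v‖ ≤ (2 * K : ℝ)⁻¹ * ‖v‖ := by gcongr
    have h3 : K * ((2 * K : ℝ)⁻¹ * ‖v‖) = ‖v‖ / 2 := by field_simp
    have h4 : ‖v‖ ≤ K * (‖w i‖ + (2 * K : ℝ)⁻¹ * ‖v‖) := by
      refine h1.trans ?_
      gcongr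
      linarith
    linarith
  have e4 : w₀ - L₀ v = (L i - L₀) v - (w i - w₀) := by
    rw [_root_.sub_apply, hv]; abel
  calc dist w₀ (L₀ v) = ‖(L i - L₀) v - (w i - w₀)‖ := by rw [dist_eq_norm, e4]
    _ ≤ ‖(L i - L₀) v‖ + ‖w i - w₀‖ := norm_sub_le _ _
    _ ≤ ‖L i - L₀‖ * (2 * K * ‖w i‖) + ‖w i - w₀‖ := by
        gcongr
        refine e1.trans ?_
        gcongr
    _ < ε := hiε

section Subbundle

variable {E : Type*} [NormedAddCommGroup E] [NormedSpace ℝ E]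
  {M : Type*} [MetricSpace M] [ChartedSpace E M]

/-- The set of vectors over `Z` which belong to a family of subspaces. -/
def subbundleGraph (Z : Set M) (B : ∀ x : M, Submodule ℝ (TangentSpace 𝓘(ℝ, E) x)) :
    Set (TangentBundle 𝓘(ℝ, E) M) :=
  {w | w.1 ∈ Z ∧ w.2 ∈ B w.1}

lemma subbundleGraph_union (Y Z : Set M) (B : ∀ x : M, Submodule ℝ (TangentSpace 𝓘(ℝ, E) x)) :
    subbundleGraph (Y ∪ Z) B = subbundleGraph Y B ∪ subbundleGraph Z B := by
  ext w
  simp only [subbundleGraph, mem_union, mem_ofPred_eq, or_and_right]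

variable [IsManifold 𝓘(ℝ, E) 1 M]

lemma IsContinuousSubbundleOn.mono {Z Z' : Set M}
    {B : ∀ x : M, Submodule ℝ (TangentSpace 𝓘(ℝ, E) x)} (h : IsContinuousSubbundleOn Z B)
    (hZ : Z' ⊆ Z) : IsContinuousSubbundleOn Z' B := by
  intro x₀ hx₀
  obtain ⟨U, hU, hxU, k, s, hs, hB⟩ := h x₀ (hZ hx₀)
  exact ⟨U, hU, hxU, k, s, fun i => (hs i).mono (inter_subset_inter_right U hZ),
    fun x hx => hB x ⟨hx.1, hZ hx.2⟩⟩

/-- The graph of a continuous subbundle over `Z` is closed relatively to `Z`. -/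
lemma IsContinuousSubbundleOn.mem_of_mem_closure {Z : Set M}
    {B : ∀ x : M, Submodule ℝ (TangentSpace 𝓘(ℝ, E) x)} (h : IsContinuousSubbundleOn Z B)
    {w : TangentBundle 𝓘(ℝ, E) M} (hw : w ∈ closure (subbundleGraph Z B)) (hwZ : w.1 ∈ Z) :
    w.2 ∈ B w.1 := by
  obtain ⟨U, hU, hxU, k, s, hs, hB⟩ := h w.1 hwZ
  let T := trivializationAt E (fun x : M => TangentSpace 𝓘(ℝ, E) x) w.1
  have hbase : w.1 ∈ T.baseSet := mem_baseSet_trivializationAt E _ w.1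
  have : (𝓝[subbundleGraph Z B] w).NeBot := mem_closure_iff_nhdsWithin_neBot.1 hw
  let L : M → (Fin k → ℝ) →L[ℝ] E := fun x =>
    ∑ i, (ContinuousLinearMap.proj i : (Fin k → ℝ) →L[ℝ] ℝ).smulRight
      (T.linearMapAt ℝ x (s i x))
  have hLapp : ∀ x c, L x c = T.linearMapAt ℝ x (∑ i, c i • s i x) := by
    intro x c
    simp [L, map_sum]
  have hproj : Tendsto (fun p : TangentBundle 𝓘(ℝ, E) M => p.1) (𝓝[subbundleGraph Z B] w)
      (𝓝[U ∩ Z] w.1) := by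
    refine tendsto_nhdsWithin_iff.2 ⟨?_, ?_⟩
    · exact ((FiberBundle.continuous_proj E _).tendsto w).mono_left nhdsWithin_le_nhds
    · have h1 : ∀ᶠ p : TangentBundle 𝓘(ℝ, E) M in 𝓝[subbundleGraph Z B] w, p.1 ∈ U :=
        (((FiberBundle.continuous_proj E _).tendsto w).mono_left nhdsWithin_le_nhds).eventually
          (hU.mem_nhds hxU)
      filter_upwards [h1, self_mem_nhdsWithin] with p hp1 hp2 using ⟨hp1, hp2.1⟩
  have hsL : ∀ i, Tendsto (fun x => T.linearMapAt ℝ x (s i x)) (𝓝[U ∩ Z] w.1)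
      (𝓝 (T.linearMapAt ℝ w.1 (s i w.1))) := by
    intro i
    have h1 := hs i w.1 ⟨hxU, hwZ⟩
    exact ContinuousAt.comp_continuousWithinAt
      (f := fun x => (⟨x, s i x⟩ : TangentBundle 𝓘(ℝ, E) M))
      (continuousAt_trivialization_snd w.1 hbase) h1
  have hL : Tendsto (fun p : TangentBundle 𝓘(ℝ, E) M => L p.1) (𝓝[subbundleGraph Z B] w)
      (𝓝 (L w.1)) := by
    refine tendsto_finsetSum _ fun i _ => ?_
    exact ((ContinuousLinearMap.smulRightL ℝ (Fin k → ℝ) E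
      (ContinuousLinearMap.proj i)).continuous.tendsto _).comp ((hsL i).comp hproj)
  have hTinj : Function.Injective (T.linearMapAt ℝ w.1) :=
    Function.LeftInverse.injective (T.symmₗ_linearMapAt hbase)
  have hinj : Function.Injective (L w.1) := by
    intro c c' hc
    rw [hLapp, hLapp] at hc
    have h1 := hTinj hc
    have h2 := Fintype.linearIndependent_iff.1 (hB w.1 ⟨hxU, hwZ⟩).1 (c - c') (by
      simp only [Pi.sub_apply, sub_smul, Finset.sum_sub_distrib]
      exact sub_eq_zero.2 h1)
    funext i
    exact sub_eq_zero.1 (h2 i)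
  have hv : Tendsto (fun p : TangentBundle 𝓘(ℝ, E) M => T.linearMapAt ℝ p.1 p.2)
      (𝓝[subbundleGraph Z B] w) (𝓝 (T.linearMapAt ℝ w.1 w.2)) :=
    (continuousAt_trivialization_snd w.1 hbase).tendsto.mono_left nhdsWithin_le_nhds
  obtain ⟨c, hc⟩ := mem_range_of_tendsto hL hinj hv (by
    have h1 := hproj.eventually (self_mem_nhdsWithin (a := w.1) (s := U ∩ Z))
    filter_upwards [h1, self_mem_nhdsWithin] with p hp hpB
    have h2 : p.2 ∈ Submodule.span ℝ (range fun i => s i p.1) := by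
      rw [(hB p.1 hp).2]; exact hpB.2
    obtain ⟨c, hc⟩ := (Submodule.mem_span_range_iff_exists_fun ℝ).1 h2
    exact ⟨c, by rw [hLapp, hc]⟩)
  rw [hLapp] at hc
  rw [← (hB w.1 ⟨hxU, hwZ⟩).2, ← hTinj hc]
  exact (Submodule.mem_span_range_iff_exists_fun ℝ).2 ⟨c, rfl⟩

lemma IsContinuousSubbundleOn.isClosed_subbundleGraph {Z : Set M} (hZ : IsClosed Z)
    {B : ∀ x : M, Submodule ℝ (TangentSpace 𝓘(ℝ, E) x)} (h : IsContinuousSubbundleOn Z B) :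
    IsClosed (subbundleGraph Z B) := by
  refine isClosed_of_closure_subset fun w hw => ?_
  have hwZ : w.1 ∈ Z := by
    have hcl : IsClosed {p : TangentBundle 𝓘(ℝ, E) M | p.1 ∈ Z} :=
      hZ.preimage (FiberBundle.continuous_proj E _)
    exact closure_minimal (fun p hp => hp.1) hcl hw
  exact ⟨hwZ, h.mem_of_mem_closure hw hwZ⟩

variable {K : Set M} {F : Type*} [NormedAddCommGroup F] [NormedSpace ℝ F]

namespace TangentEmbedding

/-- A family of subspaces of the tangent spaces read through an embedding. -/
noncomputable def push (e : TangentEmbedding E K F) (B : ∀ x : M, Submodule ℝ (TangentSpace 𝓘(ℝ, E) x)) (x : K) :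
    Submodule ℝ F := (B x).map (e.toFun x)

variable {e : TangentEmbedding E K F} {B : ∀ x : M, Submodule ℝ (TangentSpace 𝓘(ℝ, E) x)}

lemma toFun_mem_push {x : K} {v : TangentSpace 𝓘(ℝ, E) (x : M)} :
    e.toFun x v ∈ e.push B x ↔ v ∈ B x :=
  (e.injective x.2).mem_set_image (s := (B x : Set (TangentSpace 𝓘(ℝ, E) (x : M))))

lemma finrank_push (x : K) :
    Module.finrank ℝ (e.push B x) = Module.finrank ℝ (B x) :=
  (LinearEquiv.finrank_eq (Submodule.equivMapOfInjective (e.toFun x) (e.injective x.2) (B x))).symm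

lemma isClosed_push {Z : Set M} (h : IsClosed (subbundleGraph Z B)) :
    IsClosed {p : K × F | (p.1 : M) ∈ Z ∧ p.2 ∈ e.push B p.1} := by
  have h1 : IsClosed {p : K × F | e.toFun p.1 (e.inv p.1 p.2) = p.2} := by
    refine isClosed_eq ?_ continuous_snd
    exact e.continuous_toFun.comp (e.continuous_inv.comp
      ((continuous_subtype_val.comp continuous_fst).prodMk continuous_snd))
  have h2 : IsClosed {p : K × F | (⟨(p.1 : M), e.inv p.1 p.2⟩ : TangentBundle 𝓘(ℝ, E) M) ∈
      subbundleGraph Z B} :=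
    h.preimage (e.continuous_inv.comp
      ((continuous_subtype_val.comp continuous_fst).prodMk continuous_snd))
  convert h1.inter h2 using 1
  ext ⟨x, w⟩
  constructor
  · rintro ⟨hx, v, hv, hvw⟩
    change e.toFun x v = w at hvw
    have hinv : e.inv x w = v := by rw [← hvw]; exact e.inv_toFun x x.2 v
    refine ⟨?_, hx, ?_⟩
    · change e.toFun x (e.inv x w) = _
      rw [hinv, hvw]
    · change e.inv x w ∈ B x
      rw [hinv]
      exact hv
  · rintro ⟨h1, hx, h2⟩
    exact ⟨hx, e.inv x w, h2, h1⟩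

/-- The trivial cocycle over `K` associated with an embedding. -/
noncomputable def idCocycle [FiniteDimensional ℝ F] (e : TangentEmbedding E K F) :
    LinearCocycle K F where
  flow _ x := x
  map _ x := LinearMap.toContinuousLinearMap ((e.toFun x).comp (e.inv x))
  flow_zero _ := rfl
  flow_add _ _ _ := rfl
  map_add _ _ x v := by simp [e.inv_toFun x x.2]
  continuous_flow _ := continuous_id
  continuous_map _ := by
    refine continuous_clm_apply.2 fun w => ?_
    exact e.continuous_toFun.comp
      (e.continuous_inv.comp (continuous_subtype_val.prodMk continuous_const))

end TangentEmbedding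

/-- Complementary families of subspaces over a compact set with closed graphs are continuous
subbundles. -/
theorem isContinuousSubbundleOn_of_isClosed [FiniteDimensional ℝ E] (hK : IsCompact K)
    {B B' : ∀ x : M, Submodule ℝ (TangentSpace 𝓘(ℝ, E) x)} (hB : IsClosed (subbundleGraph K B))
    (hB' : IsClosed (subbundleGraph K B')) (hc : ∀ x ∈ K, IsCompl (B x) (B' x)) {d : ℕ}
    (hd : ∀ x ∈ K, Module.finrank ℝ (B x) = d) : IsContinuousSubbundleOn K B := by
  obtain ⟨t, ⟨e⟩⟩ := exists_tangentEmbedding E hK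
  have : CompactSpace K := isCompact_iff_compactSpace.1 hK
  -- With trivial dynamics any complementary pair with closed graphs is an invariant splitting,
  -- which makes the continuous projection available.
  have hsplit : e.idCocycle.IsSplittingOn univ (e.push B) (e.push B') :=
    { isClosed_u := by simpa using TangentEmbedding.isClosed_push (e := e) hB
      isClosed_s := by simpa using TangentEmbedding.isClosed_push (e := e) hB'
      flow_mem := fun _ _ _ => mem_univ _
      disjoint := fun x _ => (Submodule.disjoint_map (e.injective x.2) (hc x x.2).disjoint)
      sup_eq := fun x _ => by
        rw [TangentEmbedding.push, TangentEmbedding.push, ← Submodule.map_sup,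
          (hc x x.2).sup_eq_top, Submodule.map_top]
        ext w
        constructor
        · rintro ⟨v, rfl⟩
          exact ⟨e.toFun x v, by
            change e.toFun x (e.inv x (e.toFun x v)) = _
            rw [e.inv_toFun x x.2]⟩
        · rintro ⟨w, rfl⟩
          exact ⟨e.inv x w, rfl⟩
      map_u := fun x _ n w hw => by
        obtain ⟨v, hv, rfl⟩ := hw
        refine ⟨v, hv, ?_⟩
        change _ = e.toFun x (e.inv x (e.toFun x v))
        rw [e.inv_toFun x x.2]
        rfl
      map_s := fun x _ n w hw => by
        obtain ⟨v, hv, rfl⟩ := hw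
        refine ⟨v, hv, ?_⟩
        change _ = e.toFun x (e.inv x (e.toFun x v))
        rw [e.inv_toFun x x.2]
        rfl }
  obtain ⟨Q, hQc, hQ⟩ := hsplit.exists_projection
  intro x₀ hx₀
  let b := Module.finBasisOfFinrankEq ℝ (e.push B ⟨x₀, hx₀⟩)
    ((TangentEmbedding.finrank_push (e := e) (B := B) ⟨x₀, hx₀⟩).trans (hd x₀ hx₀))
  -- The frame near `x₀` is obtained by projecting a basis of the fibre at `x₀`; linear independence
  -- is an open condition.
  let g : K → Fin d → (t → E) := fun x i => Q x (b i)
  have hg : Continuous g := by fun_prop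
  have hg0 : g ⟨x₀, hx₀⟩ = fun i => (b i : t → E) := by
    funext i
    have hmem := hQ ⟨x₀, hx₀⟩ (mem_univ _) (b i)
    have hfib := LinearCocycle.mem_fiber.1 (hsplit.u_le (mem_univ _) (b i).2)
    rw [hfib] at hmem
    refine (sub_eq_zero.1 (hsplit.eq_zero (mem_univ _) ?_ hmem.2)).symm
    exact sub_mem (b i).2 hmem.1
  have hopen : IsOpen (g ⁻¹' {h | LinearIndependent ℝ h}) :=
    isOpen_setOfPred_linearIndependent.preimage hg
  obtain ⟨U, hU, hUeq⟩ := isOpen_induced_iff.1 hopen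
  classical
  let s : Fin d → ∀ x : M, TangentSpace 𝓘(ℝ, E) x := fun i x =>
    if h : x ∈ K then e.inv x (g ⟨x, h⟩ i) else 0
  refine ⟨U, hU, ?_, d, s, fun i => ?_, fun x hx => ?_⟩
  · have : (⟨x₀, hx₀⟩ : K) ∈ Subtype.val ⁻¹' U := by
      rw [hUeq]
      change LinearIndependent ℝ (g ⟨x₀, hx₀⟩)
      rw [hg0]
      exact b.linearIndependent.map' (e.push B ⟨x₀, hx₀⟩).subtype (Submodule.ker_subtype _)
    exact this
  · refine ContinuousOn.mono ?_ inter_subset_right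
    rw [continuousOn_iff_continuous_domRestrict]
    have : K.domRestrict (fun x => (⟨x, s i x⟩ : TangentBundle 𝓘(ℝ, E) M)) =
        fun x : K => ⟨(x : M), e.inv x (g x i)⟩ := by
      funext x
      change (⟨(x : M), s i x⟩ : TangentBundle 𝓘(ℝ, E) M) = _
      simp only [s, x.2, dif_pos]
    rw [this]
    exact e.continuous_inv.comp (continuous_subtype_val.prodMk ((continuous_apply i).comp hg))
  · obtain ⟨hxU, hxK⟩ := hx
    have hli : LinearIndependent ℝ (g ⟨x, hxK⟩) := by
      have : (⟨x, hxK⟩ : K) ∈ g ⁻¹' {h | LinearIndependent ℝ h} := by rw [← hUeq]; exact hxU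
      exact this
    have hsx : ∀ i, s i x ∈ B x ∧ e.toFun x (s i x) = g ⟨x, hxK⟩ i := by
      intro i
      obtain ⟨v, hv, hvg⟩ := (hQ ⟨x, hxK⟩ (mem_univ _) (b i)).1
      change e.toFun x v = g ⟨x, hxK⟩ i at hvg
      have : s i x = v := by
        simp only [s, hxK, dif_pos]
        rw [← hvg, e.inv_toFun x hxK]
      rw [this]
      exact ⟨hv, hvg⟩
    have hli' : LinearIndependent ℝ fun i => s i x := by
      refine LinearIndependent.of_comp (e.toFun x) ?_
      have : (e.toFun x ∘ fun i => s i x) = g ⟨x, hxK⟩ := funext fun i => (hsx i).2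
      rwa [this]
    refine ⟨hli', Submodule.eq_of_le_of_finrank_eq ?_ ?_⟩
    · rw [Submodule.span_le]
      rintro _ ⟨i, rfl⟩
      exact (hsx i).1
    · rw [finrank_span_eq_card hli', hd x hxK, Fintype.card_fin]

end Subbundle

/-! ### Norm and conorm on subspaces -/

section Conorm

variable {V W : Type*} [NormedAddCommGroup V] [NormedSpace ℝ V]
  [NormedAddCommGroup W] [NormedSpace ℝ W] {A : V →L[ℝ] W} {S T : Submodule ℝ V}

lemma exists_mem_norm_eq_one (hS : S ≠ ⊥) : ∃ v ∈ S, ‖v‖ = 1 := by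
  obtain ⟨v, hv, hv0⟩ := Submodule.exists_mem_ne_zero_of_ne_bot hS
  exact ⟨‖v‖⁻¹ • v, S.smul_mem _ hv, by rw [norm_smul, norm_inv, norm_norm,
    inv_mul_cancel₀ (norm_ne_zero_iff.2 hv0)]⟩

lemma norm_apply_le_normOn {v : V} (hv : v ∈ S) (h : ‖v‖ = 1) : ‖A v‖ ≤ normOn A S :=
  le_csSup ⟨‖A‖, by rintro _ ⟨v, -, h, rfl⟩; simpa [h] using A.le_opNorm v⟩ ⟨v, hv, h, rfl⟩

lemma conormOn_le_norm_apply {v : V} (hv : v ∈ S) (h : ‖v‖ = 1) : conormOn A S ≤ ‖A v‖ :=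
  csInf_le ⟨0, by rintro _ ⟨v, -, -, rfl⟩; exact norm_nonneg _⟩ ⟨v, hv, h, rfl⟩

lemma normOn_pos (hA : Function.Injective A) (hS : S ≠ ⊥) : 0 < normOn A S := by
  obtain ⟨v, hv, h⟩ := exists_mem_norm_eq_one hS
  refine lt_of_lt_of_le (norm_pos_iff.2 fun h0 => ?_) (norm_apply_le_normOn (A := A) hv h)
  have : v = 0 := hA (by rw [h0, map_zero])
  simp [this] at h

lemma conormOn_pos [FiniteDimensional ℝ V] (hA : Function.Injective A) (hS : S ≠ ⊥) :
    0 < conormOn A S := by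
  obtain ⟨K, hK0, hK⟩ := A.toLinearMap.exists_antilipschitzWith (LinearMap.ker_eq_bot.2 hA)
  have hK0' : (0 : ℝ) < K := by exact_mod_cast hK0
  obtain ⟨v, hv, h⟩ := exists_mem_norm_eq_one hS
  refine lt_of_lt_of_le (inv_pos.2 hK0') (le_csInf ⟨_, v, hv, h, rfl⟩ ?_)
  rintro _ ⟨v, -, h, rfl⟩
  have := hK.le_mul_norm (_root_.map_zero A) v
  rw [inv_le_iff_one_le_mul₀' hK0', ← h]
  exact this

/-- Injectivity makes both the conorm and the norm positive; only then do the logarithms compare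
them, the real logarithm being defined by convention elsewhere. -/
lemma norm_mul_lt_of_log_pos [FiniteDimensional ℝ V] (hA : Function.Injective A)
    (h : 0 < Real.log (conormOn A S) - Real.log (normOn A T)) {u s : V} (hu : u ∈ S) (hs : s ∈ T)
    (hu0 : u ≠ 0) (hs0 : s ≠ 0) : ‖A s‖ * ‖u‖ < ‖A u‖ * ‖s‖ := by
  have pu := norm_pos_iff.2 hu0
  have ps := norm_pos_iff.2 hs0
  have hlt := (Real.log_lt_log_iff (normOn_pos hA (Submodule.ne_bot_iff _ |>.2 ⟨s, hs, hs0⟩))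
    (conormOn_pos hA (Submodule.ne_bot_iff _ |>.2 ⟨u, hu, hu0⟩))).1 (sub_pos.1 h)
  have h1 := conormOn_le_norm_apply (A := A) (S.smul_mem ‖u‖⁻¹ hu)
    (by rw [norm_smul, norm_inv, norm_norm, inv_mul_cancel₀ pu.ne'])
  have h2 := norm_apply_le_normOn (A := A) (T.smul_mem ‖s‖⁻¹ hs)
    (by rw [norm_smul, norm_inv, norm_norm, inv_mul_cancel₀ ps.ne'])
  have h3 := h2.trans_lt (hlt.trans_le h1)
  rw [map_smul, map_smul, norm_smul, norm_smul, norm_inv, norm_inv, norm_norm, norm_norm,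
    inv_mul_eq_div, inv_mul_eq_div, div_lt_div_iff₀ ps pu] at h3
  exact h3

/-- The factor 2 survives passing to the supremum and the infimum and yields a strict inequality
there, which pointwise strict inequalities alone would not. -/
lemma log_pos_of_norm_mul_le [FiniteDimensional ℝ V] (hA : Function.Injective A) (hS : S ≠ ⊥)
    (hT : T ≠ ⊥) (h : ∀ u ∈ S, ∀ s ∈ T, 2 * (‖A s‖ * ‖u‖) ≤ ‖A u‖ * ‖s‖) :
    0 < Real.log (conormOn A S) - Real.log (normOn A T) := by
  rw [sub_pos]
  have hN := normOn_pos hA hT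
  refine Real.log_lt_log hN ?_
  obtain ⟨u₀, hu₀, hu₀1⟩ := exists_mem_norm_eq_one hS
  obtain ⟨s₀, hs₀, hs₀1⟩ := exists_mem_norm_eq_one hT
  have : normOn A T ≤ conormOn A S / 2 := by
    refine csSup_le ⟨_, s₀, hs₀, hs₀1, rfl⟩ ?_
    rintro _ ⟨s, hs, hs1, rfl⟩
    rw [le_div_iff₀ two_pos]
    refine le_csInf ⟨_, u₀, hu₀, hu₀1, rfl⟩ ?_
    rintro _ ⟨u, hu, hu1, rfl⟩
    have := h u hu s hs
    rw [hu1, hs1] at this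
    linarith
  linarith

end Conorm

/-! ### From dominated splittings on the manifold to cocycles -/

section Bridge

variable {E : Type*} [NormedAddCommGroup E] [NormedSpace ℝ E]
  {M : Type*} [MetricSpace M] [ChartedSpace E M]
  {f : M ≃ₘ^1⟮𝓘(ℝ, E), 𝓘(ℝ, E)⟯ M} {K Z : Set M}
  {B : ∀ x : M, Submodule ℝ (TangentSpace 𝓘(ℝ, E) x)}

lemma mfderiv_zIterate_mem (hZ : f '' Z = Z)
    (hB : ∀ x ∈ Z, (B x).map (mfderiv 𝓘(ℝ, E) 𝓘(ℝ, E) f x).toLinearMap = B (f x)) {x : M}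
    (hx : x ∈ Z) (k : ℤ) {v : TangentSpace 𝓘(ℝ, E) x} (hv : v ∈ B x) :
    mfderiv 𝓘(ℝ, E) 𝓘(ℝ, E) (zIterate f k) x v ∈ B (zIterate f k x) := by
  have h1 : ∀ p ∈ subbundleGraph Z B,
      tangentMap 𝓘(ℝ, E) 𝓘(ℝ, E) (zIterate f 1) p ∈ subbundleGraph Z B := by
    rintro p ⟨hp, hpB⟩
    rw [zIterate_one]
    refine ⟨hZ ▸ mem_image_of_mem f hp, ?_⟩
    change mfderiv 𝓘(ℝ, E) 𝓘(ℝ, E) f p.1 p.2 ∈ B (f p.1)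
    rw [← hB _ hp]
    exact ⟨p.2, hpB, rfl⟩
  have h2 : ∀ p ∈ subbundleGraph Z B,
      tangentMap 𝓘(ℝ, E) 𝓘(ℝ, E) (zIterate f (-1)) p ∈ subbundleGraph Z B := by
    rintro ⟨y, w⟩ ⟨hp, hpB⟩
    change y ∈ Z at hp
    change w ∈ B y at hpB
    rw [← hZ] at hp
    obtain ⟨y, hy, rfl⟩ := hp
    rw [← hB _ hy] at hpB
    obtain ⟨v, hv, rfl⟩ := hpB
    have h3 := tangentMap_zIterate_add f (-1) 1 ⟨y, v⟩
    rw [neg_add_cancel, tangentMap_zIterate_zero, zIterate_one] at h3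
    change tangentMap 𝓘(ℝ, E) 𝓘(ℝ, E) (zIterate f (-1))
      (tangentMap 𝓘(ℝ, E) 𝓘(ℝ, E) f ⟨y, v⟩) ∈ _
    rw [← h3]
    exact ⟨hy, hv⟩
  have h3 : ∀ k : ℤ, ∀ p ∈ subbundleGraph Z B,
      tangentMap 𝓘(ℝ, E) 𝓘(ℝ, E) (zIterate f k) p ∈ subbundleGraph Z B := by
    intro k
    induction k using Int.induction_on with
    | zero => intro p hp; rwa [tangentMap_zIterate_zero]
    | succ n ih => intro p hp; rw [tangentMap_zIterate_add]; exact ih _ (h1 p hp)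
    | pred n ih => intro p hp; rw [sub_eq_add_neg, tangentMap_zIterate_add]; exact ih _ (h2 p hp)
  exact (h3 k ⟨x, v⟩ ⟨hx, hv⟩).2

lemma mfderiv_zIterate_injective (k : ℤ) (x : M) :
    Function.Injective (mfderiv 𝓘(ℝ, E) 𝓘(ℝ, E) (zIterate f k) x) := by
  rw [injective_iff_map_eq_zero]
  intro v hv
  by_contra h
  exact mfderiv_zIterate_ne_zero f k h hv

variable [RiemannianBundle (fun x : M => TangentSpace 𝓘(ℝ, E) x)]
  {Eu Es : ∀ x : M, Submodule ℝ (TangentSpace 𝓘(ℝ, E) x)}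

lemma norm_mfderiv_mul_lt [FiniteDimensional ℝ E] {n : ℤ} {x : M}
    (h : 0 < Real.log (conormOn (mfderiv 𝓘(ℝ, E) 𝓘(ℝ, E) (zIterate f n) x) (Eu x)) -
      Real.log (normOn (mfderiv 𝓘(ℝ, E) 𝓘(ℝ, E) (zIterate f n) x) (Es x)))
    {u s : TangentSpace 𝓘(ℝ, E) x} (hu : u ∈ Eu x) (hs : s ∈ Es x) (hu0 : u ≠ 0) (hs0 : s ≠ 0) :
    ‖mfderiv 𝓘(ℝ, E) 𝓘(ℝ, E) (zIterate f n) x s‖ * ‖u‖ <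
      ‖mfderiv 𝓘(ℝ, E) 𝓘(ℝ, E) (zIterate f n) x u‖ * ‖s‖ := by
  have hinj := mfderiv_zIterate_injective (f := f) n x
  have : FiniteDimensional ℝ (TangentSpace 𝓘(ℝ, E) x) := inferInstance
  exact norm_mul_lt_of_log_pos hinj h hu hs hu0 hs0

variable [IsManifold 𝓘(ℝ, E) 1 M]

lemma IsDominatedSplittingOn.exists_log_pos (h : IsDominatedSplittingOn f Z Eu Es) :
    ∃ n : ℤ, 0 < n ∧ ∀ x ∈ Z,
      0 < Real.log (conormOn (mfderiv 𝓘(ℝ, E) 𝓘(ℝ, E) (zIterate f n) x) (Eu x)) -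
        Real.log (normOn (mfderiv 𝓘(ℝ, E) 𝓘(ℝ, E) (zIterate f n) x) (Es x)) := by
  obtain ⟨n₀, hn₀⟩ := h.dominated
  refine ⟨(n₀ + 1 : ℕ), by positivity, fun x hx => ?_⟩
  rw [zIterate_natCast]
  exact hn₀ (n₀ + 1) (Nat.lt_succ_self _) x hx

variable {F : Type*} [NormedAddCommGroup F] [NormedSpace ℝ F] [FiniteDimensional ℝ F]
  {e : TangentEmbedding E K F} {hK : f '' K = K}

lemma TangentEmbedding.isSplittingOn_push (hZ : IsClosed Z) (hfZ : f '' Z = Z)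
    (h : IsDominatedSplittingOn f Z Eu Es) :
    (e.cocycle f hK).IsSplittingOn {x : K | (x : M) ∈ Z} (e.push Eu) (e.push Es) where
  isClosed_u := isClosed_push (h.continuous_u.isClosed_subbundleGraph hZ)
  isClosed_s := isClosed_push (h.continuous_s.isClosed_subbundleGraph hZ)
  flow_mem x hx k := zIterate_mem hfZ hx k
  disjoint x hx := Submodule.disjoint_map (e.injective x.2) (h.isCompl x hx).disjoint
  sup_eq x hx := by
    rw [push, push, ← Submodule.map_sup, (h.isCompl x hx).sup_eq_top, Submodule.map_top,
      cocycle_fiber]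
  map_u x hx k w hw := by
    obtain ⟨v, hv, rfl⟩ := hw
    rw [cocycle_map]
    exact ⟨_, mfderiv_zIterate_mem hfZ h.invariant_u hx k hv, rfl⟩
  map_s x hx k w hw := by
    obtain ⟨v, hv, rfl⟩ := hw
    rw [cocycle_map]
    exact ⟨_, mfderiv_zIterate_mem hfZ h.invariant_s hx k hv, rfl⟩

variable [IsContinuousRiemannianBundle E (fun x : M => TangentSpace 𝓘(ℝ, E) x)]

lemma continuous_norm_tangentBundle :
    Continuous fun p : TangentBundle 𝓘(ℝ, E) M => ‖p.2‖ := by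
  have h : Continuous fun p : TangentBundle 𝓘(ℝ, E) M => inner ℝ p.2 p.2 :=
    Continuous.inner_bundle (F := E) (E := fun x : M => TangentSpace 𝓘(ℝ, E) x)
      (b := fun p : TangentBundle 𝓘(ℝ, E) M => p.1) (v := fun p => p.2) (w := fun p => p.2)
      continuous_id continuous_id
  refine h.sqrt.congr fun p => ?_
  rw [real_inner_self_eq_norm_sq, Real.sqrt_sq (norm_nonneg _)]

namespace TangentEmbedding

/-- This is the Riemannian norm read through the embedding. The domination hypothesis is stated for
it, whereas domination of cocycles uses the norm of the ambient space. -/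
lemma isFiberNorm_inv : (e.cocycle f hK).IsFiberNorm fun x w => ‖e.inv x w‖ where
  continuous := continuous_norm_tangentBundle.comp
    (e.continuous_inv.comp (continuous_subtype_val.prodMap continuous_id))
  smul x c v := by rw [_root_.map_smul, norm_smul, Real.norm_eq_abs]
  pos x v hv hv0 := by
    rw [cocycle_fiber] at hv
    obtain ⟨v, rfl⟩ := hv
    rw [e.inv_toFun x x.2, norm_pos_iff]
    rintro rfl
    exact hv0 (_root_.map_zero _)

/-- One time at which the logarithmic difference is positive supplies the strict inequality for
every pair of vectors; compactness upgrades it to domination with arbitrary constants, in the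
ambient norm. -/
theorem isDominatedOn_push [FiniteDimensional ℝ E] (hKc : IsCompact K) (hZ : IsClosed Z) (hfZ : f '' Z = Z)
    (h : IsDominatedSplittingOn f Z Eu Es) :
    (e.cocycle f hK).IsDominatedOn {x : K | (x : M) ∈ Z} (e.push Eu) (e.push Es) := by
  have : CompactSpace K := isCompact_iff_compactSpace.1 hKc
  refine (isSplittingOn_push hZ hfZ h).isDominatedOn isFiberNorm_inv ?_
  rintro x hx _ ⟨u, hu, rfl⟩ _ ⟨s, hs, rfl⟩ hu0 hs0
  obtain ⟨n, hn, hlog⟩ := h.exists_log_pos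
  refine ⟨n, hn, ?_⟩
  have hlt := norm_mfderiv_mul_lt (hlog x hx) hu hs
    (fun h0 => hu0 (by rw [h0, _root_.map_zero])) (fun h0 => hs0 (by rw [h0, _root_.map_zero]))
  have hinv : ∀ v : TangentSpace 𝓘(ℝ, E) (x : M),
      e.inv ((e.cocycle f hK).flow n x : K) ((e.cocycle f hK).map n x (e.toFun x v)) =
        mfderiv 𝓘(ℝ, E) 𝓘(ℝ, E) (zIterate f n) (x : M) v := fun v => by
    rw [cocycle_map]
    exact e.inv_toFun _ (zIterate_mem hK x.2 _) _
  have hinv0 : ∀ v : TangentSpace 𝓘(ℝ, E) (x : M), e.inv x (e.toFun x v) = v :=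
    e.inv_toFun x x.2
  calc _ = ‖mfderiv 𝓘(ℝ, E) 𝓘(ℝ, E) (zIterate f n) (x : M) s‖ * ‖u‖ := by
        exact congrArg₂ (· * ·) (congrArg norm (hinv s)) (congrArg norm (hinv0 u))
    _ < _ := hlt
    _ = _ := by
        exact (congrArg₂ (· * ·) (congrArg norm (hinv u)) (congrArg norm (hinv0 s))).symm

end TangentEmbedding

end Bridge

/-! ### From cocycles back to the manifold -/

section Transfer

variable {E : Type*} [NormedAddCommGroup E] [NormedSpace ℝ E]
  {M : Type*} [MetricSpace M] [ChartedSpace E M] [IsManifold 𝓘(ℝ, E) 1 M]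
  {f : M ≃ₘ^1⟮𝓘(ℝ, E), 𝓘(ℝ, E)⟯ M} {K Z : Set M}
  {F : Type*} [NormedAddCommGroup F] [NormedSpace ℝ F]
  {e : TangentEmbedding E K F} {hK : f '' K = K}

namespace TangentEmbedding

open Classical in
/-- The family of subspaces of the tangent spaces read from a family of subspaces of the target of
an embedding. -/
noncomputable def pull (e : TangentEmbedding E K F) (S : K → Submodule ℝ F) (x : M) :
    Submodule ℝ (TangentSpace 𝓘(ℝ, E) x) :=
  if h : x ∈ K then (S ⟨x, h⟩).comap (e.toFun x) else ⊥

variable {S T : K → Submodule ℝ F}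

lemma mem_pull {x : M} (hx : x ∈ K) {v : TangentSpace 𝓘(ℝ, E) x} :
    v ∈ e.pull S x ↔ e.toFun x v ∈ S ⟨x, hx⟩ := by
  rw [pull, dif_pos hx, Submodule.mem_comap]

lemma push_pull (x : K) (h : S x ≤ LinearMap.range (e.toFun x)) : e.push (e.pull S) x = S x := by
  rw [push, pull, dif_pos x.2]
  exact Submodule.map_comap_eq_of_le h

lemma pull_eq_of_eq_push {B : ∀ x : M, Submodule ℝ (TangentSpace 𝓘(ℝ, E) x)} {x : M} (hx : x ∈ K)
    (h : S ⟨x, hx⟩ = e.push B ⟨x, hx⟩) : e.pull S x = B x := by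
  ext v
  rw [mem_pull hx, h]
  exact toFun_mem_push (x := ⟨x, hx⟩)

lemma isClosed_subbundleGraph_pull (hK : IsClosed K)
    (h : IsClosed {p : K × F | p.1 ∈ univ ∧ p.2 ∈ S p.1}) :
    IsClosed (subbundleGraph K (e.pull S)) := by
  have h1 := (hK.isClosedEmbedding_subtypeVal.prodMap
    (Topology.IsClosedEmbedding.id (X := F))).isClosedMap _ h
  have h2 : Continuous fun p : TangentBundle 𝓘(ℝ, E) M => (p.1, e.toFun p.1 p.2) :=
    (FiberBundle.continuous_proj E _).prodMk e.continuous_toFun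
  convert h1.preimage h2 using 1
  ext p
  constructor
  · rintro ⟨hp, hpS⟩
    exact ⟨(⟨p.1, hp⟩, e.toFun p.1 p.2), ⟨mem_univ _, (mem_pull hp).1 hpS⟩, rfl⟩
  · rintro ⟨⟨x, w⟩, ⟨-, hw⟩, hxw⟩
    obtain ⟨hx, rfl⟩ := Prod.mk.inj hxw
    have hp : p.1 ∈ K := by rw [← show (x : M) = p.1 from hx]; exact x.2
    have hx' : x = ⟨p.1, hp⟩ := Subtype.ext hx
    subst hx'
    exact ⟨hp, (mem_pull hp).2 hw⟩

lemma finrank_pull {x : M} (hx : x ∈ K) (h : S ⟨x, hx⟩ ≤ LinearMap.range (e.toFun x)) :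
    Module.finrank ℝ (e.pull S x) = Module.finrank ℝ (S ⟨x, hx⟩) := by
  have h1 := finrank_push (e := e) (B := e.pull S) ⟨x, hx⟩
  rw [push_pull ⟨x, hx⟩ h] at h1
  exact h1.symm

variable [FiniteDimensional ℝ F]

lemma isCompl_pull (h : (e.cocycle f hK).IsSplittingOn univ S T) {x : M} (hx : x ∈ K) :
    IsCompl (e.pull S x) (e.pull T x) := by
  constructor
  · rw [Submodule.disjoint_def]
    intro v hv hv'
    have := h.eq_zero (mem_univ _) ((mem_pull hx).1 hv) ((mem_pull hx).1 hv')
    exact e.injective hx (by rw [this, _root_.map_zero])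
  · rw [codisjoint_iff, eq_top_iff]
    intro v _
    have hv : e.toFun x v ∈ S ⟨x, hx⟩ ⊔ T ⟨x, hx⟩ := by
      rw [h.sup_eq _ (mem_univ _), cocycle_fiber]
      exact ⟨v, rfl⟩
    obtain ⟨a, ha, b, hb, hab⟩ := Submodule.mem_sup.1 hv
    have ha' := h.u_le (mem_univ _) ha
    have hb' := h.s_le (mem_univ _) hb
    rw [cocycle_fiber] at ha' hb'
    obtain ⟨a, rfl⟩ := ha'
    obtain ⟨b, rfl⟩ := hb'
    rw [← _root_.map_add] at hab
    rw [← e.injective hx hab]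
    exact Submodule.add_mem_sup ((mem_pull hx).2 ha) ((mem_pull hx).2 hb)

lemma map_mfderiv_pull [FiniteDimensional ℝ E] {d : ℕ} (hle : ∀ x, S x ≤ LinearMap.range (e.toFun x))
    (hd : ∀ x, Module.finrank ℝ (S x) = d)
    (hS : ∀ x n, ∀ v ∈ S x, (e.cocycle f hK).map n x v ∈ S ((e.cocycle f hK).flow n x))
    {x : M} (hx : x ∈ K) :
    (e.pull S x).map (mfderiv 𝓘(ℝ, E) 𝓘(ℝ, E) f x).toLinearMap = e.pull S (f x) := by
  have hfx : f x ∈ K := hK ▸ mem_image_of_mem f hx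
  have hinj : Function.Injective (mfderiv 𝓘(ℝ, E) 𝓘(ℝ, E) f x).toLinearMap := by
    have := mfderiv_zIterate_injective (f := f) 1 x
    rw [zIterate_one] at this
    exact this
  refine Submodule.eq_of_le_of_finrank_eq ?_ ?_
  · rintro _ ⟨v, hv, rfl⟩
    rw [mem_pull hfx]
    have h1 := hS ⟨x, hx⟩ 1 _ ((mem_pull hx).1 hv)
    rw [cocycle_map] at h1
    have h2 : (e.cocycle f hK).flow 1 ⟨x, hx⟩ = ⟨f x, hfx⟩ :=
      Subtype.ext (congrFun (zIterate_one f) x)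
    rw [h2] at h1
    exact h1
  · rw [← (Submodule.equivMapOfInjective _ hinj (e.pull S x)).finrank_eq,
      finrank_pull hx (hle _), finrank_pull hfx (hle _), hd, hd]

/-- The sequence of exponents `k` treats both time directions at once. The scalars are inverses of
Riemannian norms, so the images in the ambient space need not be unit vectors. -/
lemma accumulatesOff_of_mapClusterPt [RiemannianBundle (fun x : M => TangentSpace 𝓘(ℝ, E) x)]
    {B : ∀ x : M, Submodule ℝ (TangentSpace 𝓘(ℝ, E) x)} (hZK : Z ⊆ K) {g : M → M} {k : ℕ → ℤ}
    (hk : ∀ n, g^[n] = zIterate f (k n)) {x : M} (hx : x ∈ K) {v : TangentSpace 𝓘(ℝ, E) x}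
    (h : AccumulatesOn g x v {w | w.1 ∈ Z ∧ w.2 ∉ B w.1}) :
    ∃ c : ℕ → ℝ, ∃ z ∈ {x : K | (x : M) ∈ Z}, ∃ w ∉ e.push B z,
      MapClusterPt (z, w) atTop fun n : ℕ => ((e.cocycle f hK).flow (k n) ⟨x, hx⟩,
        c n • (e.cocycle f hK).map (k n) ⟨x, hx⟩ (e.toFun x v)) := by
  obtain ⟨w, ⟨hwZ, hwB⟩, hcl⟩ := h
  have h2 : Continuous fun p : TangentBundle 𝓘(ℝ, E) M => (p.1, e.toFun p.1 p.2) :=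
    (FiberBundle.continuous_proj E _).prodMk e.continuous_toFun
  have h3 := hcl.continuousAt_comp h2.continuousAt
  refine ⟨fun n => ‖mfderiv 𝓘(ℝ, E) 𝓘(ℝ, E) (zIterate f (k n)) x v‖⁻¹, ⟨w.1, hZK hwZ⟩, hwZ,
    e.toFun w.1 w.2, fun hw => hwB ((toFun_mem_push (x := ⟨w.1, hZK hwZ⟩)).1 hw), ?_⟩
  refine ((Topology.IsInducing.subtypeVal.prodMap (Topology.IsInducing.id (X := F))).mapClusterPt_iff
    (l := map _ atTop)).1 ?_
  rw [MapClusterPt, Filter.map_map]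
  refine (congrArg (MapClusterPt (w.1, e.toFun w.1 w.2) atTop) (funext fun n => ?_)).mpr h3
  have hn : normalizedIterate g x v n = ⟨zIterate f (k n) x,
      ‖mfderiv 𝓘(ℝ, E) 𝓘(ℝ, E) (zIterate f (k n)) x v‖⁻¹ •
        mfderiv 𝓘(ℝ, E) 𝓘(ℝ, E) (zIterate f (k n)) x v⟩ := by
    rw [normalizedIterate, hk]
  rw [Function.comp_apply, Function.comp_apply, hn]
  refine Prod.ext rfl ?_
  change _ • (e.cocycle f hK).map (k n) ⟨x, hx⟩ (e.toFun x v) = e.toFun _ (_ • _)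
  rw [_root_.map_smul, cocycle_map (x := ⟨x, hx⟩)]

variable [RiemannianBundle (fun x : M => TangentSpace 𝓘(ℝ, E) x)]
  {B : ∀ x : M, Submodule ℝ (TangentSpace 𝓘(ℝ, E) x)}

lemma accumulatesOff (hZK : Z ⊆ K) {x : M} (hx : x ∈ K) {v : TangentSpace 𝓘(ℝ, E) x}
    (h : AccumulatesOn f x v {w | w.1 ∈ Z ∧ w.2 ∉ B w.1}) :
    (e.cocycle f hK).AccumulatesOff {x : K | (x : M) ∈ Z} (e.push B) ⟨x, hx⟩ (e.toFun x v) :=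
  accumulatesOff_of_mapClusterPt (hK := hK) hZK (fun n => (zIterate_natCast f n).symm) hx h

lemma reverse_accumulatesOff (hZK : Z ⊆ K) {x : M} (hx : x ∈ K) {v : TangentSpace 𝓘(ℝ, E) x}
    (h : AccumulatesOn f.symm x v {w | w.1 ∈ Z ∧ w.2 ∉ B w.1}) :
    (e.cocycle f hK).reverse.AccumulatesOff {x : K | (x : M) ∈ Z} (e.push B) ⟨x, hx⟩
      (e.toFun x v) :=
  accumulatesOff_of_mapClusterPt (hK := hK) (k := fun n => -n) hZK
    (fun n => (zIterate_neg_natCast f n).symm) hx h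

variable [IsContinuousRiemannianBundle E (fun x : M => TangentSpace 𝓘(ℝ, E) x)]

/-- Cocycle domination is available with any constant: $R^4$ pays for changing norms at four
vectors, and the remaining 2 makes the logarithmic inequality strict. -/
theorem isDominatedSplittingOn_pull [FiniteDimensional ℝ E] (hKc : IsCompact K)
    (h : (e.cocycle f hK).IsDominatedOn univ S T) {d d' : ℕ} (hd0 : d ≠ 0) (hd0' : d' ≠ 0)
    (hd : ∀ x, Module.finrank ℝ (S x) = d) (hd' : ∀ x, Module.finrank ℝ (T x) = d') :
    IsDominatedSplittingOn f K (e.pull S) (e.pull T) := by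
  have : CompactSpace K := isCompact_iff_compactSpace.1 hKc
  have hleS : ∀ x, S x ≤ LinearMap.range (e.toFun x) := fun x => by
    rw [← cocycle_fiber (hK := hK)]; exact h.u_le (mem_univ x)
  have hleT : ∀ x, T x ≤ LinearMap.range (e.toFun x) := fun x => by
    rw [← cocycle_fiber (hK := hK)]; exact h.s_le (mem_univ x)
  have hSd : ∀ x ∈ K, Module.finrank ℝ (e.pull S x) = d := fun x hx => by
    rw [finrank_pull hx (hleS _), hd]
  have hTd : ∀ x ∈ K, Module.finrank ℝ (e.pull T x) = d' := fun x hx => by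
    rw [finrank_pull hx (hleT _), hd']
  have hSne : ∀ x ∈ K, e.pull S x ≠ ⊥ := fun x hx h0 => hd0 (by
    rw [← hSd x hx, h0, finrank_bot])
  have hTne : ∀ x ∈ K, e.pull T x ≠ ⊥ := fun x hx h0 => hd0' (by
    rw [← hTd x hx, h0, finrank_bot])
  have hScl := isClosed_subbundleGraph_pull (e := e) hKc.isClosed h.isClosed_u
  have hTcl := isClosed_subbundleGraph_pull (e := e) hKc.isClosed h.isClosed_s
  have hcompl : ∀ x ∈ K, IsCompl (e.pull S x) (e.pull T x) := fun x hx =>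
    isCompl_pull h.toIsSplittingOn hx
  refine ⟨isContinuousSubbundleOn_of_isClosed hKc hScl hTcl hcompl hSd,
    isContinuousSubbundleOn_of_isClosed hKc hTcl hScl (fun x hx => (hcompl x hx).symm) hTd,
    hSne, hTne, hcompl,
    fun x hx => map_mfderiv_pull hleS hd (fun x n => h.map_u x (mem_univ x) n) hx,
    fun x hx => map_mfderiv_pull hleT hd' (fun x n => h.map_s x (mem_univ x) n) hx, ?_⟩
  obtain ⟨R, hR0, hR⟩ := (isFiberNorm_inv (e := e) (hK := hK)).exists_bound
  obtain ⟨n₀, hn₀⟩ := eventually_atTop.1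
    (LinearCocycle.tendsto_natCast_int_atTop.eventually (h.dominated (2 * R ^ 4)))
  refine ⟨n₀, fun n hn x hx => ?_⟩
  beta_reduce
  rw [← zIterate_natCast]
  refine log_pos_of_norm_mul_le (mfderiv_zIterate_injective n x) (hSne x hx) (hTne x hx) ?_
  intro u hu s hs
  have hdom := hn₀ n hn.le ⟨x, hx⟩ (mem_univ _) _ ((mem_pull hx).1 hu) _ ((mem_pull hx).1 hs)
  rw [cocycle_map, cocycle_map] at hdom
  have hbd : ∀ (y : M) (_ : y ∈ K) (w : TangentSpace 𝓘(ℝ, E) y),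
      ‖w‖ ≤ R * ‖e.toFun y w‖ ∧ ‖e.toFun y w‖ ≤ R * ‖w‖ := by
    intro y hy w
    have := hR ⟨y, hy⟩ (e.toFun y w) (by rw [cocycle_fiber]; exact ⟨w, rfl⟩)
    simp only [e.inv_toFun y hy] at this
    exact this
  set A := mfderiv 𝓘(ℝ, E) 𝓘(ℝ, E) (zIterate f n) x with hA
  have hxn : zIterate f n x ∈ K := zIterate_mem hK hx n
  have hR2 : 0 < R ^ 2 := by positivity
  refine le_of_mul_le_mul_left ?_ hR2
  calc R ^ 2 * (2 * (‖A s‖ * ‖u‖))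
      ≤ R ^ 2 * (2 * ((R * ‖e.toFun _ (A s)‖) * (R * ‖e.toFun x u‖))) := by
        gcongr
        · exact (hbd _ hxn _).1
        · exact (hbd _ hx _).1
    _ = 2 * R ^ 4 * (‖e.toFun _ (A s)‖ * ‖e.toFun x u‖) := by ring
    _ ≤ ‖e.toFun _ (A u)‖ * ‖e.toFun x s‖ := hdom
    _ ≤ (R * ‖A u‖) * (R * ‖s‖) := by
        gcongr
        · exact (hbd _ hxn _).2
        · exact (hbd _ hx _).2
    _ = R ^ 2 * (‖A u‖ * ‖s‖) := by ring

end TangentEmbedding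

end Transfer

/-! ### Extension over a compact invariant set of the manifold -/

section Extension

variable {E : Type*} [NormedAddCommGroup E] [NormedSpace ℝ E] [FiniteDimensional ℝ E]
  {M : Type*} [MetricSpace M] [ChartedSpace E M] [IsManifold 𝓘(ℝ, E) 1 M]
  [RiemannianBundle (fun x : M => TangentSpace 𝓘(ℝ, E) x)]
  [IsContinuousRiemannianBundle E (fun x : M => TangentSpace 𝓘(ℝ, E) x)]
  {f : M ≃ₘ^1⟮𝓘(ℝ, E), 𝓘(ℝ, E)⟯ M} {K Z : Set M}
  {Eu Es : ∀ x : M, Submodule ℝ (TangentSpace 𝓘(ℝ, E) x)}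

/-- A dominated splitting extends from `Z` to a compact invariant set in which all points off `Z`
are wandering and carry a subspace of vectors which accumulate off `Es`. -/
theorem IsDominatedSplittingOn.exists_extension (h : IsDominatedSplittingOn f Z Eu Es)
    (hKc : IsCompact K) (hK : f '' K = K) (hZ : IsClosed Z) (hfZ : f '' Z = Z) (hZK : Z ⊆ K)
    {d : ℕ} (hd : ∀ x ∈ Z, Module.finrank ℝ (Eu x) = d)
    (hw : ∀ x ∈ K \ Z, ∃ W ∈ 𝓝 x, ∀ y ∈ W ∩ K, ∀ n : ℕ, 0 < n → f^[n] y ∉ W)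
    (hV : ∀ x ∈ K \ Z, HasAccumulatingSubspace f d {w | w.1 ∈ Z ∧ w.2 ∉ Es w.1} x) :
    ∃ Eu' Es' : ∀ x : M, Submodule ℝ (TangentSpace 𝓘(ℝ, E) x),
      IsDominatedSplittingOn f K Eu' Es' ∧ (∀ x ∈ Z, Eu' x = Eu x ∧ Es' x = Es x) ∧
      (∀ x ∈ K, Module.finrank ℝ (Eu' x) = d) ∧
      (∀ x ∈ K, ∀ v, AccumulatesOn f.symm x v {w | w.1 ∈ Z ∧ w.2 ∉ Es w.1} → v ∈ Eu' x) ∧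
      (∀ x ∈ K, ∀ v, AccumulatesOn f x v {w | w.1 ∈ Z ∧ w.2 ∉ Eu w.1} → v ∈ Es' x) := by
  obtain ⟨t, ⟨e⟩⟩ := exists_tangentEmbedding E hKc
  have : CompactSpace K := isCompact_iff_compactSpace.1 hKc
  set C := e.cocycle f hK with hC
  set ZK : Set K := {x : K | (x : M) ∈ Z} with hZKdef
  have hdom : C.IsDominatedOn ZK (e.push Eu) (e.push Es) := e.isDominatedOn_push hKc hZ hfZ h
  have hwK : ∀ x ∉ ZK, C.IsWandering x := by
    intro x hx
    obtain ⟨W, hW, hWn⟩ := hw x ⟨x.2, hx⟩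
    refine ⟨Subtype.val ⁻¹' W, continuous_subtype_val.continuousAt hW, fun y hy n hn hyn => ?_⟩
    lift n to ℕ using hn.le
    refine hWn y ⟨hy, y.2⟩ n (by exact_mod_cast hn) ?_
    rw [← zIterate_natCast]
    exact hyn
  obtain ⟨S, T, hST, hagree, hSd, hSacc, hTacc⟩ := hdom.exists_extension (d := d) hwK
    (D := Module.finrank ℝ E) (fun x => TangentEmbedding.finrank_cocycle_fiber x)
    (fun z hz => (TangentEmbedding.finrank_push z).trans (hd z hz)) (by
      intro x hx
      obtain ⟨y, ⟨k, hk⟩, V, hVd, hV⟩ := hV x ⟨x.2, hx⟩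
      have hy : y ∈ K := hk ▸ zIterate_mem hK x.2 k
      have hfl : C.flow k x = ⟨y, hy⟩ := Subtype.ext hk
      refine ⟨k, V.map (e.toFun y), ?_, ?_, ?_⟩
      · rw [hfl, TangentEmbedding.cocycle_fiber]
        exact LinearMap.map_le_range
      · rw [← (Submodule.equivMapOfInjective _ (e.injective hy) V).finrank_eq, hVd]
      · rintro _ ⟨v, hv, rfl⟩ hv0
        have := hV v hv (fun h0 => hv0 (by rw [h0, map_zero]))
        rw [hfl]
        exact ⟨TangentEmbedding.accumulatesOff hZK hy this.1,
          TangentEmbedding.reverse_accumulatesOff hZK hy this.2⟩)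
  have hsum : ∀ x, d + Module.finrank ℝ (T x) = Module.finrank ℝ E := by
    intro x
    have := LinearCocycle.finrank_add_finrank_eq (hST.disjoint x (mem_univ x))
      (hST.sup_eq x (mem_univ x))
    rwa [hSd, TangentEmbedding.finrank_cocycle_fiber] at this
  -- The bundles must be non-zero. Their ranks are read off at a point of `Z`, which exists unless
  -- `K` is empty, since orbits converge to `Z`.
  have hpull : IsDominatedSplittingOn f K (e.pull S) (e.pull T) := by
    rcases K.eq_empty_or_nonempty with rfl | ⟨x, hx⟩
    · exact ⟨fun x hx => hx.elim, fun x hx => hx.elim, fun x hx => hx.elim, fun x hx => hx.elim,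
        fun x hx => hx.elim, fun x hx => hx.elim, fun x hx => hx.elim, 0, fun n _ x hx => hx.elim⟩
    · obtain ⟨z, hz⟩ : ZK.Nonempty := by
        by_contra hne
        obtain ⟨n, hn⟩ := (LinearCocycle.eventually_flow_mem isOpen_empty
          (not_nonempty_iff_eq_empty.1 hne).subset hwK ⟨x, hx⟩).exists
        exact hn
      have h1 : d ≠ 0 := fun h0 => h.ne_bot_u z hz (Submodule.finrank_eq_zero.1
        ((hd z hz).trans h0))
      have h2 : Module.finrank ℝ E - d ≠ 0 := by
        intro h0
        have h3 : Module.finrank ℝ (T z) = 0 := by have := hsum z; lia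
        rw [(hagree z hz).2, TangentEmbedding.finrank_push] at h3
        exact h.ne_bot_s z hz (Submodule.finrank_eq_zero.1 h3)
      exact TangentEmbedding.isDominatedSplittingOn_pull hKc hST h1 h2 hSd
        (fun x => by have := hsum x; lia)
  refine ⟨e.pull S, e.pull T, hpull, fun x hx => ?_, fun x hx => ?_, fun x hx v hv => ?_,
    fun x hx v hv => ?_⟩
  · exact ⟨TangentEmbedding.pull_eq_of_eq_push (hZK hx) (hagree ⟨x, hZK hx⟩ hx).1,
      TangentEmbedding.pull_eq_of_eq_push (hZK hx) (hagree ⟨x, hZK hx⟩ hx).2⟩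
  · rw [TangentEmbedding.finrank_pull hx, hSd]
    have := hST.u_le (mem_univ ⟨x, hx⟩)
    rwa [TangentEmbedding.cocycle_fiber] at this
  · rw [TangentEmbedding.mem_pull hx]
    refine hSacc _ _ ?_ (TangentEmbedding.reverse_accumulatesOff hZK hx hv)
    rw [TangentEmbedding.cocycle_fiber]
    exact ⟨v, rfl⟩
  · rw [TangentEmbedding.mem_pull hx]
    refine hTacc _ _ ?_ (TangentEmbedding.accumulatesOff hZK hx hv)
    rw [TangentEmbedding.cocycle_fiber]
    exact ⟨v, rfl⟩

end Extension

/-! ### Nonwandering points -/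

section Nonwandering

variable {M : Type*} [MetricSpace M] {g : M → M}

/-- The points of `Y` all of whose neighbourhoods in `Y` return to themselves. -/
def nonwanderingOn (g : M → M) (Y : Set M) : Set M :=
  {x | x ∈ Y ∧ ∀ W ∈ 𝓝 x, ∃ y ∈ W ∩ Y, ∃ n : ℕ, 0 < n ∧ g^[n] y ∈ W}

/-- An orbit segment that starts and ends near `x` becomes a closed pseudo-orbit through `x` once
both endpoints are moved to `x`; continuity controls the first jump. -/
lemma nonwanderingOn_subset_chainRecurrentOn (hg : Continuous g) {Y : Set M} (hY : MapsTo g Y Y) :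
    nonwanderingOn g Y ⊆ chainRecurrentOn g Y := by
  rintro x ⟨hx, hnw⟩
  refine ⟨hx, fun ε hε => ?_⟩
  obtain ⟨y, ⟨⟨hyx, hgy⟩, hyY⟩, n, hn, hny, -⟩ := hnw
    (Metric.ball x (ε / 2) ∩ g ⁻¹' Metric.ball (g x) (ε / 2))
    (inter_mem (Metric.ball_mem_nhds x (half_pos hε))
      (hg.continuousAt (Metric.ball_mem_nhds (g x) (half_pos hε))))
  let p : ℕ → M := fun i => if i = 0 ∨ i = n then x else g^[i] y
  refine ⟨n, hn, p, by simp [p], by simp [p], fun i _ => ?_, fun i hi => ?_⟩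
  · by_cases h : i = 0 ∨ i = n
    · simpa only [p, if_pos h] using hx
    · simpa only [p, if_neg h] using hY.iterate i hyY
  · have h1 : dist (g (p i)) (g^[i + 1] y) < ε / 2 := by
      by_cases h : i = 0
      · subst h
        have hgy' : dist (g y) (g x) < ε / 2 := hgy
        simpa only [p, true_or, if_true, zero_add, Function.iterate_one, dist_comm] using hgy'
      · have : ¬(i = 0 ∨ i = n) := by lia
        simp only [p, if_neg this, Function.iterate_succ_apply', dist_self]
        exact half_pos hε
    have h2 : dist (g^[i + 1] y) (p (i + 1)) < ε / 2 := by
      by_cases h : i + 1 = n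
      · subst h
        simpa only [p, or_true, if_true] using Metric.mem_ball.1 hny
      · have : ¬(i + 1 = 0 ∨ i + 1 = n) := by lia
        simp only [p, if_neg this, dist_self]
        exact half_pos hε
    calc dist (g (p i)) (p (i + 1)) ≤ _ := dist_triangle _ (g^[i + 1] y) _
      _ < ε := by linarith

lemma isClosed_nonwanderingOn_univ : IsClosed (nonwanderingOn g univ) := by
  rw [← isOpen_compl_iff, isOpen_iff_mem_nhds]
  intro x hx
  have hx' : ∃ W ∈ 𝓝 x, ∀ y ∈ W, ∀ n : ℕ, 0 < n → g^[n] y ∉ W := by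
    by_contra hcon
    push Not at hcon
    exact hx ⟨mem_univ x, fun W hW => by
      obtain ⟨y, hy, n, hn, hny⟩ := hcon W hW
      exact ⟨y, ⟨hy, mem_univ y⟩, n, hn, hny⟩⟩
  obtain ⟨W, hW, hWn⟩ := hx'
  filter_upwards [eventually_mem_nhds_iff.2 hW] with z hz hzn
  obtain ⟨y, hy, n, hn, hny⟩ := hzn.2 W hz
  exact hWn y hy.1 n hn hny

lemma map_mem_nonwanderingOn_univ {φ : M → M} (hφ : Continuous φ) (hc : Function.Commute φ g)
    {x : M} (hx : x ∈ nonwanderingOn g univ) : φ x ∈ nonwanderingOn g univ := by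
  refine ⟨mem_univ _, fun W hW => ?_⟩
  obtain ⟨y, hy, n, hn, hny⟩ := hx.2 _ (hφ.continuousAt hW)
  exact ⟨φ y, ⟨hy.1, mem_univ _⟩, n, hn, by rw [← (hc.iterate_right n).eq]; exact hny⟩

lemma mem_nonwanderingOn_univ_of_mapClusterPt {x z : M}
    (h : MapClusterPt z atTop fun n => g^[n] x) : z ∈ nonwanderingOn g univ := by
  refine ⟨mem_univ z, fun W hW => ?_⟩
  have hfr := frequently_atTop.1 (h.frequently hW)
  obtain ⟨m, -, hm⟩ := hfr 0
  obtain ⟨n, hn, hnW⟩ := hfr (m + 1)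
  refine ⟨g^[m] x, ⟨hm, mem_univ _⟩, n - m, by lia, ?_⟩
  rw [← Function.iterate_add_apply, Nat.sub_add_cancel (by lia)]
  exact hnW

lemma nonwanderingOn_univ_subset_of_leftInverse {h : M → M} (hh : Function.LeftInverse g h) :
    nonwanderingOn h univ ⊆ nonwanderingOn g univ := by
  rintro x ⟨-, hx⟩
  refine ⟨mem_univ x, fun W hW => ?_⟩
  obtain ⟨y, hy, n, hn, hny⟩ := hx W hW
  exact ⟨h^[n] y, ⟨hny, mem_univ _⟩, n, hn, by rw [hh.iterate n y]; exact hy.1⟩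

end Nonwandering

/-! ### Restricting and gluing dominated splittings -/

section Splitting

variable {E : Type*} [NormedAddCommGroup E] [NormedSpace ℝ E]
  {M : Type*} [MetricSpace M] [ChartedSpace E M] [IsManifold 𝓘(ℝ, E) 1 M]
  {f : M ≃ₘ^1⟮𝓘(ℝ, E), 𝓘(ℝ, E)⟯ M} {Y Z : Set M}
  {Bu Bs Eu Es : ∀ x : M, Submodule ℝ (TangentSpace 𝓘(ℝ, E) x)}

lemma IsContinuousSubbundleOn.congr (h : IsContinuousSubbundleOn Z Eu)
    (hB : ∀ x ∈ Z, Bu x = Eu x) : IsContinuousSubbundleOn Z Bu := by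
  intro x₀ hx₀
  obtain ⟨U, hU, hxU, k, s, hs, hEu⟩ := h x₀ hx₀
  exact ⟨U, hU, hxU, k, s, hs, fun x hx => by rw [hB x hx.2]; exact hEu x hx⟩

variable [RiemannianBundle (fun x : M => TangentSpace 𝓘(ℝ, E) x)]

lemma IsDominatedSplittingOn.congr (h : IsDominatedSplittingOn f Z Eu Es) (hfZ : MapsTo f Z Z)
    (hu : ∀ x ∈ Z, Bu x = Eu x) (hs : ∀ x ∈ Z, Bs x = Es x) :
    IsDominatedSplittingOn f Z Bu Bs where
  continuous_u := h.continuous_u.congr hu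
  continuous_s := h.continuous_s.congr hs
  ne_bot_u x hx := by rw [hu x hx]; exact h.ne_bot_u x hx
  ne_bot_s x hx := by rw [hs x hx]; exact h.ne_bot_s x hx
  isCompl x hx := by rw [hu x hx, hs x hx]; exact h.isCompl x hx
  invariant_u x hx := by rw [hu x hx, hu _ (hfZ hx)]; exact h.invariant_u x hx
  invariant_s x hx := by rw [hs x hx, hs _ (hfZ hx)]; exact h.invariant_s x hx
  dominated := by
    obtain ⟨n₀, hn₀⟩ := h.dominated
    exact ⟨n₀, fun n hn x hx => by
      beta_reduce
      rw [hu x hx, hs x hx]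
      exact hn₀ n hn x hx⟩

lemma IsDominatedSplittingOn.mono (h : IsDominatedSplittingOn f Z Eu Es) (hY : Y ⊆ Z) :
    IsDominatedSplittingOn f Y Eu Es where
  continuous_u := h.continuous_u.mono hY
  continuous_s := h.continuous_s.mono hY
  ne_bot_u x hx := h.ne_bot_u x (hY hx)
  ne_bot_s x hx := h.ne_bot_s x (hY hx)
  isCompl x hx := h.isCompl x (hY hx)
  invariant_u x hx := h.invariant_u x (hY hx)
  invariant_s x hx := h.invariant_s x (hY hx)
  dominated := by
    obtain ⟨n₀, hn₀⟩ := h.dominated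
    exact ⟨n₀, fun n hn x hx => hn₀ n hn x (hY hx)⟩

/-- Frames over the two pieces need not fit together, but graphs that are closed over each piece
have a closed union, and complementary families of constant rank with closed graphs are continuous.
-/
lemma IsDominatedSplittingOn.union [FiniteDimensional ℝ E]
    (hY : IsDominatedSplittingOn f Y Eu Es) (hZ : IsDominatedSplittingOn f Z Eu Es)
    (hYc : IsCompact Y) (hZc : IsCompact Z) {d : ℕ}
    (hd : ∀ x ∈ Y ∪ Z, Module.finrank ℝ (Eu x) = d) :
    IsDominatedSplittingOn f (Y ∪ Z) Eu Es := by
  have hu : IsClosed (subbundleGraph (Y ∪ Z) Eu) := by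
    rw [subbundleGraph_union]
    exact (hY.continuous_u.isClosed_subbundleGraph hYc.isClosed).union
      (hZ.continuous_u.isClosed_subbundleGraph hZc.isClosed)
  have hs : IsClosed (subbundleGraph (Y ∪ Z) Es) := by
    rw [subbundleGraph_union]
    exact (hY.continuous_s.isClosed_subbundleGraph hYc.isClosed).union
      (hZ.continuous_s.isClosed_subbundleGraph hZc.isClosed)
  have hc : ∀ x ∈ Y ∪ Z, IsCompl (Eu x) (Es x) := fun x hx =>
    hx.elim (hY.isCompl x) (hZ.isCompl x)
  have hd' : ∀ x ∈ Y ∪ Z, Module.finrank ℝ (Es x) = Module.finrank ℝ E - d := fun x hx => by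
    have := Submodule.finrank_add_eq_of_isCompl (hc x hx)
    rw [hd x hx, finrank_tangentSpace] at this
    lia
  refine ⟨isContinuousSubbundleOn_of_isClosed (hYc.union hZc) hu hs hc hd,
    isContinuousSubbundleOn_of_isClosed (hYc.union hZc) hs hu (fun x hx => (hc x hx).symm) hd',
    fun x hx => hx.elim (hY.ne_bot_u x) (hZ.ne_bot_u x),
    fun x hx => hx.elim (hY.ne_bot_s x) (hZ.ne_bot_s x), hc,
    fun x hx => hx.elim (hY.invariant_u x) (hZ.invariant_u x),
    fun x hx => hx.elim (hY.invariant_s x) (hZ.invariant_s x), ?_⟩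
  obtain ⟨n₁, hn₁⟩ := hY.dominated
  obtain ⟨n₂, hn₂⟩ := hZ.dominated
  exact ⟨max n₁ n₂, fun n hn x hx => hx.elim (hn₁ n (lt_of_le_of_lt (le_max_left _ _) hn) x)
    (hn₂ n (lt_of_le_of_lt (le_max_right _ _) hn) x)⟩

end Splitting

/-! ### Accumulation of normalized iterates -/

section Accumulation

variable {E : Type*} [NormedAddCommGroup E] [NormedSpace ℝ E]
  {M : Type*} [MetricSpace M] [ChartedSpace E M]
  [RiemannianBundle (fun x : M => TangentSpace 𝓘(ℝ, E) x)]
  {f : M ≃ₘ^1⟮𝓘(ℝ, E), 𝓘(ℝ, E)⟯ M} {Z : Set M} {g : M → M} {x : M}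
  {v : TangentSpace 𝓘(ℝ, E) x} {w : TangentBundle 𝓘(ℝ, E) M}

lemma normalizedIterate_eq {n : ℕ} {k : ℤ} (hk : g^[n] = zIterate f k) :
    normalizedIterate g x v n = ⟨zIterate f k x,
      ‖mfderiv 𝓘(ℝ, E) 𝓘(ℝ, E) (zIterate f k) x v‖⁻¹ •
        mfderiv 𝓘(ℝ, E) 𝓘(ℝ, E) (zIterate f k) x v⟩ := by
  rw [normalizedIterate, hk]

lemma norm_normalizedIterate {k : ℕ → ℤ} (hk : ∀ n, g^[n] = zIterate f (k n)) (hv : v ≠ 0)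
    (n : ℕ) : ‖(normalizedIterate g x v n).2‖ = 1 := by
  rw [normalizedIterate_eq (hk n)]
  change ‖_ • _‖ = 1
  rw [norm_smul, norm_inv, norm_norm,
    inv_mul_cancel₀ (norm_ne_zero_iff.2 (mfderiv_zIterate_ne_zero f (k n) hv))]

variable [IsManifold 𝓘(ℝ, E) 1 M]

lemma mapClusterPt_proj (h : MapClusterPt w atTop (normalizedIterate g x v)) :
    MapClusterPt w.1 atTop fun n => g^[n] x :=
  h.continuousAt_comp (FiberBundle.continuous_proj E _).continuousAt

lemma proj_mem_of_mapClusterPt (hZ : IsClosed Z) (hg : MapsTo g Z Z) (hx : x ∈ Z)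
    (h : MapClusterPt w atTop (normalizedIterate g x v)) : w.1 ∈ Z := by
  by_contra hcon
  obtain ⟨n, hn⟩ := ((mapClusterPt_proj h).frequently (hZ.isOpen_compl.mem_nhds hcon)).exists
  exact hn (hg.iterate n hx)

lemma AccumulatesOn.mono {S T : Set (TangentBundle 𝓘(ℝ, E) M)} (h : AccumulatesOn g x v S)
    (hST : ∀ w ∈ S, MapClusterPt w atTop (normalizedIterate g x v) → w ∈ T) :
    AccumulatesOn g x v T := by
  obtain ⟨w, hw, hcl⟩ := h
  exact ⟨w, hST w hw hcl, hcl⟩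

variable [IsContinuousRiemannianBundle E (fun x : M => TangentSpace 𝓘(ℝ, E) x)]

lemma norm_eq_one_of_mapClusterPt {k : ℕ → ℤ} (hk : ∀ n, g^[n] = zIterate f (k n)) (hv : v ≠ 0)
    (h : MapClusterPt w atTop (normalizedIterate g x v)) : ‖w.2‖ = 1 := by
  by_contra hcon
  obtain ⟨n, hn⟩ := (h.frequently ((isClosed_eq continuous_norm_tangentBundle
    continuous_const).isOpen_compl.mem_nhds hcon)).exists
  exact hn (norm_normalizedIterate hk hv n)

variable [FiniteDimensional ℝ E] [CompactSpace M]

/-- The unit vectors form a closed subset of the image of a compact product under the left inverse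
of an embedding. The map `f` serves only to form a cocycle, whose comparison of norms gives the
radius. -/
lemma isCompact_unitSphere (f : M ≃ₘ^1⟮𝓘(ℝ, E), 𝓘(ℝ, E)⟯ M) :
    IsCompact {p : TangentBundle 𝓘(ℝ, E) M | ‖p.2‖ = 1} := by
  obtain ⟨t, ⟨e⟩⟩ := exists_tangentEmbedding E (isCompact_univ (X := M))
  have : CompactSpace (univ : Set M) := isCompact_iff_compactSpace.1 isCompact_univ
  obtain ⟨R, hR0, hR⟩ := (TangentEmbedding.isFiberNorm_inv (e := e) (f := f)
    (hK := image_univ_of_surjective f.surjective)).exists_bound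
  have : ProperSpace (t → E) := FiniteDimensional.proper_real _
  refine ((isCompact_univ.prod (isCompact_closedBall (0 : t → E) R)).image
    e.continuous_inv).of_isClosed_subset
    (isClosed_eq continuous_norm_tangentBundle continuous_const) ?_
  rintro ⟨y, v⟩ hv
  have hinv := e.inv_toFun y (mem_univ y) v
  refine ⟨(y, e.toFun y v), ⟨mem_univ _, ?_⟩, ?_⟩
  · have h1 := (hR ⟨y, mem_univ y⟩ (e.toFun y v) (by
      rw [TangentEmbedding.cocycle_fiber]; exact ⟨v, rfl⟩)).2
    simp only [hinv] at h1
    rw [mem_closedBall_zero_iff]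
    refine h1.trans_eq ?_
    rw [show ‖v‖ = 1 from hv, mul_one]
  · simp only [hinv]

/-- The iterates of a vector of an invariant continuous subbundle accumulate on unit vectors of this
subbundle. -/
lemma accumulatesOn_of_mem {B B' : ∀ x : M, Submodule ℝ (TangentSpace 𝓘(ℝ, E) x)}
    (hfZ : f '' Z = Z) (hB : IsContinuousSubbundleOn Z B)
    (hinv : ∀ x ∈ Z, (B x).map (mfderiv 𝓘(ℝ, E) 𝓘(ℝ, E) f x).toLinearMap = B (f x))
    (hd : ∀ x ∈ Z, Disjoint (B x) (B' x)) {Ω : Set M} (hΩZ : Ω ⊆ Z) {k : ℕ → ℤ}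
    (hk : ∀ n, g^[n] = zIterate f (k n)) (hΩ : nonwanderingOn g univ ⊆ Ω) (hx : x ∈ Z)
    (hvB : v ∈ B x) (hv : v ≠ 0) : AccumulatesOn g x v {w | w.1 ∈ Ω ∧ w.2 ∉ B' w.1} := by
  obtain ⟨w, -, hw⟩ := (isCompact_unitSphere f).exists_mapClusterPt
    (u := normalizedIterate g x v) (f := atTop)
    (tendsto_principal.2 (Eventually.of_forall (norm_normalizedIterate hk hv)))
  have hwΩ : w.1 ∈ Ω := hΩ (mem_nonwanderingOn_univ_of_mapClusterPt (mapClusterPt_proj hw))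
  have hwB : w.2 ∈ B w.1 := by
    -- The graph of `B` is closed only relatively to `Z`, which may fail to be closed; the limit
    -- point is nonwandering, hence in `Z`.
    refine hB.mem_of_mem_closure ?_ (hΩZ hwΩ)
    refine mem_closure_iff_clusterPt.2 (ClusterPt.mono hw (tendsto_principal.2
      (Eventually.of_forall fun n => ?_)))
    rw [normalizedIterate_eq (hk n)]
    exact ⟨zIterate_mem hfZ hx _,
      Submodule.smul_mem _ _ (mfderiv_zIterate_mem hfZ hinv hx _ hvB)⟩
  refine ⟨w, ⟨hwΩ, fun hwB' => ?_⟩, hw⟩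
  have h1 := norm_eq_one_of_mapClusterPt hk hv hw
  rw [Submodule.disjoint_def.1 (hd _ (hΩZ hwΩ)) _ hwB hwB', norm_zero] at h1
  exact zero_ne_one h1

end Accumulation

/-! ### The two versions of the theorem -/

section Main

variable {E : Type*} [NormedAddCommGroup E] [NormedSpace ℝ E] [FiniteDimensional ℝ E]
  {M : Type*} [MetricSpace M] [ChartedSpace E M] [IsManifold 𝓘(ℝ, E) 1 M]
  [RiemannianBundle (fun x : M => TangentSpace 𝓘(ℝ, E) x)]
  [IsContinuousRiemannianBundle E (fun x : M => TangentSpace 𝓘(ℝ, E) x)]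
  {f : M ≃ₘ^1⟮𝓘(ℝ, E), 𝓘(ℝ, E)⟯ M} {Y Z : Set M}
  {Eu Es : ∀ x : M, Submodule ℝ (TangentSpace 𝓘(ℝ, E) x)} {d : ℕ}

lemma exists_wandering_nhds {g : M → M} {x : M} (hx : x ∈ Y \ nonwanderingOn g Y) :
    ∃ W ∈ 𝓝 x, ∀ y ∈ W ∩ Y, ∀ n : ℕ, 0 < n → g^[n] y ∉ W := by
  by_contra hcon
  push Not at hcon
  exact hx.2 ⟨hx.1, fun W hW => by
    obtain ⟨y, hy, n, hn, hny⟩ := hcon W hW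
    exact ⟨y, hy, n, hn, hny⟩⟩

/-- Orbits in the closed set $Y$ accumulate only on $Y$, so accumulation over $Z$ is accumulation
over $Y\cap Z$. The extension from $Y\cap Z$ to $Y$ agrees with the given splitting there and glues
with it. -/
theorem IsDominatedSplittingOn.exists_extension_union (h : IsDominatedSplittingOn f Z Eu Es)
    (hY : IsCompact Y) (hZ : IsCompact Z) (hfY : f '' Y = Y) (hfZ : f '' Z = Z)
    (hcr : chainRecurrentOn f Y ⊆ Z) (hd : ∀ x ∈ Z, Module.finrank ℝ (Eu x) = d)
    (hV : ∀ x ∈ Y \ Z, HasAccumulatingSubspace f d {w | w.1 ∈ Z ∧ w.2 ∉ Es w.1} x) :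
    ∃ Eu' Es' : ∀ x : M, Submodule ℝ (TangentSpace 𝓘(ℝ, E) x),
      IsDominatedSplittingOn f (Y ∪ Z) Eu' Es' ∧ ∀ x ∈ Z, Eu' x = Eu x ∧ Es' x = Es x := by
  have hmY : MapsTo f Y Y := mapsTo_iff_image_subset.2 hfY.subset
  have hmZ : MapsTo f Z Z := mapsTo_iff_image_subset.2 hfZ.subset
  have hnw : nonwanderingOn f Y ⊆ Z :=
    (nonwanderingOn_subset_chainRecurrentOn f.continuous hmY).trans hcr
  obtain ⟨Eu', Es', h', hagree, hd', -, -⟩ := (h.mono (inter_subset_right (s := Y))).exists_extension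
    hY hfY (hY.inter hZ).isClosed (by rw [image_inter (f := f) f.injective, hfY, hfZ]) inter_subset_left
    (fun x hx => hd x hx.2)
    (fun x hx => exists_wandering_nhds ⟨hx.1, fun hn => hx.2 ⟨hx.1, hnw hn⟩⟩) (by
      intro x hx
      obtain ⟨y, ⟨k, hk⟩, V, hVd, hV⟩ := hV x ⟨hx.1, fun hxZ => hx.2 ⟨hx.1, hxZ⟩⟩
      have hy : y ∈ Y := hk ▸ zIterate_mem hfY hx.1 k
      refine ⟨y, ⟨k, hk⟩, V, hVd, fun v hv hv0 => ⟨(hV v hv hv0).1.mono fun w hw hcl => ?_,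
        (hV v hv hv0).2.mono fun w hw hcl => ?_⟩⟩
      · exact ⟨⟨proj_mem_of_mapClusterPt hY.isClosed hmY hy hcl, hw.1⟩, hw.2⟩
      · exact ⟨⟨proj_mem_of_mapClusterPt hY.isClosed (mapsTo_symm_of_image_eq hfY) hy hcl, hw.1⟩,
          hw.2⟩)
  classical
  let Bu : ∀ x : M, Submodule ℝ (TangentSpace 𝓘(ℝ, E) x) := fun x => if x ∈ Z then Eu x else Eu' x
  let Bs : ∀ x : M, Submodule ℝ (TangentSpace 𝓘(ℝ, E) x) := fun x => if x ∈ Z then Es x else Es' x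
  have huZ : ∀ x ∈ Z, Bu x = Eu x := fun x hx => if_pos hx
  have hsZ : ∀ x ∈ Z, Bs x = Es x := fun x hx => if_pos hx
  have huY : ∀ x ∈ Y, Bu x = Eu' x := fun x hx => by
    by_cases hxZ : x ∈ Z
    · rw [huZ x hxZ, (hagree x ⟨hx, hxZ⟩).1]
    · exact if_neg hxZ
  have hsY : ∀ x ∈ Y, Bs x = Es' x := fun x hx => by
    by_cases hxZ : x ∈ Z
    · rw [hsZ x hxZ, (hagree x ⟨hx, hxZ⟩).2]
    · exact if_neg hxZ
  refine ⟨Bu, Bs, (h'.congr hmY huY hsY).union (h.congr hmZ huZ hsZ) hY hZ (d := d) ?_,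
    fun x hx => ⟨huZ x hx, hsZ x hx⟩⟩
  rintro x (hx | hx)
  · rw [huY x hx, hd' x hx]
  · rw [huZ x hx, hd x hx]

theorem IsDominatedSplittingOn.exists_extension_univ [CompactSpace M]
    (h : IsDominatedSplittingOn f Z Eu Es) (hfZ : f '' Z = Z) (hcr : chainRecurrentOn f univ ⊆ Z)
    (hd : ∀ x ∈ Z, Module.finrank ℝ (Eu x) = d)
    (hV : ∀ x, x ∉ Z → HasAccumulatingSubspace f d {w | w.1 ∈ Z ∧ w.2 ∈ Eu w.1} x) :
    ∃ Eu' Es' : ∀ x : M, Submodule ℝ (TangentSpace 𝓘(ℝ, E) x),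
      IsDominatedSplittingOn f univ Eu' Es' ∧ ∀ x ∈ Z, Eu' x = Eu x ∧ Es' x = Es x := by
  set Ω : Set M := nonwanderingOn f univ with hΩ
  have hΩZ : Ω ⊆ Z :=
    (nonwanderingOn_subset_chainRecurrentOn f.continuous (mapsTo_univ _ _)).trans hcr
  have hleft : Function.LeftInverse f f.symm := f.toEquiv.apply_symm_apply
  have hright : Function.LeftInverse f.symm f := f.toEquiv.symm_apply_apply
  have hΩsymm : nonwanderingOn f.symm univ ⊆ Ω := nonwanderingOn_univ_subset_of_leftInverse hleft
  have hfΩ : f '' Ω = Ω := by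
    refine Subset.antisymm (image_subset_iff.2 fun x hx =>
      map_mem_nonwanderingOn_univ f.continuous (Function.Commute.refl f) hx) fun x hx => ?_
    exact ⟨f.symm x, map_mem_nonwanderingOn_univ f.symm.continuous
      (fun y => by rw [hleft, hright]) hx, hleft x⟩
  have hkf : ∀ n : ℕ, (f : M → M)^[n] = zIterate f n := fun n => (zIterate_natCast f n).symm
  have hks : ∀ n : ℕ, (f.symm : M → M)^[n] = zIterate f (-n) :=
    fun n => (zIterate_neg_natCast f n).symm
  have hdisj : ∀ x ∈ Z, Disjoint (Eu x) (Es x) := fun x hx => (h.isCompl x hx).disjoint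
  -- Limit points of orbits are nonwandering and limits of normalized vectors have norm one, so
  -- accumulation on $E^u$ over $Z$ is accumulation over the nonwandering set off $E^s$.
  have hoff : ∀ {g : M → M} {k : ℕ → ℤ} (_ : ∀ n, g^[n] = zIterate f (k n))
      (_ : nonwanderingOn g univ ⊆ Ω) {y : M} {v : TangentSpace 𝓘(ℝ, E) y} (_ : v ≠ 0)
      (_ : AccumulatesOn g y v {w | w.1 ∈ Z ∧ w.2 ∈ Eu w.1}),
      AccumulatesOn g y v {w | w.1 ∈ Ω ∧ w.2 ∉ Es w.1} := by
    intro g k hk hg y v hv hacc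
    refine hacc.mono fun w hw hcl => ⟨hg (mem_nonwanderingOn_univ_of_mapClusterPt
      (mapClusterPt_proj hcl)), fun hws => ?_⟩
    have h1 := norm_eq_one_of_mapClusterPt hk hv hcl
    rw [Submodule.disjoint_def.1 (hdisj _ hw.1) _ hw.2 hws, norm_zero] at h1
    exact zero_ne_one h1
  obtain ⟨Eu', Es', h', -, hd', hu, hs⟩ := (h.mono hΩZ).exists_extension isCompact_univ
    (image_univ_of_surjective f.surjective) isClosed_nonwanderingOn_univ hfΩ (subset_univ Ω)
    (fun x hx => hd x (hΩZ hx)) (fun x hx => exists_wandering_nhds hx) (by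
      intro x hx
      by_cases hxZ : x ∈ Z
      -- At wandering points of $Z$ the given $E^u$ itself plays the role of $V$.
      · refine ⟨x, ⟨0, rfl⟩, Eu x, hd x hxZ, fun v hv hv0 => ⟨?_, ?_⟩⟩
        · exact accumulatesOn_of_mem hfZ h.continuous_u h.invariant_u hdisj hΩZ hkf subset_rfl
            hxZ hv hv0
        · exact accumulatesOn_of_mem hfZ h.continuous_u h.invariant_u hdisj hΩZ hks hΩsymm
            hxZ hv hv0
      · obtain ⟨y, hy, V, hVd, hV⟩ := hV x hxZ
        exact ⟨y, hy, V, hVd, fun v hv hv0 => ⟨hoff hkf subset_rfl hv0 (hV v hv hv0).1,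
          hoff hks hΩsymm hv0 (hV v hv hv0).2⟩⟩)
  refine ⟨Eu', Es', h', fun x hx => ?_⟩
  -- So far the extension is known to agree only over the nonwandering set. Over $Z$, backward
  -- accumulation places $E^u$ in the new unstable space and forward accumulation places $E^s$ in
  -- the new stable one; the ranks then force equality.
  have hleu : Eu x ≤ Eu' x := fun v hv => by
    rcases eq_or_ne v 0 with rfl | hv0
    · exact zero_mem _
    · exact hu x (mem_univ x) v (accumulatesOn_of_mem hfZ h.continuous_u h.invariant_u hdisj hΩZ hks
        hΩsymm hx hv hv0)
  have hles : Es x ≤ Es' x := fun v hv => by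
    rcases eq_or_ne v 0 with rfl | hv0
    · exact zero_mem _
    · exact hs x (mem_univ x) v (accumulatesOn_of_mem hfZ h.continuous_s h.invariant_s
        (fun x hx => (hdisj x hx).symm) hΩZ hkf subset_rfl hx hv hv0)
  have h1 := Submodule.finrank_add_eq_of_isCompl (h.isCompl x hx)
  have h2 := Submodule.finrank_add_eq_of_isCompl (h'.isCompl x (mem_univ x))
  have h3 : Module.finrank ℝ (Eu x) = Module.finrank ℝ (Eu' x) := by
    rw [hd x hx, hd' x (mem_univ x)]
  exact ⟨(Submodule.eq_of_le_of_finrank_eq hleu h3).symm,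
    (Submodule.eq_of_le_of_finrank_eq hles (by lia)).symm⟩

end Main

theorem theorem3p1 {E : Type*} [NormedAddCommGroup E] [NormedSpace ℝ E] [FiniteDimensional ℝ E]
    {M : Type*} [MetricSpace M] [ChartedSpace E M] [IsManifold 𝓘(ℝ, E) 1 M]
    [RiemannianBundle (fun x : M => TangentSpace 𝓘(ℝ, E) x)]
    [IsContinuousRiemannianBundle E (fun x : M => TangentSpace 𝓘(ℝ, E) x)]
    (f : M ≃ₘ^1⟮𝓘(ℝ, E), 𝓘(ℝ, E)⟯ M) :
    -- the closed manifold version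
    (CompactSpace M →
      ∀ (Z : Set M) (Eu Es : ∀ x : M, Submodule ℝ (TangentSpace 𝓘(ℝ, E) x)) (d : ℕ),
        f '' Z = Z →
        chainRecurrentOn f univ ⊆ Z →
        IsDominatedSplittingOn f Z Eu Es →
        (∀ x ∈ Z, Module.finrank ℝ (Eu x) = d) →
        (∀ x, x ∉ Z → HasAccumulatingSubspace f d {w | w.1 ∈ Z ∧ w.2 ∈ Eu w.1} x) →
        ∃ Eu' Es' : ∀ x : M, Submodule ℝ (TangentSpace 𝓘(ℝ, E) x),
          IsDominatedSplittingOn f univ Eu' Es' ∧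
          ∀ x ∈ Z, Eu' x = Eu x ∧ Es' x = Es x) ∧
    -- the general version
    (∀ (Y Z : Set M) (Eu Es : ∀ x : M, Submodule ℝ (TangentSpace 𝓘(ℝ, E) x)) (d : ℕ),
      IsCompact Y → IsCompact Z →
      f '' Y = Y → f '' Z = Z →
      chainRecurrentOn f Y ⊆ Z →
      IsDominatedSplittingOn f Z Eu Es →
      (∀ x ∈ Z, Module.finrank ℝ (Eu x) = d) →
      (∀ x ∈ Y \ Z, HasAccumulatingSubspace f d {w | w.1 ∈ Z ∧ w.2 ∉ Es w.1} x) →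
      ∃ Eu' Es' : ∀ x : M, Submodule ℝ (TangentSpace 𝓘(ℝ, E) x),
        IsDominatedSplittingOn f (Y ∪ Z) Eu' Es' ∧
        ∀ x ∈ Z, Eu' x = Eu x ∧ Es' x = Es x) :=
  ⟨fun _ _ _ _ _ hfZ hcr h hd hV => h.exists_extension_univ hfZ hcr hd hV,
    fun _ _ _ _ _ hY hZ hfY hfZ hcr h hd hV =>
      h.exists_extension_union hY hZ hfY hfZ hcr hd hV⟩
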